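/- **Setting.** Let $\mathcal X$ be a measurable space with a $\sigma$-finite measure $\nu$ (e.g. a Borel subset of $\mathbb R^d$ with Lebesgue measure). One observes i.i.d. $(X_i,Y_i)$, $i=1,\dots,n$, with $$Y_i=\mu(X_i)+\sigma(X_i)\epsilon_i ,$$ where $X_i$ has density $h$ with respect to $\nu$, $\epsilon_i$ is independent of $X_i$ and has a known Lebesgue density $f$ whose $\tau$-th quantile $\inf\{y:F(y)\ge\tau\}$ is $0$, for a given $\tau\in(0,1)$; so $\mu$ is the $\tau$-th conditional quantile function of $Y$ given $X$. The unknown functions satisfy $\mu\in\mathcal U$, $\sigma\in\Sigma$, $h\in\mathcal H$, where $\mathcal U$ and $\Sigma\neq\emptyset$ are classes of measurable functions with $\sup_{\mu\in\mathcal U}\|\mu\|_\infty<\infty$ and $\overline\sigma^{-1}\le\sigma(x)\le\overline\sigma$ for all $\sigma\in\Sigma$, $x\in\mathcal X$ and some $\overline\sigma>1$, and $\mathcal H$ is a class of probability densities with respect to $\nu$. Write $\|u-v\|_{2,h}^2=\int (u-v)^2h\,d\nu$. For a class $\mathcal G$ that is totally bounded in $L_2(h_0)$, let $M_{h_0}(\varepsilon;\mathcal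 G)$ be the logarithm of the maximal cardinality of a finite subset of $\mathcal G$ whose distinct elements have $\|\cdot\|_{2,h_0}$-distance $>\varepsilon$. For nonnegative quantities, $a\asymp b$ means that each is $O$ of the other. **Assumptions.** (a) There are $h_0\in\mathcal H$ and $C<\infty$ with $h(x)\le C\,h_0(x)$ for all $h\in\mathcal H$ and $x\in\mathcal X$. (b) $\mathcal U$ and $\Sigma$ are totally bounded in $L_2(h_0)$, and there is a function $M$ with $M(\varepsilon)\asymp M_{h_0}(\varepsilon;\mathcal U)$ as $\varepsilon\to0^+$ which is rich, i.e. $\liminf_{\varepsilon\to0^+}M(\alpha\varepsilon)/M(\varepsilon)>1$ for some $0<\alpha<1$, and order regular, i.e. $M(c\varepsilon)\asymp M(\varepsilon)$ as $\varepsilon\to0^+$ for every $c>0$. Moreover $M_{h_0}(\varepsilon;\Sigma)=O(M_{h_0}(\varepsilon;\mathcal U))$ as $\varepsilon\to0^+$. (c) With $\rho_\kappa(y)=y(\kappa-I(y<0))$ and $\Gamma(t,k)=\int_k^\infty x^{t-1}e^{-x}dx$, the density $f$ is, for some $\eta\in\mathbb R$, $s>0$ and $0<\kappa<1$, one of the following: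 - asymmetric Laplace: $\frac{\kappa(1-\kappa)}{s}\exp[-\rho_\kappa(\frac{y-\eta}{s})]$; - asymmetric connected double truncated gamma, with $\alpha\ge0$: $\frac{\kappa(1-\kappa)}{s\,\Gamma(\alpha+1,\alpha)}[\alpha+\rho_\kappa(\frac{y-\eta}{s})]^{\alpha}\exp\{-[\alpha+\rho_\kappa(\frac{y-\eta}{s})]\}$; - connected normal-Laplace, with $\beta>0$ and $\frac{1-\kappa}{\beta}=\frac{2\kappa}{\sqrt{2\pi}}$: $\frac{2\kappa}{\sqrt{2\pi}\,s}e^{-(y-\eta)^2/(2s^2)}I(y\le\eta)+\frac{1-\kappa}{\beta s}e^{-(y-\eta)/(\beta s)}I(y>\eta)$; - Cauchy: $\frac{1}{\pi s[1+((y-\eta)/s)^2]}$. (For the first three families the $\tau$-th quantile is $0$ in particular when $\kappa=\tau$ and $\eta=0$; for the Cauchy density when $\tau=1/2$ and $\eta=0$.) **Conclusion.** There is a sequence $\varepsilon_n$, positive for all large $n$, solving $$M_{h_0}(\varepsilon_n;\mathcal U)= n\varepsilon_n^2$$ in order, i.e. $M_{h_0}(\varepsilon_n;\mathcal U)\asymp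 n\varepsilon_n^2$ as $n\to\infty$. For every such sequence (in particular for every exact solution with $\varepsilon_n>0$), $$\inf_{\hat\mu}\ \sup_{\mu\in\mathcal U,\ \sigma\in\Sigma,\ h\in\mathcal H}\mathbb E\,\|\mu-\hat\mu\|_{2,h}^2\ \asymp\ \varepsilon_n^2\qquad(n\to\infty),$$ where the infimum is over all measurable estimators $\hat\mu$ of $\mu$ based on $(X_i,Y_i)_{i=1}^n$. -/

import Mathlib

open MeasureTheory Filter Topology Asymptotics

noncomputable section

namespace LocScale

/-! ### Error densities -/

/-- The check loss `ρ_κ(y) = y (κ - 1{y < 0})`. -/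
def checkLoss (κ y : ℝ) : ℝ := y * (κ - if y < 0 then 1 else 0)

/-- The upper incomplete gamma function `Γ(t, k) = ∫_k^∞ x^(t-1) e^(-x) dx`. -/
def upperGamma (t k : ℝ) : ℝ := ∫ x in Set.Ioi k, x ^ (t - 1) * Real.exp (-x)

/-- Asymmetric Laplace density with location `η`, scale `s`, skewness `κ`. -/
def aldPDF (η s κ y : ℝ) : ℝ :=
  κ * (1 - κ) / s * Real.exp (-checkLoss κ ((y - η) / s))

/-- Asymmetric connected double truncated gamma density with location `η`, scale `s`,
shape `a`, skewness `κ`. -/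
def acdtgPDF (η s a κ y : ℝ) : ℝ :=
  κ * (1 - κ) / (s * upperGamma (a + 1) a) * (a + checkLoss κ ((y - η) / s)) ^ a *
    Real.exp (-(a + checkLoss κ ((y - η) / s)))

/-- Connected normal-Laplace density with location `η`, scale `s`, proportion `κ` and
additional right-hand scale `β`. -/
def cnlPDF (η s κ β y : ℝ) : ℝ :=
  if y ≤ η then
    2 * κ / (√(2 * Real.pi) * s) * Real.exp (-(y - η) ^ 2 / (2 * s ^ 2))
  else
    (1 - κ) / (β * s) * Real.exp (-(1 / (β * s)) * (y - η))

/-- The four families of error densities. -/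
inductive IsErrorDensity : (ℝ → ℝ) → Prop
  | ald (η s κ : ℝ) (hs : 0 < s) (hκ0 : 0 < κ) (hκ1 : κ < 1) :
      IsErrorDensity (aldPDF η s κ)
  | acdtg (η s a κ : ℝ) (hs : 0 < s) (ha : 0 ≤ a) (hκ0 : 0 < κ) (hκ1 : κ < 1) :
      IsErrorDensity (acdtgPDF η s a κ)
  | cnl (η s κ β : ℝ) (hs : 0 < s) (hκ0 : 0 < κ) (hκ1 : κ < 1) (hβ : 0 < β)
      (hc : (1 - κ) / β = 2 * κ / √(2 * Real.pi)) :
      IsErrorDensity (cnlPDF η s κ β)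
  | cauchy (η : ℝ) (s : NNReal) (hs : 0 < s) :
      IsErrorDensity (ProbabilityTheory.cauchyPDFReal η s)

/-- The law on `ℝ` with Lebesgue density `f`. -/
def errorLaw (f : ℝ → ℝ) : Measure ℝ := volume.withDensity fun y => ENNReal.ofReal (f y)

/-- The `τ`-th quantile `inf {y : F(y) ≥ τ}` of a law on `ℝ` with distribution function `F`. -/
def quantile (P : Measure ℝ) (τ : ℝ) : ℝ := sInf {y : ℝ | ENNReal.ofReal τ ≤ P (Set.Iic y)}

/-! ### The regression model and its minimax risk -/

variable {X : Type*} [MeasurableSpace X]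

/-- `h` is a probability density with respect to `ν`. -/
def IsProbDensity (ν : Measure X) (h : X → ℝ) : Prop :=
  Measurable h ∧ (∀ x, 0 ≤ h x) ∧ ∫⁻ x, ENNReal.ofReal (h x) ∂ν = 1

/-- The law of one observation `(x, μ(x) + σ(x) ε)`, where `x` has density `h`, the error `ε`
has density `f`, and `x` and `ε` are independent. -/
def obsLaw (ν : Measure X) (f : ℝ → ℝ) (μ σ h : X → ℝ) : Measure (X × ℝ) :=
  ((ν.withDensity fun x => ENNReal.ofReal (h x)).prod (errorLaw f)).map
    fun p => (p.1, μ p.1 + σ p.1 * p.2)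

/-- The squared `L₂(h)` distance `∫ (u - v)² h dν`. -/
def l2DistSq (ν : Measure X) (h u v : X → ℝ) : ENNReal :=
  ∫⁻ x, ENNReal.ofReal ((u x - v x) ^ 2 * h x) ∂ν

/-- The `L₂(h)` distance. -/
def l2Dist (ν : Measure X) (h u v : X → ℝ) : ENNReal := l2DistSq ν h u v ^ (1 / 2 : ℝ)

/-- Expected squared `L₂(h)` loss of the estimator `m` based on `n` i.i.d. observations. -/
def risk (ν : Measure X) (f : ℝ → ℝ) (n : ℕ) (m : (Fin n → X × ℝ) → X → ℝ) (μ σ h : X → ℝ) :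
    ENNReal :=
  ∫⁻ d, l2DistSq ν h μ (m d) ∂(Measure.pi fun _ : Fin n => obsLaw ν f μ σ h)

/-- The minimax risk: infimum over all (jointly measurable) estimators of the worst-case risk over
`μ ∈ U`, `σ ∈ S`, `h ∈ H`. -/
def minimaxRisk (ν : Measure X) (f : ℝ → ℝ) (U S H : Set (X → ℝ)) (n : ℕ) : ENNReal :=
  ⨅ (m : (Fin n → X × ℝ) → X → ℝ) (_ : Measurable (Function.uncurry m)),
    ⨆ μ ∈ U, ⨆ σ ∈ S, ⨆ h ∈ H, risk ν f n m μ σ h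

/-! ### Metric entropy -/

/-- Maximal cardinality of a finite subset of `U` whose distinct elements are at `L₂(h)` distance
larger than `ε`. -/
def packingNumber (ν : Measure X) (h : X → ℝ) (U : Set (X → ℝ)) (ε : ℝ) : ℕ∞ :=
  ⨆ (N : Finset (X → ℝ)) (_ : (N : Set (X → ℝ)) ⊆ U)
    (_ : (N : Set (X → ℝ)).Pairwise fun u v => ENNReal.ofReal ε < l2Dist ν h u v), (N.card : ℕ∞)

/-- Total boundedness in `L₂(h)`: all packing numbers are finite. -/
def TotallyBoundedL2 (ν : Measure X) (h : X → ℝ) (U : Set (X → ℝ)) : Prop :=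
  ∀ ε : ℝ, 0 < ε → packingNumber ν h U ε ≠ ⊤

/-- Packing `ε`-entropy in `L₂(h)` (used only for totally bounded classes and `ε > 0`). -/
def packingEntropy (ν : Measure X) (h : X → ℝ) (U : Set (X → ℝ)) (ε : ℝ) : ℝ :=
  Real.log ((packingNumber ν h U ε).toNat : ℝ)

/-- Richness: `liminf_{ε → 0} M(αε) / M(ε) > 1` for some `0 < α < 1`; the lower limit is taken in
the extended reals. -/
def IsRich (M : ℝ → ℝ) : Prop :=
  ∃ α : ℝ, 0 < α ∧ α < 1 ∧
    1 < liminf (fun ε : ℝ => ((M (α * ε) / M ε : ℝ) : EReal)) (𝓝[>] (0 : ℝ))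

/-- Order regularity: `M(cε) ≍ M(ε)` as `ε → 0`, for every `c > 0`. -/
def IsOrderRegular (M : ℝ → ℝ) : Prop :=
  ∀ c : ℝ, 0 < c → (fun ε => M (c * ε)) =Θ[𝓝[>] (0 : ℝ)] M

/-- The entropy condition: the `L₂(h₀)` entropy of `U` has an order `M` which is rich and regular,
and the entropy of `S` is at most of the order of the entropy of `U`. -/
def EntropyCondition (ν : Measure X) (h₀ : X → ℝ) (U S : Set (X → ℝ)) : Prop :=
  TotallyBoundedL2 ν h₀ U ∧ TotallyBoundedL2 ν h₀ S ∧
  (∃ M : ℝ → ℝ, M =Θ[𝓝[>] (0 : ℝ)] packingEntropy ν h₀ U ∧ IsRich M ∧ IsOrderRegular M) ∧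
  packingEntropy ν h₀ S =O[𝓝[>] (0 : ℝ)] packingEntropy ν h₀ U

/-- `ε` solves `M_{h₀}(ε_n; U) = n ε_n²` in order. An exact solution satisfies this, and so does
any vanishing solution of `M(ε_n) = n ε_n²` for a function `M` of the order of the entropy. -/
def SolvesEntropyEquation (ν : Measure X) (h₀ : X → ℝ) (U : Set (X → ℝ)) (ε : ℕ → ℝ) : Prop :=
  (∀ᶠ n in atTop, 0 < ε n) ∧
    (fun n => packingEntropy ν h₀ U (ε n)) =Θ[atTop] fun n : ℕ => (n : ℝ) * ε n ^ 2

/-- `R_n ≍ ε_n²` for an extended nonnegative sequence `R`. -/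
def HasSqRate (R : ℕ → ENNReal) (ε : ℕ → ℝ) : Prop :=
  ∃ c C : ℝ, 0 < c ∧ 0 < C ∧ ∀ᶠ n in atTop,
    ENNReal.ofReal (c * ε n ^ 2) ≤ R n ∧ R n ≤ ENNReal.ofReal (C * ε n ^ 2)

end LocScale

end

/-! Richness provides a packing, of log-cardinality at least a large multiple of `n ε_n²`, inside a
set of regression functions of diameter of order `ε_n`. The log-densities of the location-scale
family are Lipschitz in the parameters with a square integrable envelope, so the Kullback-Leibler
divergences within this packing are `O(n ε_n²)` and a change of measure shows that no estimator can
tell its elements apart: this is the lower bound. For the upper bound, take the Bayes predictive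
density of a mixture over maximal packings of the two classes. Its cumulative Kullback-Leibler risk
telescopes to at most the log-cardinality of the mixture plus `n` times a squared approximation
error, hence to `O(n ε_n²)`. Averaged over the sample sizes up to `n`, it controls the Hellinger
distance between the true and the predictive conditional densities, and since the error density is
bounded below near its quantile, this distance controls the distance between their `τ`-th
quantiles. -/

open ProbabilityTheory
open scoped ENNReal

namespace LocScale

/-! ### Finite products of probability measures -/

section Products

variable {ι κ : Type*} [Fintype ι] [Fintype κ]

section Dependent

variable {α : ι → Type*} [∀ i, MeasurableSpace (α i)] (P : ∀ i, Measure (α i))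
  [∀ i, IsProbabilityMeasure (P i)]

theorem lintegral_fintype_prod_eq_prod {g : ∀ i, α i → ℝ≥0∞} (hg : ∀ i, Measurable (g i)) :
    ∫⁻ d, ∏ i, g i (d i) ∂(Measure.pi P) = ∏ i, ∫⁻ z, g i z ∂P i := by
  rw [lintegral_prod_eq_prod_lintegral_of_indepFun Finset.univ _
    (iIndepFun_pi fun i => (hg i).aemeasurable) fun i => (hg i).comp (measurable_pi_apply i)]
  exact Finset.prod_congr rfl fun i _ => (measurePreserving_eval P i).lintegral_comp (hg i)

theorem pi_withDensity {r : ∀ i, α i → ℝ≥0∞} (hr : ∀ i, Measurable (r i))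
    [∀ i, SigmaFinite ((P i).withDensity (r i))] :
    Measure.pi (fun i => (P i).withDensity (r i)) =
      (Measure.pi P).withDensity fun d => ∏ i, r i (d i) := by
  classical
  refine Measure.pi_eq fun s hs => ?_
  have hbox : MeasurableSet (Set.univ.pi s) := MeasurableSet.univ_pi hs
  have hind : (Set.univ.pi s).indicator (fun d => ∏ i, r i (d i)) =
      fun d => ∏ i, (s i).indicator (r i) (d i) := by
    ext d
    by_cases hd : ∀ i, d i ∈ s i
    · simp [Set.indicator, hd]
    · obtain ⟨i, hi⟩ := not_forall.mp hd
      rw [Set.indicator_of_notMem fun h : d ∈ Set.univ.pi s => hi (h i trivial),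
        Finset.prod_eq_zero (Finset.mem_univ i) (Set.indicator_of_notMem hi _)]
  rw [withDensity_apply _ hbox, ← lintegral_indicator hbox, hind,
    lintegral_fintype_prod_eq_prod P fun i => (hr i).indicator (hs i)]
  exact Finset.prod_congr rfl fun i _ => by
    rw [lintegral_indicator (hs i), withDensity_apply _ (hs i)]

theorem measurePreserving_pi_comp_of_injective {e : κ → ι} (he : e.Injective) :
    MeasurePreserving (fun (d : ∀ i, α i) k => d (e k)) (Measure.pi P)
      (Measure.pi fun k => P (e k)) := by
  have hind : iIndepFun (fun i (d : ∀ i, α i) => d i) (Measure.pi P) :=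
    iIndepFun_pi fun i => (measurable_id (α := α i)).aemeasurable
  refine ⟨by fun_prop, ?_⟩
  rw [(iIndepFun_iff_map_fun_eq_pi_map fun k => (measurable_pi_apply (e k)).aemeasurable).mp
    (hind.precomp he)]
  simp_rw [(measurePreserving_eval P _).map_eq]

end Dependent

variable {Z : Type*} [MeasurableSpace Z] (P : Measure Z) [IsProbabilityMeasure P]

theorem measurePreserving_snoc (n : ℕ) :
    MeasurePreserving (fun p : (Fin n → Z) × Z => (Fin.snoc p.1 p.2 : Fin (n + 1) → Z))
      ((Measure.pi fun _ => P).prod P) (Measure.pi fun _ => P) := by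
  convert (measurePreserving_piFinSuccAbove (fun _ : Fin (n + 1) => P) (Fin.last n)).symm.comp
    Measure.measurePreserving_swap using 1
  funext p
  simp [MeasurableEquiv.piFinSuccAbove_symm_apply, Fin.insertNthEquiv, Fin.insertNth_last']

theorem integral_sum_comp_eval {g : Z → ℝ} (hg : Integrable g P) :
    ∫ d : ι → Z, ∑ i, g (d i) ∂(Measure.pi fun _ => P) = Fintype.card ι * ∫ z, g z ∂P := by
  rw [integral_finsetSum _ fun i _ => integrable_comp_eval (μ := fun _ : ι => P) hg]
  simp_rw [integral_comp_eval (μ := fun _ : ι => P) hg.aestronglyMeasurable]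
  simp

end Products

/-! ### Likelihood ratios -/

section LikelihoodRatio

variable {Z : Type*} [MeasurableSpace Z] {P Q : Measure Z} {r : Z → ℝ}

theorem sub_one_sub_log_le {x : ℝ} (hx : 0 < x) :
    x - 1 - Real.log x ≤ Real.log x ^ 2 + x * Real.log x ^ 2 := by
  have hup := Real.log_le_sub_one_of_pos hx
  have hlow : x - 1 ≤ x * Real.log x := by
    have := mul_le_mul_of_nonneg_left (Real.one_sub_inv_le_log_of_pos hx) hx.le
    rwa [mul_sub, mul_one, mul_inv_cancel₀ hx.ne'] at this
  rcases le_total 0 (Real.log x) with hlog | hlog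
  · nlinarith [mul_nonneg hlog (sub_nonneg.mpr hlow), sq_nonneg (Real.log x)]
  · nlinarith [mul_nonneg (neg_nonneg.mpr hlog) (sub_nonneg.mpr hup),
      mul_nonneg (sq_nonneg (Real.log x)) hx.le]

/-- A version `r` of the likelihood ratio `dQ/dP` of a probability measure `Q` equivalent to `P`.
The Kullback-Leibler divergence of `P` from `Q` is `-∫ log r dP`; integrability of `log r` makes
it finite and excludes the junk value of the integral. -/
structure IsLikelihoodRatio (P : Measure Z) (r : Z → ℝ) : Prop where
  measurable : Measurable r
  pos : ∀ z, 0 < r z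
  lintegral_eq_one : ∫⁻ z, ENNReal.ofReal (r z) ∂P = 1
  integrable_log : Integrable (fun z => Real.log (r z)) P

namespace IsLikelihoodRatio

theorem integrable (h : IsLikelihoodRatio P r) : Integrable r P :=
  (lintegral_ofReal_ne_top_iff_integrable h.measurable.aestronglyMeasurable
    (ae_of_all _ fun z => (h.pos z).le)).mp (by simp [h.lintegral_eq_one])

theorem integral_eq_one (h : IsLikelihoodRatio P r) : ∫ z, r z ∂P = 1 := by
  rw [integral_eq_lintegral_of_nonneg_ae (ae_of_all _ fun z => (h.pos z).le)
    h.measurable.aestronglyMeasurable, h.lintegral_eq_one, ENNReal.toReal_one]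

theorem pi {ι : Type*} [Fintype ι] [IsProbabilityMeasure P] (h : IsLikelihoodRatio P r) :
    IsLikelihoodRatio (Measure.pi fun _ : ι => P) fun d => ∏ i, r (d i) where
  measurable := Finset.measurable_prod _ fun i _ => h.measurable.comp (measurable_pi_apply i)
  pos d := Finset.prod_pos fun i _ => h.pos (d i)
  lintegral_eq_one := by
    simp_rw [ENNReal.ofReal_prod_of_nonneg fun _ _ => (h.pos _).le]
    rw [lintegral_fintype_prod_eq_prod _ fun _ => h.measurable.ennreal_ofReal]
    simp [h.lintegral_eq_one]
  integrable_log := by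
    simp_rw [Real.log_prod fun _ _ => (h.pos _).ne']
    exact integrable_finsetSum _ fun _ _ =>
      integrable_comp_eval (μ := fun _ : ι => P) h.integrable_log

theorem integral_log_pi {ι : Type*} [Fintype ι] [IsProbabilityMeasure P]
    (h : IsLikelihoodRatio P r) :
    ∫ d : ι → Z, Real.log (∏ i, r (d i)) ∂(Measure.pi fun _ => P) =
      Fintype.card ι * ∫ z, Real.log (r z) ∂P := by
  simp_rw [Real.log_prod fun _ _ => (h.pos _).ne']
  exact integral_sum_comp_eval P h.integrable_log

theorem integral_sub_log (h : IsLikelihoodRatio P r) :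
    ∫ z, (r z - Real.log (r z)) ∂P = 1 - ∫ z, Real.log (r z) ∂P := by
  rw [integral_sub h.integrable h.integrable_log, h.integral_eq_one]

theorem exp_neg_mul_real_le [IsFiniteMeasure Q] (h : IsLikelihoodRatio P r)
    (hQ : Q = P.withDensity fun z => ENNReal.ofReal (r z)) {B : Set Z}
    (hB : MeasurableSet B) {t : ℝ} (hBt : ∀ z ∈ B, -t ≤ Real.log (r z)) :
    Real.exp (-t) * P.real B ≤ Q.real B := by
  have hle : ENNReal.ofReal (Real.exp (-t)) * P B ≤ Q B := by
    rw [hQ, withDensity_apply _ hB, ← setLIntegral_const]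
    exact setLIntegral_mono h.measurable.ennreal_ofReal fun z hz =>
      ENNReal.ofReal_le_ofReal ((Real.le_log_iff_exp_le (h.pos z)).mp (hBt z hz))
  simpa [Measure.real, ENNReal.toReal_mul, (Real.exp_pos _).le] using
    ENNReal.toReal_mono (measure_ne_top Q B) hle

theorem real_le_exp_mul_add [IsProbabilityMeasure P] [IsFiniteMeasure Q]
    (h : IsLikelihoodRatio P r) (hQ : Q = P.withDensity fun z => ENNReal.ofReal (r z))
    {A : Set Z} (hA : MeasurableSet A) {t : ℝ} (ht : 0 < t) :
    P.real A ≤ Real.exp t * Q.real A + (1 - ∫ z, Real.log (r z) ∂P) / t := by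
  -- Markov's inequality is applied to `r - log r`, which unlike `-log r` is nonnegative.
  set B : Set Z := {z | t ≤ r z - Real.log (r z)}
  have hB : MeasurableSet B :=
    measurableSet_le measurable_const (h.measurable.sub h.measurable.log)
  have hnonneg : ∀ z, 0 ≤ r z - Real.log (r z) := fun z => by
    linarith [Real.log_le_sub_one_of_pos (h.pos z)]
  have hmarkov : P.real B ≤ (1 - ∫ z, Real.log (r z) ∂P) / t := by
    rw [le_div_iff₀' ht, ← h.integral_sub_log]
    exact mul_meas_ge_le_integral_of_nonneg (ae_of_all _ hnonneg)
      (h.integrable.sub h.integrable_log) t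
  have hdiff : P.real (A \ B) ≤ Real.exp t * Q.real A := by
    have hlog : ∀ z ∈ A \ B, -t ≤ Real.log (r z) := fun z hz => by
      have : r z - Real.log (r z) < t := not_le.mp hz.2
      linarith [h.pos z]
    calc P.real (A \ B) = Real.exp t * (Real.exp (-t) * P.real (A \ B)) := by
          rw [← mul_assoc, ← Real.exp_add]; simp
      _ ≤ Real.exp t * Q.real A := by
          gcongr
          exact (h.exp_neg_mul_real_le hQ (hA.diff hB) hlog).trans
            (measureReal_mono Set.sdiff_subset)
  calc P.real A ≤ P.real (A \ B ∪ B) := measureReal_mono (by simp)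
    _ ≤ P.real (A \ B) + P.real B := measureReal_union_le _ _
    _ ≤ _ := add_le_add hdiff hmarkov

theorem pi_real_le_exp_mul_add {ι : Type*} [Fintype ι] [IsProbabilityMeasure P]
    [IsProbabilityMeasure Q] (h : IsLikelihoodRatio P r)
    (hQ : Q = P.withDensity fun z => ENNReal.ofReal (r z)) {A : Set (ι → Z)}
    (hA : MeasurableSet A) {t : ℝ} (ht : 0 < t) :
    (Measure.pi fun _ => P).real A ≤ Real.exp t * (Measure.pi fun _ => Q).real A +
      (1 - Fintype.card ι * ∫ z, Real.log (r z) ∂P) / t := by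
  have hprod : Measure.pi (fun _ : ι => Q) =
      (Measure.pi fun _ => P).withDensity fun d => ENNReal.ofReal (∏ i, r (d i)) := by
    have : IsProbabilityMeasure (P.withDensity fun z => ENNReal.ofReal (r z)) := hQ ▸ inferInstance
    simp_rw [ENNReal.ofReal_prod_of_nonneg fun _ _ => (h.pos _).le]
    rw [hQ, pi_withDensity _ fun _ => h.measurable.ennreal_ofReal]
  rw [← h.integral_log_pi]
  exact h.pi.real_le_exp_mul_add hprod hA ht

theorem integrable_sub_one_sub_log [IsFiniteMeasure P] (h : IsLikelihoodRatio P r) :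
    Integrable (fun z => r z - 1 - Real.log (r z)) P :=
  (h.integrable.sub (integrable_const 1)).sub h.integrable_log

theorem integral_sub_one_sub_log [IsProbabilityMeasure P] (h : IsLikelihoodRatio P r) :
    ∫ z, (r z - 1 - Real.log (r z)) ∂P = -∫ z, Real.log (r z) ∂P := by
  have hsub : Integrable (fun z => r z - Real.log (r z)) P := h.integrable.sub h.integrable_log
  simp_rw [sub_right_comm _ (1 : ℝ)]
  rw [integral_sub hsub (integrable_const 1), h.integral_sub_log]
  simp

theorem lintegral_one_sub_sqrt_sq_le [IsProbabilityMeasure P] (h : IsLikelihoodRatio P r) :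
    ∫⁻ z, ENNReal.ofReal ((1 - √(r z)) ^ 2) ∂P ≤
      ENNReal.ofReal (-∫ z, Real.log (r z) ∂P) := by
  have hle : ∀ z, (1 - √(r z)) ^ 2 ≤ r z - 1 - Real.log (r z) := fun z => by
    have hlog := Real.log_le_sub_one_of_pos (Real.sqrt_pos.mpr (h.pos z))
    rw [Real.log_sqrt (h.pos z).le] at hlog
    nlinarith [Real.sq_sqrt (h.pos z).le]
  rw [← h.integral_sub_one_sub_log, ofReal_integral_eq_lintegral_ofReal
    h.integrable_sub_one_sub_log (ae_of_all _ fun z => (sq_nonneg _).trans (hle z))]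
  exact lintegral_mono fun z => ENNReal.ofReal_le_ofReal (hle z)

theorem ofReal_neg_integral_log_le [IsProbabilityMeasure P] (h : IsLikelihoodRatio P r)
    (hQ : Q = P.withDensity fun z => ENNReal.ofReal (r z)) :
    ENNReal.ofReal (-∫ z, Real.log (r z) ∂P) ≤
      ∫⁻ z, ENNReal.ofReal (Real.log (r z) ^ 2) ∂P +
        ∫⁻ z, ENNReal.ofReal (Real.log (r z) ^ 2) ∂Q := by
  have hmeas : Measurable fun z => ENNReal.ofReal (Real.log (r z) ^ 2) :=
    (h.measurable.log.pow_const 2).ennreal_ofReal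
  rw [← h.integral_sub_one_sub_log, ofReal_integral_eq_lintegral_ofReal
      h.integrable_sub_one_sub_log
      (ae_of_all _ fun z => sub_nonneg.mpr (Real.log_le_sub_one_of_pos (h.pos z))), hQ,
    lintegral_withDensity_eq_lintegral_mul _ h.measurable.ennreal_ofReal hmeas,
    ← lintegral_add_left hmeas]
  refine lintegral_mono fun z => ?_
  rw [Pi.mul_apply, ← ENNReal.ofReal_mul (h.pos z).le, ← ENNReal.ofReal_add (sq_nonneg _)
    (mul_nonneg (h.pos z).le (sq_nonneg _))]
  exact ENNReal.ofReal_le_ofReal (sub_one_sub_log_le (h.pos z))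

end IsLikelihoodRatio

end LikelihoodRatio

/-! ### Sequential prediction by a finite mixture -/

section Mixture

variable {J Z : Type*} [Fintype J]

/-- Likelihood of the sample `d` under the mixture of the candidates `r j` with unit weights; it is
left unnormalised, so its value at the empty sample is the number of candidates. -/
def mixLik (r : J → Z → ℝ) {n : ℕ} (d : Fin n → Z) : ℝ := ∑ j, ∏ k, r j (d k)

/-- Posterior weight of the candidate `j` under the uniform prior, given the sample `d`. -/
noncomputable def postWeight (r : J → Z → ℝ) {n : ℕ} (d : Fin n → Z) (j : J) : ℝ :=
  (∏ k, r j (d k)) / mixLik r d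

/-- Bayesian predictive density: the average of the candidates `r j` with respect to their posterior
weights, given the sample `d`. -/
noncomputable def mixPred (r : J → Z → ℝ) {n : ℕ} (d : Fin n → Z) (z : Z) : ℝ :=
  ∑ j, postWeight r d j * r j z

variable {r : J → Z → ℝ} {n : ℕ}

theorem mixPred_eq_div (d : Fin n → Z) (z : Z) :
    mixPred r d z = mixLik r (Fin.snoc d z : Fin (n + 1) → Z) / mixLik r d := by
  simp [mixPred, postWeight, mixLik, Fin.prod_univ_castSucc, Finset.sum_div, div_mul_eq_mul_div]

theorem prod_le_mixLik (hpos : ∀ j z, 0 < r j z) (d : Fin n → Z) (j : J) :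
    ∏ k, r j (d k) ≤ mixLik r d :=
  Finset.single_le_sum (f := fun j => ∏ k, r j (d k))
    (fun j _ => Finset.prod_nonneg fun _ _ => (hpos j _).le) (Finset.mem_univ j)

theorem postWeight_div {g : J → Z → ℝ} {p : Z → ℝ} (hp : ∀ z, 0 < p z) (d : Fin n → Z) (j : J) :
    postWeight (fun j z => g j z / p z) d j = postWeight g d j := by
  have hprod : ∏ k, p (d k) ≠ 0 := (Finset.prod_pos fun k _ => hp (d k)).ne'
  simp only [postWeight, mixLik, Finset.prod_div_distrib, ← Finset.sum_div]
  exact div_div_div_cancel_right₀ hprod _ _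

theorem mixPred_div {g : J → Z → ℝ} {p : Z → ℝ} (hp : ∀ z, 0 < p z) (d : Fin n → Z) (z : Z) :
    mixPred (fun j z => g j z / p z) d z = mixPred g d z / p z := by
  simp only [mixPred, postWeight_div hp, Finset.sum_div, mul_div_assoc]

section Positive

variable [Nonempty J]

theorem mixLik_pos (hpos : ∀ j z, 0 < r j z) (d : Fin n → Z) : 0 < mixLik r d :=
  Finset.sum_pos (fun j _ => Finset.prod_pos fun _ _ => hpos j _) Finset.univ_nonempty

theorem postWeight_pos (hpos : ∀ j z, 0 < r j z) (d : Fin n → Z) (j : J) :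
    0 < postWeight r d j :=
  div_pos (Finset.prod_pos fun _ _ => hpos j _) (mixLik_pos hpos d)

theorem sum_postWeight (hpos : ∀ j z, 0 < r j z) (d : Fin n → Z) : ∑ j, postWeight r d j = 1 := by
  simp_rw [postWeight, ← Finset.sum_div]
  exact div_self (mixLik_pos hpos d).ne'

theorem mixPred_pos (hpos : ∀ j z, 0 < r j z) (d : Fin n → Z) (z : Z) : 0 < mixPred r d z :=
  Finset.sum_pos (fun j _ => mul_pos (postWeight_pos hpos d j) (hpos j z)) Finset.univ_nonempty

theorem log_mixPred (hpos : ∀ j z, 0 < r j z) (d : Fin n → Z) (z : Z) :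
    Real.log (mixPred r d z) =
      Real.log (mixLik r (Fin.snoc d z : Fin (n + 1) → Z)) - Real.log (mixLik r d) := by
  rw [mixPred_eq_div, Real.log_div (mixLik_pos hpos _).ne' (mixLik_pos hpos d).ne']

theorem lintegral_mixPred_comp {Y : Type*} [MeasurableSpace Y] {lam : Measure Y} {φ : Y → Z}
    (hpos : ∀ j z, 0 < r j z) (hr : ∀ j, Measurable fun y => r j (φ y))
    (hone : ∀ j, ∫⁻ y, ENNReal.ofReal (r j (φ y)) ∂lam = 1) (d : Fin n → Z) :
    ∫⁻ y, ENNReal.ofReal (mixPred r d (φ y)) ∂lam = 1 := by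
  have hw : ∀ j, 0 ≤ postWeight r d j := fun j => (postWeight_pos hpos d j).le
  simp_rw [mixPred, ENNReal.ofReal_sum_of_nonneg fun j _ => mul_nonneg (hw j) (hpos j _).le,
    ENNReal.ofReal_mul (hw _)]
  rw [lintegral_finsetSum _ fun j _ => (hr j).ennreal_ofReal.const_mul _]
  simp_rw [lintegral_const_mul _ (hr _).ennreal_ofReal, hone, mul_one]
  rw [← ENNReal.ofReal_sum_of_nonneg fun j _ => hw j, sum_postWeight hpos, ENNReal.ofReal_one]

theorem abs_log_sum_le {a : J → ℝ} (ha : ∀ j, 0 < a j) :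
    |Real.log (∑ j, a j)| ≤ Real.log (Fintype.card J) + ∑ j, |Real.log (a j)| := by
  set T := ∑ j, |Real.log (a j)|
  have hlog : ∀ j, |Real.log (a j)| ≤ T := fun j =>
    Finset.single_le_sum (f := fun j => |Real.log (a j)|) (fun _ _ => abs_nonneg _)
      (Finset.mem_univ j)
  have hcard : (1 : ℝ) ≤ Fintype.card J := by exact_mod_cast Fintype.card_pos
  refine abs_le.mpr ⟨?_, ?_⟩
  · obtain ⟨j⟩ := ‹Nonempty J›
    have hle : Real.log (a j) ≤ Real.log (∑ j, a j) := Real.log_le_log (ha j)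
      (Finset.single_le_sum (fun j _ => (ha j).le) (Finset.mem_univ j))
    linarith [Real.log_nonneg hcard, (abs_le.mp (hlog j)).1]
  · have hle : ∑ j, a j ≤ Fintype.card J * Real.exp T := by
      simpa using Finset.sum_le_sum (s := Finset.univ) fun j _ =>
        (Real.log_le_iff_le_exp (ha j)).mp ((le_abs_self _).trans (hlog j))
    calc Real.log (∑ j, a j) ≤ Real.log (Fintype.card J * Real.exp T) :=
          Real.log_le_log (Finset.sum_pos (fun j _ => ha j) Finset.univ_nonempty) hle
      _ = Real.log (Fintype.card J) + T := by
          rw [Real.log_mul (by positivity) (Real.exp_pos _).ne', Real.log_exp]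

end Positive

section Measure

variable [MeasurableSpace Z]

theorem measurable_mixLik (hr : ∀ j, Measurable (r j)) (n : ℕ) :
    Measurable (mixLik r : (Fin n → Z) → ℝ) :=
  Finset.measurable_sum _ fun j _ => Finset.measurable_prod _ fun k _ =>
    (hr j).comp (measurable_pi_apply k)

theorem measurable_mixPred (hr : ∀ j, Measurable (r j)) (n : ℕ) :
    Measurable fun p : (Fin n → Z) × Z => mixPred r p.1 p.2 := by
  refine Finset.measurable_sum _ fun j _ => Measurable.mul (Measurable.div ?_ ?_) ?_
  · exact Finset.measurable_prod _ fun k _ =>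
      (hr j).comp ((measurable_pi_apply k).comp measurable_fst)
  · exact (measurable_mixLik hr n).comp measurable_fst
  · exact (hr j).comp measurable_snd

variable {P : Measure Z} [IsProbabilityMeasure P]

/-- The expected logarithm of the mixture likelihood of `n` observations from `P`. -/
noncomputable def expLogMixLik (P : Measure Z) (r : J → Z → ℝ) (n : ℕ) : ℝ :=
  ∫ d, Real.log (mixLik r d) ∂(Measure.pi fun _ : Fin n => P)

theorem expLogMixLik_zero : expLogMixLik P r 0 = Real.log (Fintype.card J) := by
  simp [expLogMixLik, mixLik]

section Nonempty

variable [Nonempty J]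

theorem integrable_log_mixLik (h : ∀ j, IsLikelihoodRatio P (r j)) (n : ℕ) :
    Integrable (fun d : Fin n → Z => Real.log (mixLik r d)) (Measure.pi fun _ => P) := by
  have hlog : ∀ j, Integrable (fun d : Fin n → Z => Real.log (∏ k, r j (d k)))
      (Measure.pi fun _ => P) := fun j => (h j).pi.integrable_log
  exact ((integrable_const (Real.log (Fintype.card J))).add
      (integrable_finsetSum _ fun j _ => (hlog j).abs)).mono'
    (measurable_mixLik (fun j => (h j).measurable) n).log.aestronglyMeasurable
    (ae_of_all _ fun d => abs_log_sum_le fun j => Finset.prod_pos fun k _ => (h j).pos (d k))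

theorem isLikelihoodRatio_mixPred (h : ∀ j, IsLikelihoodRatio P (r j)) (n : ℕ) :
    IsLikelihoodRatio ((Measure.pi fun _ : Fin n => P).prod P)
      fun p => mixPred r p.1 p.2 where
  measurable := measurable_mixPred (fun j => (h j).measurable) n
  pos p := mixPred_pos (fun j => (h j).pos) p.1 p.2
  lintegral_eq_one := by
    have hone : ∀ d : Fin n → Z, ∫⁻ z, ENNReal.ofReal (mixPred r d z) ∂P = 1 :=
      lintegral_mixPred_comp (φ := fun z => z) (fun j => (h j).pos) (fun j => (h j).measurable)
        fun j => (h j).lintegral_eq_one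
    rw [lintegral_prod _
      (measurable_mixPred (fun j => (h j).measurable) n).ennreal_ofReal.aemeasurable]
    simp [hone]
  integrable_log := by
    simp_rw [log_mixPred fun j => (h j).pos]
    exact ((measurePreserving_snoc P n).integrable_comp_of_integrable
      (integrable_log_mixLik h (n + 1))).sub
        (measurePreserving_fst.integrable_comp_of_integrable (integrable_log_mixLik h n))

theorem integral_log_mixPred (h : ∀ j, IsLikelihoodRatio P (r j)) (n : ℕ) :
    ∫ p : (Fin n → Z) × Z, Real.log (mixPred r p.1 p.2) ∂((Measure.pi fun _ => P).prod P) =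
      expLogMixLik P r (n + 1) - expLogMixLik P r n := by
  have hsnoc := measurePreserving_snoc P n
  have hfst : MeasurePreserving Prod.fst ((Measure.pi fun _ : Fin n => P).prod P) _ :=
    measurePreserving_fst
  have hint := integrable_log_mixLik h
  have hint_snoc : Integrable (fun p : (Fin n → Z) × Z =>
      Real.log (mixLik r (Fin.snoc p.1 p.2 : Fin (n + 1) → Z))) ((Measure.pi fun _ => P).prod P) :=
    hsnoc.integrable_comp_of_integrable (hint (n + 1))
  have hint_fst : Integrable (fun p : (Fin n → Z) × Z => Real.log (mixLik r p.1))
      ((Measure.pi fun _ => P).prod P) := hfst.integrable_comp_of_integrable (hint n)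
  have hval_snoc : expLogMixLik P r (n + 1) =
      ∫ p : (Fin n → Z) × Z, Real.log (mixLik r (Fin.snoc p.1 p.2 : Fin (n + 1) → Z))
        ∂((Measure.pi fun _ => P).prod P) := by
    rw [expLogMixLik, ← hsnoc.map_eq, integral_map hsnoc.aemeasurable
      (hsnoc.map_eq ▸ (hint (n + 1)).aestronglyMeasurable)]
  have hval_fst : expLogMixLik P r n =
      ∫ p : (Fin n → Z) × Z, Real.log (mixLik r p.1) ∂((Measure.pi fun _ => P).prod P) := by
    rw [integral_fun_fst fun d => Real.log (mixLik r d), probReal_univ, one_smul, expLogMixLik]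
  simp_rw [log_mixPred fun j => (h j).pos]
  rw [integral_sub hint_snoc hint_fst, hval_snoc, hval_fst]

theorem lintegral_hellinger_mixPred_le (h : ∀ j, IsLikelihoodRatio P (r j)) (n : ℕ) :
    ∫⁻ d, ∫⁻ z, ENNReal.ofReal ((1 - √(mixPred r d z)) ^ 2) ∂P
        ∂(Measure.pi fun _ : Fin n => P) ≤
      ENNReal.ofReal (expLogMixLik P r n - expLogMixLik P r (n + 1)) := by
  have hlr := isLikelihoodRatio_mixPred h n
  rw [← neg_sub, ← integral_log_mixPred h, ← lintegral_prod
    (fun p : (Fin n → Z) × Z => ENNReal.ofReal ((1 - √(mixPred r p.1 p.2)) ^ 2))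
    ((hlr.measurable.sqrt.const_sub 1).pow_const 2).ennreal_ofReal.aemeasurable]
  exact hlr.lintegral_one_sub_sqrt_sq_le

theorem expLogMixLik_succ_le (h : ∀ j, IsLikelihoodRatio P (r j)) (n : ℕ) :
    expLogMixLik P r (n + 1) ≤ expLogMixLik P r n := by
  have hlr := isLikelihoodRatio_mixPred h n
  have hle : ∫ p : (Fin n → Z) × Z, Real.log (mixPred r p.1 p.2)
      ∂((Measure.pi fun _ => P).prod P) ≤ 0 := by
    have hmono := integral_mono hlr.integrable_log (hlr.integrable.sub (integrable_const 1))
      fun p => Real.log_le_sub_one_of_pos (hlr.pos p)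
    rw [integral_sub' hlr.integrable (integrable_const 1), hlr.integral_eq_one] at hmono
    simpa using hmono
  rw [integral_log_mixPred h] at hle
  exact sub_nonpos.mp hle

end Nonempty

theorem mul_integral_log_le_expLogMixLik (h : ∀ j, IsLikelihoodRatio P (r j)) (j : J) (n : ℕ) :
    n * ∫ z, Real.log (r j z) ∂P ≤ expLogMixLik P r n := by
  have : Nonempty J := ⟨j⟩
  calc n * ∫ z, Real.log (r j z) ∂P
      = ∫ d : Fin n → Z, Real.log (∏ k, r j (d k)) ∂(Measure.pi fun _ => P) := by
        rw [(h j).integral_log_pi, Fintype.card_fin]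
    _ ≤ expLogMixLik P r n := integral_mono (h j).pi.integrable_log (integrable_log_mixLik h n)
        fun d => Real.log_le_log ((h j).pi.pos d) (prod_le_mixLik (fun j => (h j).pos) d j)

-- The one-step Kullback-Leibler risks of the predictive density telescope.
theorem sum_hellinger_mixPred_le (h : ∀ j, IsLikelihoodRatio P (r j)) (j : J) (n : ℕ) :
    ∑ i ∈ Finset.range n, ∫⁻ d, ∫⁻ z, ENNReal.ofReal ((1 - √(mixPred r d z)) ^ 2) ∂P
        ∂(Measure.pi fun _ : Fin i => P) ≤
      ENNReal.ofReal (Real.log (Fintype.card J) - n * ∫ z, Real.log (r j z) ∂P) := by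
  have : Nonempty J := ⟨j⟩
  refine (Finset.sum_le_sum fun i _ => lintegral_hellinger_mixPred_le h i).trans ?_
  rw [← ENNReal.ofReal_sum_of_nonneg fun i _ => sub_nonneg.mpr (expLogMixLik_succ_le h i),
    Finset.sum_range_sub', expLogMixLik_zero]
  exact ENNReal.ofReal_le_ofReal (sub_le_sub_left (mul_integral_log_le_expLogMixLik h j n) _)

end Measure

end Mixture

/-! ### Packings -/

section Packing

variable {X : Type*} [MeasurableSpace X] {ν : Measure X} {h : X → ℝ} {U : Set (X → ℝ)} {ε : ℝ}

theorem l2DistSq_self (u : X → ℝ) : l2DistSq ν h u u = 0 := by simp [l2DistSq]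

theorem l2DistSq_comm (u v : X → ℝ) : l2DistSq ν h u v = l2DistSq ν h v u := by
  simp_rw [l2DistSq, sub_sq_comm]

theorem ofReal_lt_l2Dist_iff {u v : X → ℝ} (hε : 0 ≤ ε) :
    ENNReal.ofReal ε < l2Dist ν h u v ↔ ENNReal.ofReal (ε ^ 2) < l2DistSq ν h u v := by
  rw [l2Dist, one_div, ENNReal.lt_rpow_inv_iff (by norm_num), ENNReal.rpow_ofNat,
    ENNReal.ofReal_pow hε]

/-- Finite `ε`-packings of `U` in `L₂(h)`: distinct elements are at distance larger than `ε`. This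
is the relation maximised in `packingNumber`, expressed through squared distances. -/
structure IsL2Packing (ν : Measure X) (h : X → ℝ) (U : Set (X → ℝ)) (ε : ℝ)
    (N : Finset (X → ℝ)) : Prop where
  subset : (N : Set (X → ℝ)) ⊆ U
  pairwise : (N : Set (X → ℝ)).Pairwise fun u v => ENNReal.ofReal (ε ^ 2) < l2DistSq ν h u v

theorem packingNumber_eq_iSup (hε : 0 ≤ ε) :
    packingNumber ν h U ε = ⨆ (N : Finset (X → ℝ)) (_ : IsL2Packing ν h U ε N), (N.card : ℕ∞) := by
  simp_rw [packingNumber, ofReal_lt_l2Dist_iff hε]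
  exact iSup_congr fun N =>
    iSup_and'.trans (iSup_congr_Prop ⟨fun h => ⟨h.1, h.2⟩, fun h => ⟨h.1, h.2⟩⟩ fun _ => rfl)

/-- A finite `ε`-packing of `U` whose cardinality is the packing number. -/
structure IsMaxL2Packing (ν : Measure X) (h : X → ℝ) (U : Set (X → ℝ)) (ε : ℝ)
    (N : Finset (X → ℝ)) : Prop extends IsL2Packing ν h U ε N where
  card_eq : (N.card : ℕ∞) = packingNumber ν h U ε

theorem exists_isMaxL2Packing (hU : TotallyBoundedL2 ν h U) (hε : 0 < ε) :
    ∃ N, IsMaxL2Packing ν h U ε N := by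
  have hempty : IsL2Packing ν h U ε ∅ := ⟨by simp, by simp⟩
  have : Nonempty {N // IsL2Packing ν h U ε N} := ⟨⟨∅, hempty⟩⟩
  have hfin := hU ε hε
  rw [packingNumber_eq_iSup hε.le, iSup_subtype'] at hfin
  obtain ⟨⟨N, hN⟩, hcard⟩ := ENat.exists_eq_iSup_of_lt_top hfin.lt_top
  exact ⟨N, hN, by rw [packingNumber_eq_iSup hε.le, iSup_subtype', hcard]⟩

namespace IsMaxL2Packing

variable {N : Finset (X → ℝ)}

theorem packingEntropy_eq (hN : IsMaxL2Packing ν h U ε N) :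
    packingEntropy ν h U ε = Real.log N.card := by
  rw [packingEntropy, ← hN.card_eq, ENat.toNat_natCast]

theorem exists_l2DistSq_le (hN : IsMaxL2Packing ν h U ε N) (hε : 0 ≤ ε) {u : X → ℝ} (hu : u ∈ U) :
    ∃ v ∈ N, l2DistSq ν h u v ≤ ENNReal.ofReal (ε ^ 2) := by
  classical
  by_contra! hfar
  have huN : u ∉ N := fun hmem => not_lt_zero (l2DistSq_self (ν := ν) (h := h) u ▸ hfar u hmem)
  have hinsert : IsL2Packing ν h U ε (insert u N) := by
    refine ⟨by simpa [Set.insert_subset_iff] using ⟨hu, hN.subset⟩, ?_⟩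
    rw [Finset.coe_insert]
    exact hN.pairwise.insert fun v hv _ => ⟨hfar v hv, l2DistSq_comm u v ▸ hfar v hv⟩
  have hle : ((insert u N).card : ℕ∞) ≤ N.card := by
    rw [hN.card_eq, packingNumber_eq_iSup hε]
    exact le_iSup₂_of_le _ hinsert le_rfl
  rw [Nat.cast_le, Finset.card_insert_of_notMem huN] at hle
  omega

end IsMaxL2Packing

theorem packingEntropy_nonneg (ε : ℝ) : 0 ≤ packingEntropy ν h U ε := Real.log_natCast_nonneg _

theorem packingNumber_antitone : Antitone (packingNumber ν h U) := fun _ _ hab =>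
  iSup_mono fun _ => iSup_mono fun _ => iSup_mono' fun hsep =>
    ⟨hsep.mono' fun _ _ huv => (ENNReal.ofReal_le_ofReal hab).trans_lt huv, le_rfl⟩

theorem packingEntropy_antitoneOn (hU : TotallyBoundedL2 ν h U) :
    AntitoneOn (packingEntropy ν h U) (Set.Ioi 0) := by
  intro a ha b _ hab
  have hle : (packingNumber ν h U b).toNat ≤ (packingNumber ν h U a).toNat :=
    ENat.toNat_le_toNat (packingNumber_antitone hab) (hU a ha)
  rcases Nat.eq_zero_or_pos (packingNumber ν h U b).toNat with hzero | hpos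
  · simpa [packingEntropy, hzero] using packingEntropy_nonneg a
  · exact Real.log_le_log (by exact_mod_cast hpos) (by exact_mod_cast hle)

end Packing

/-! ### Rich and order regular functions -/

section Entropy

variable {E M : ℝ → ℝ}

theorem tendsto_const_mul_nhdsGT_zero {c : ℝ} (hc : 0 < c) :
    Tendsto (fun ε : ℝ => c * ε) (𝓝[>] 0) (𝓝[>] 0) :=
  tendsto_iff_comap.mpr (comap_mulLeft_nhdsGT_zero hc).ge

theorem IsOrderRegular.congr (hM : IsOrderRegular M) (hME : M =Θ[𝓝[>] (0 : ℝ)] E) :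
    IsOrderRegular E := fun c hc =>
  have htend := tendsto_const_mul_nhdsGT_zero hc
  ⟨(hME.2.comp_tendsto htend).trans ((hM c hc).1.trans hME.1),
    hME.2.trans ((hM c hc).2.trans (hME.1.comp_tendsto htend))⟩

theorem IsRich.exists_mul_norm_le (hM : IsRich M) :
    ∃ α q : ℝ, 0 < α ∧ 1 < q ∧ ∀ᶠ ε in 𝓝[>] (0 : ℝ), M ε ≠ 0 ∧ q * ‖M ε‖ ≤ ‖M (α * ε)‖ := by
  obtain ⟨α, hα, -, hlim⟩ := hM
  obtain ⟨q, hq1, hq⟩ := EReal.lt_iff_exists_real_btwn.mp hlim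
  have hq1 : 1 < q := by exact_mod_cast hq1
  refine ⟨α, q, hα, hq1, (eventually_lt_of_lt_liminf hq).mono fun ε hε => ?_⟩
  have hlt : q < M (α * ε) / M ε := by exact_mod_cast hε
  have hne : M ε ≠ 0 := fun hzero => by
    rw [hzero, div_zero] at hlt
    linarith
  refine ⟨hne, ?_⟩
  rw [← le_div_iff₀ (norm_pos_iff.mpr hne), ← norm_div]
  exact hlt.le.trans (Real.le_norm_self _)

theorem IsRich.eventually_pos (hM : IsRich M) (hME : M =Θ[𝓝[>] (0 : ℝ)] E) (hE0 : ∀ ε, 0 ≤ E ε) :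
    ∀ᶠ ε in 𝓝[>] (0 : ℝ), 0 < E ε := by
  obtain ⟨_, _, _, _, hev⟩ := hM.exists_mul_norm_le
  filter_upwards [hev, hME.eq_zero_iff] with ε hε hzero
  exact (hE0 ε).lt_of_ne' fun h => hε.1 (hzero.mpr h)

theorem IsRich.exists_pow_mul_norm_le (hM : IsRich M) :
    ∃ α q : ℝ, 0 < α ∧ 1 < q ∧
      ∀ k : ℕ, ∀ᶠ ε in 𝓝[>] (0 : ℝ), q ^ k * ‖M ε‖ ≤ ‖M (α ^ k * ε)‖ := by
  obtain ⟨α, q, hα, hq, hstep⟩ := hM.exists_mul_norm_le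
  refine ⟨α, q, hα, hq, fun k => ?_⟩
  induction k with
  | zero => simp
  | succ k ih =>
    filter_upwards [ih, (tendsto_const_mul_nhdsGT_zero (pow_pos hα k)).eventually hstep]
      with ε hk hsucc
    calc q ^ (k + 1) * ‖M ε‖ = q * (q ^ k * ‖M ε‖) := by ring
      _ ≤ q * ‖M (α ^ k * ε)‖ := by gcongr
      _ ≤ ‖M (α * (α ^ k * ε))‖ := hsucc.2
      _ = ‖M (α ^ (k + 1) * ε)‖ := by rw [pow_succ', mul_assoc]

theorem IsRich.exists_mul_le (hM : IsRich M) (hME : M =Θ[𝓝[>] (0 : ℝ)] E) (hE0 : ∀ ε, 0 ≤ E ε)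
    (K : ℝ) : ∃ γ : ℝ, 0 < γ ∧ ∀ᶠ ε in 𝓝[>] (0 : ℝ), K * E ε ≤ E (γ * ε) := by
  obtain ⟨α, q, hα, hq, hpow⟩ := hM.exists_pow_mul_norm_le
  obtain ⟨c₁, hc₁, hME₁⟩ := hME.1.exists_pos
  obtain ⟨c₂, hc₂, hME₂⟩ := hME.2.exists_pos
  obtain ⟨k, hk⟩ := pow_unbounded_of_one_lt (K * c₁ * c₂) hq
  have htend := tendsto_const_mul_nhdsGT_zero (pow_pos hα k)
  refine ⟨α ^ k, pow_pos hα k, ?_⟩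
  filter_upwards [hpow k, htend.eventually hME₁.bound, hME₂.bound] with ε hgrow hup hlow
  rw [Real.norm_of_nonneg (hE0 _)] at hup hlow
  refine le_of_mul_le_mul_left ?_ (mul_pos hc₁ hc₂)
  calc c₁ * c₂ * (K * E ε) = K * c₁ * c₂ * E ε := by ring
    _ ≤ q ^ k * (c₂ * ‖M ε‖) := mul_le_mul hk.le hlow (hE0 ε) (by positivity)
    _ = c₂ * (q ^ k * ‖M ε‖) := by ring
    _ ≤ c₂ * (c₁ * E (α ^ k * ε)) := mul_le_mul_of_nonneg_left (hgrow.trans hup) hc₂.le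
    _ = c₁ * c₂ * E (α ^ k * ε) := by ring

theorem IsRich.tendsto_atTop (hM : IsRich M) (hME : M =Θ[𝓝[>] (0 : ℝ)] E) (hE0 : ∀ ε, 0 ≤ E ε)
    (hanti : AntitoneOn E (Set.Ioi 0)) : Tendsto E (𝓝[>] (0 : ℝ)) atTop := by
  refine Filter.tendsto_atTop.mpr fun B => ?_
  obtain ⟨δ, hEδ, hδ⟩ := ((hM.eventually_pos hME hE0).and self_mem_nhdsWithin).exists
  obtain ⟨γ, hγ, hgrow⟩ := hM.exists_mul_le hME hE0 (|B| / E δ)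
  obtain ⟨ε₀, hε₀, hgrow, hlt⟩ :=
    (eventually_mem_nhdsWithin.and (hgrow.and (Ioo_mem_nhdsGT hδ))).exists
  have hB : B ≤ E (γ * ε₀) := calc
    B ≤ |B| / E δ * E δ := by rw [div_mul_cancel₀ _ hEδ.ne']; exact le_abs_self B
    _ ≤ |B| / E δ * E ε₀ := by gcongr; exact hanti hε₀ hδ hlt.2.le
    _ ≤ E (γ * ε₀) := hgrow
  filter_upwards [Ioo_mem_nhdsGT (mul_pos hγ hε₀)] with ε hε
  exact hB.trans (hanti hε.1 (mul_pos hγ hε₀) hε.2.le)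

theorem tendsto_nhdsGT_zero_of_mul_sq_le (hanti : AntitoneOn E (Set.Ioi 0)) {C : ℝ} (hC : 0 ≤ C)
    {ε : ℕ → ℝ} (hε : ∀ᶠ n in atTop, 0 < ε n)
    (hle : ∀ᶠ n : ℕ in atTop, n * ε n ^ 2 ≤ C * E (ε n)) : Tendsto ε atTop (𝓝[>] 0) := by
  refine tendsto_nhdsWithin_iff.mpr ⟨tendsto_order.mpr ⟨fun a ha => ?_, fun η hη => ?_⟩, hε⟩
  · filter_upwards [hε] with n hn using ha.trans hn
  · filter_upwards [hε, hle, tendsto_natCast_atTop_atTop.eventually_gt_atTop (C * E η / η ^ 2)]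
      with n hn hle hlarge
    by_contra! hηε
    refine absurd hle (not_le.mpr ?_)
    calc C * E (ε n) ≤ C * E η := by gcongr; exact hanti hη hn hηε
      _ < n * η ^ 2 := (div_lt_iff₀ (by positivity)).mp hlarge
      _ ≤ n * ε n ^ 2 := by gcongr

-- Halving the scale from `2` on, `n ε²` drops below the entropy at some first scale `ε`.
theorem exists_mul_sq_le_and_le_mul_sq (hanti : AntitoneOn E (Set.Ioi 0))
    (hpos : ∀ᶠ ε in 𝓝[>] (0 : ℝ), 0 < E ε) {n : ℕ} (hn : E 2 ≤ n * 2 ^ 2) :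
    ∃ ε : ℝ, 0 < ε ∧ n * ε ^ 2 ≤ E ε ∧ E (2 * ε) ≤ n * (2 * ε) ^ 2 := by
  obtain ⟨δ, hEδ, hδ⟩ := (hpos.and self_mem_nhdsWithin).exists
  have hsmall : ∀ᶠ ε : ℝ in 𝓝[>] 0, n * ε ^ 2 ≤ E ε := by
    have hlim : Tendsto (fun ε : ℝ => n * ε ^ 2) (𝓝[>] 0) (𝓝 0) := by
      have hcont : Continuous fun ε : ℝ => n * ε ^ 2 := by fun_prop
      simpa using (hcont.tendsto 0).mono_left nhdsWithin_le_nhds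
    filter_upwards [hlim.eventually_lt_const hEδ, Ioo_mem_nhdsGT hδ] with ε hlt hε
    exact hlt.le.trans (hanti hε.1 hδ hε.2.le)
  obtain ⟨s, hs⟩ : ∃ s : ℕ → ℝ, s = fun k => 2 * (1 / 2 : ℝ) ^ k := ⟨_, rfl⟩
  have hs_tendsto : Tendsto s atTop (𝓝[>] 0) := hs ▸
    (tendsto_const_mul_nhdsGT_zero two_pos).comp
      (tendsto_pow_atTop_nhdsWithin_zero_of_lt_one (by norm_num) (by norm_num))
  have hs_succ : ∀ k, 2 * s (k + 1) = s k := fun k => by rw [hs]; ring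
  have hs_zero : s 0 = 2 := by simp [hs]
  obtain ⟨k, hk, hfirst⟩ : ∃ k, n * s (k + 1) ^ 2 ≤ E (s (k + 1)) ∧ E (s k) ≤ n * s k ^ 2 := by
    by_contra! hcon
    have hnever : ∀ k, ¬ n * s (k + 1) ^ 2 ≤ E (s (k + 1)) := fun k => by
      induction k with
      | zero => exact fun h => (hcon 0 h).not_ge (by rwa [hs_zero])
      | succ k ih => exact fun h => ih (hcon (k + 1) h).le
    obtain ⟨k, hk⟩ := (((tendsto_add_atTop_iff_nat 1).mpr hs_tendsto).eventually hsmall).exists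
    exact hnever k hk
  exact ⟨s (k + 1), by rw [hs]; positivity, hk, by rwa [hs_succ]⟩

theorem exists_solution (hE0 : ∀ ε, 0 ≤ E ε) (hanti : AntitoneOn E (Set.Ioi 0))
    (hpos : ∀ᶠ ε in 𝓝[>] (0 : ℝ), 0 < E ε) (hreg : IsOrderRegular E) :
    ∃ ε : ℕ → ℝ, (∀ᶠ n in atTop, 0 < ε n) ∧
      (fun n => E (ε n)) =Θ[atTop] fun n : ℕ => (n : ℝ) * ε n ^ 2 := by
  have hlarge : ∀ᶠ n : ℕ in atTop, E 2 ≤ n * 2 ^ 2 :=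
    (tendsto_natCast_atTop_atTop.atTop_mul_const (by norm_num)).eventually_ge_atTop (E 2)
  obtain ⟨ε, hε⟩ := skolem.mp
    (hlarge.mono fun n hn => exists_mul_sq_le_and_le_mul_sq hanti hpos hn)
  have hε0 : ∀ᶠ n in atTop, 0 < ε n := hε.mono fun n hn => hn.1
  have hlim : Tendsto ε atTop (𝓝[>] 0) :=
    tendsto_nhdsGT_zero_of_mul_sq_le hanti zero_le_one hε0
      (hε.mono fun n hn => by simpa using hn.2.1)
  have hdouble : (fun n => E (ε n)) =O[atTop] fun n => E (2 * ε n) :=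
    (hreg 2 two_pos).2.comp_tendsto hlim
  refine ⟨ε, hε0, hdouble.trans (IsBigO.of_bound 4 ?_), IsBigO.of_bound 1 ?_⟩
  · filter_upwards [hε] with n hn
    rw [Real.norm_of_nonneg (hE0 _), Real.norm_of_nonneg (by positivity)]
    linarith [hn.2.2]
  · filter_upwards [hε] with n hn
    rw [Real.norm_of_nonneg (hE0 _), Real.norm_of_nonneg (by positivity), one_mul]
    exact hn.2.1

end Entropy

/-! ### Location-scale densities and the law of an observation -/

/-- The density of `m + s ε` when `ε` has density `f`. -/
noncomputable def lsPDF (f : ℝ → ℝ) (m s y : ℝ) : ℝ := f ((y - m) / s) / s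

/-- `G` is an envelope for the Lipschitz constants of the log-densities of the location-scale
family of `f` over the parameters `|m| ≤ J`, `b⁻¹ ≤ s ≤ b`, and has second moment at most `C` under
each member of the family. -/
structure IsLogLipschitzEnvelope (f : ℝ → ℝ) (J b : ℝ) (G : ℝ → ℝ) (C : NNReal) : Prop where
  measurable : Measurable G
  abs_log_sub_log_le : ∀ {m m' s s' : ℝ}, |m| ≤ J → |m'| ≤ J → s ∈ Set.Icc b⁻¹ b →
    s' ∈ Set.Icc b⁻¹ b → ∀ y,
      |Real.log (lsPDF f m s y) - Real.log (lsPDF f m' s' y)| ≤ (|m - m'| + |s - s'|) * G y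
  lintegral_sq_le : ∀ {m s : ℝ}, |m| ≤ J → s ∈ Set.Icc b⁻¹ b →
    ∫⁻ y, ENNReal.ofReal (G y ^ 2) * ENNReal.ofReal (lsPDF f m s y) ≤ C

/-- The regularity properties of an error density which determine the minimax rate: it is bounded
away from zero on bounded sets, and the log-densities of its location-scale family are Lipschitz in
the parameters, locally uniformly, with a square integrable envelope. -/
structure IsRegularError (f : ℝ → ℝ) : Prop where
  measurable : Measurable f
  pos : ∀ y, 0 < f y
  lintegral_eq_one : ∫⁻ y, ENNReal.ofReal (f y) = 1
  exists_le_of_abs_le : ∀ R : ℝ, ∃ c : ℝ, 0 < c ∧ ∀ y, |y| ≤ R → c ≤ f y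
  exists_envelope : ∀ J b : ℝ, 0 < b → ∃ G C, IsLogLipschitzEnvelope f J b G C

theorem IsRegularError.isProbDensity {f : ℝ → ℝ} (hf : IsRegularError f) :
    IsProbDensity volume f :=
  ⟨hf.measurable, fun y => (hf.pos y).le, hf.lintegral_eq_one⟩

theorem lintegral_comp_add_mul (k : ℝ → ℝ≥0∞) (m : ℝ) {s : ℝ} (hs : 0 < s) :
    ∫⁻ e, k (m + s * e) = ENNReal.ofReal s⁻¹ * ∫⁻ y, k y := by
  have hmap : ∫⁻ e, k (m + s * e) = ∫⁻ y, k (m + y) ∂(Measure.map (s * ·) volume) :=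
    (lintegral_map_equiv (fun y => k (m + y))
      (Homeomorph.mulLeft₀ s hs.ne').toMeasurableEquiv).symm
  rw [hmap, Real.map_volume_mul_left hs.ne', lintegral_smul_measure,
    lintegral_add_left_eq_self k m, abs_of_pos (inv_pos.mpr hs), smul_eq_mul]

theorem lintegral_mul_lsPDF {f : ℝ → ℝ} (k : ℝ → ℝ≥0∞) (m : ℝ) {s : ℝ} (hs : 0 < s) :
    ∫⁻ y, k y * ENNReal.ofReal (lsPDF f m s y) = ∫⁻ e, k (m + s * e) * ENNReal.ofReal (f e) := by
  have hstd : ∀ e, (m + s * e - m) / s = e := fun e => by field_simp; ring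
  have haff := lintegral_comp_add_mul (fun y => k y * ENNReal.ofReal (f ((y - m) / s))) m hs
  simp only [hstd] at haff
  rw [haff, ← lintegral_const_mul' _ _ ENNReal.ofReal_ne_top]
  refine lintegral_congr fun y => ?_
  rw [lsPDF, div_eq_mul_inv, mul_comm (f _), ENNReal.ofReal_mul (inv_pos.mpr hs).le]
  ring

/-- The conditional density of the response given the covariate. -/
noncomputable def condPDF {X : Type*} (f : ℝ → ℝ) (μ σ : X → ℝ) (z : X × ℝ) : ℝ :=
  lsPDF f (μ z.1) (σ z.1) z.2

theorem condPDF_pos {X : Type*} {f : ℝ → ℝ} {μ σ : X → ℝ} (hf : ∀ y, 0 < f y)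
    (hσ : ∀ x, 0 < σ x) (z : X × ℝ) : 0 < condPDF f μ σ z :=
  div_pos (hf _) (hσ _)

section Model

variable {X : Type*} [MeasurableSpace X] {ν : Measure X} {f : ℝ → ℝ} {μ μ' σ σ' h : X → ℝ}

theorem measurable_condPDF (hf : Measurable f) (hμ : Measurable μ) (hσ : Measurable σ) :
    Measurable (condPDF f μ σ) :=
  (hf.comp ((measurable_snd.sub (hμ.comp measurable_fst)).div (hσ.comp measurable_fst))).div
    (hσ.comp measurable_fst)

theorem IsProbDensity.isProbabilityMeasure (hh : IsProbDensity ν h) :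
    IsProbabilityMeasure (ν.withDensity fun x => ENNReal.ofReal (h x)) :=
  ⟨by rw [withDensity_apply _ MeasurableSet.univ, Measure.restrict_univ, hh.2.2]⟩

theorem measurable_fst_prodMk_add_mul (hμ : Measurable μ) (hσ : Measurable σ) :
    Measurable fun p : X × ℝ => (p.1, μ p.1 + σ p.1 * p.2) :=
  measurable_fst.prodMk ((hμ.comp measurable_fst).add
    ((hσ.comp measurable_fst).mul measurable_snd))

theorem isProbabilityMeasure_obsLaw (hf : IsProbDensity volume f) (hμ : Measurable μ)
    (hσ : Measurable σ) (hh : IsProbDensity ν h) : IsProbabilityMeasure (obsLaw ν f μ σ h) := by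
  have : IsProbabilityMeasure (errorLaw f) := hf.isProbabilityMeasure
  have := hh.isProbabilityMeasure
  exact Measure.isProbabilityMeasure_map (measurable_fst_prodMk_add_mul hμ hσ).aemeasurable

theorem lintegral_obsLaw (hf : Measurable f) (hμ : Measurable μ) (hσ : Measurable σ)
    (hσ0 : ∀ x, 0 < σ x) (hh : IsProbDensity ν h) {k : X × ℝ → ℝ≥0∞} (hk : Measurable k) :
    ∫⁻ z, k z ∂(obsLaw ν f μ σ h) = ∫⁻ x, ENNReal.ofReal (h x) *
      (∫⁻ y, k (x, y) * ENNReal.ofReal (condPDF f μ σ (x, y))) ∂ν := by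
  have : SFinite (errorLaw f) := by unfold errorLaw; infer_instance
  have := hh.isProbabilityMeasure
  have hobs := measurable_fst_prodMk_add_mul hμ hσ
  have hinner : ∀ x, ∫⁻ e, k (x, μ x + σ x * e) ∂(errorLaw f) =
      ∫⁻ y, k (x, y) * ENNReal.ofReal (condPDF f μ σ (x, y)) := fun x => by
    have hkx : Measurable fun e => k (x, μ x + σ x * e) := by fun_prop
    simp only [condPDF]
    rw [lintegral_mul_lsPDF (fun y => k (x, y)) (μ x) (hσ0 x), errorLaw,
      lintegral_withDensity_eq_lintegral_mul _ hf.ennreal_ofReal hkx]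
    exact lintegral_congr fun e => mul_comm _ _
  have hmeas : Measurable fun x => ∫⁻ y, k (x, y) * ENNReal.ofReal (condPDF f μ σ (x, y)) :=
    (hk.mul (measurable_condPDF hf hμ hσ).ennreal_ofReal).lintegral_prod_right'
  rw [obsLaw, lintegral_map hk hobs,
    lintegral_prod (fun p : X × ℝ => k (p.1, μ p.1 + σ p.1 * p.2)) (hk.comp hobs).aemeasurable]
  simp only [hinner]
  rw [lintegral_withDensity_eq_lintegral_mul _ hh.1.ennreal_ofReal hmeas]
  rfl

theorem obsLaw_eq_withDensity (hf : Measurable f) (hf0 : ∀ y, 0 < f y) (hμ : Measurable μ)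
    (hσ : Measurable σ) (hσ0 : ∀ x, 0 < σ x) (hμ' : Measurable μ') (hσ' : Measurable σ')
    (hσ0' : ∀ x, 0 < σ' x) (hh : IsProbDensity ν h) :
    obsLaw ν f μ' σ' h = (obsLaw ν f μ σ h).withDensity fun z =>
      ENNReal.ofReal (condPDF f μ' σ' z / condPDF f μ σ z) := by
  have hr : Measurable fun z => ENNReal.ofReal (condPDF f μ' σ' z / condPDF f μ σ z) :=
    ((measurable_condPDF hf hμ' hσ').div (measurable_condPDF hf hμ hσ)).ennreal_ofReal
  ext s hs
  rw [withDensity_apply _ hs, ← lintegral_indicator hs, ← lintegral_indicator_one hs,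
    lintegral_obsLaw hf hμ hσ hσ0 hh (hr.indicator hs),
    lintegral_obsLaw hf hμ' hσ' hσ0' hh (measurable_one.indicator hs)]
  refine lintegral_congr fun x => ?_
  congr 1
  refine lintegral_congr fun y => ?_
  by_cases hxy : (x, y) ∈ s
  · rw [Set.indicator_of_mem hxy, Set.indicator_of_mem hxy, Pi.one_apply, one_mul,
      ← ENNReal.ofReal_mul (div_pos (condPDF_pos hf0 hσ0' _) (condPDF_pos hf0 hσ0 _)).le,
      div_mul_cancel₀ _ (condPDF_pos hf0 hσ0 _).ne']
  · simp [hxy]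

/-- Pairs of a location function bounded by `J` and a scale function with values in `[b⁻¹, b]`. -/
structure IsLocScaleParam (J b : ℝ) (μ σ : X → ℝ) : Prop where
  measurable_loc : Measurable μ
  measurable_scale : Measurable σ
  abs_loc_le : ∀ x, |μ x| ≤ J
  scale_mem : ∀ x, σ x ∈ Set.Icc b⁻¹ b

variable {J b : ℝ} {G : ℝ → ℝ} {C : NNReal}

theorem IsLocScaleParam.scale_pos (hθ : IsLocScaleParam J b μ σ) (hb : 0 < b) (x : X) : 0 < σ x :=
  (inv_pos.mpr hb).trans_le (hθ.scale_mem x).1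

theorem IsLocScaleParam.obsLaw_eq_withDensity (hθ : IsLocScaleParam J b μ σ)
    (hθ' : IsLocScaleParam J b μ' σ') (hb : 0 < b) (hf : IsRegularError f)
    (hh : IsProbDensity ν h) :
    obsLaw ν f μ' σ' h = (obsLaw ν f μ σ h).withDensity fun z =>
      ENNReal.ofReal (condPDF f μ' σ' z / condPDF f μ σ z) :=
  LocScale.obsLaw_eq_withDensity hf.measurable hf.pos hθ.measurable_loc hθ.measurable_scale
    (hθ.scale_pos hb) hθ'.measurable_loc hθ'.measurable_scale (hθ'.scale_pos hb) hh

theorem IsLocScaleParam.isProbabilityMeasure_obsLaw (hθ : IsLocScaleParam J b μ σ)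
    (hf : IsProbDensity volume f) (hh : IsProbDensity ν h) :
    IsProbabilityMeasure (obsLaw ν f μ σ h) :=
  LocScale.isProbabilityMeasure_obsLaw hf hθ.measurable_loc hθ.measurable_scale hh

namespace IsLogLipschitzEnvelope

theorem lintegral_mul_sq_le (hG : IsLogLipschitzEnvelope f J b G C) (hf : Measurable f)
    (hb : 0 < b) (hθ : IsLocScaleParam J b μ σ) (hh : IsProbDensity ν h) {g : X → ℝ≥0∞}
    (hg : Measurable g) :
    ∫⁻ z, g z.1 * ENNReal.ofReal (G z.2 ^ 2) ∂(obsLaw ν f μ σ h) ≤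
      C * ∫⁻ x, g x * ENNReal.ofReal (h x) ∂ν := by
  have hGsq : Measurable fun y => ENNReal.ofReal (G y ^ 2) :=
    (hG.measurable.pow_const 2).ennreal_ofReal
  have hcond : ∀ x, Measurable fun y => ENNReal.ofReal (condPDF f μ σ (x, y)) := fun x =>
    ((measurable_condPDF hf hθ.measurable_loc hθ.measurable_scale).comp
      measurable_prodMk_left).ennreal_ofReal
  rw [lintegral_obsLaw hf hθ.measurable_loc hθ.measurable_scale (hθ.scale_pos hb) hh
      (k := fun z => g z.1 * ENNReal.ofReal (G z.2 ^ 2))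
      ((hg.comp measurable_fst).mul (hGsq.comp measurable_snd)),
    ← lintegral_const_mul' _ _ ENNReal.coe_ne_top]
  refine lintegral_mono fun x => ?_
  simp_rw [mul_assoc]
  refine (congrArg _ (lintegral_const_mul (g x) (hGsq.mul (hcond x)))).trans_le ?_
  calc ENNReal.ofReal (h x) * (g x * ∫⁻ y, ENNReal.ofReal (G y ^ 2) *
        ENNReal.ofReal (condPDF f μ σ (x, y)))
      ≤ ENNReal.ofReal (h x) * (g x * C) := by
        gcongr
        exact hG.lintegral_sq_le (hθ.abs_loc_le x) (hθ.scale_mem x)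
    _ = C * (g x * ENNReal.ofReal (h x)) := by ring

theorem integrable_sq (hG : IsLogLipschitzEnvelope f J b G C) (hf : Measurable f)
    (hb : 0 < b) (hθ : IsLocScaleParam J b μ σ) (hh : IsProbDensity ν h) :
    Integrable (fun z : X × ℝ => G z.2 ^ 2) (obsLaw ν f μ σ h) := by
  refine (lintegral_ofReal_ne_top_iff_integrable
    ((hG.measurable.comp measurable_snd).pow_const 2).aestronglyMeasurable
    (ae_of_all _ fun _ => sq_nonneg _)).mp (ne_top_of_le_ne_top ENNReal.coe_ne_top (b := C) ?_)
  simpa [hh.2.2] using hG.lintegral_mul_sq_le hf hb hθ hh (g := 1) measurable_one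

theorem abs_log_div_le (hG : IsLogLipschitzEnvelope f J b G C) (hf0 : ∀ y, 0 < f y) (hb : 0 < b)
    (hθ : IsLocScaleParam J b μ σ) (hθ' : IsLocScaleParam J b μ' σ') (z : X × ℝ) :
    |Real.log (condPDF f μ' σ' z / condPDF f μ σ z)| ≤
      (|μ z.1 - μ' z.1| + |σ z.1 - σ' z.1|) * G z.2 := by
  rw [Real.log_div (condPDF_pos hf0 (hθ'.scale_pos hb) z).ne'
    (condPDF_pos hf0 (hθ.scale_pos hb) z).ne', abs_sub_comm]
  exact hG.abs_log_sub_log_le (hθ.abs_loc_le _) (hθ'.abs_loc_le _) (hθ.scale_mem _)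
    (hθ'.scale_mem _) _

theorem log_div_sq_le (hG : IsLogLipschitzEnvelope f J b G C) (hf0 : ∀ y, 0 < f y) (hb : 0 < b)
    (hθ : IsLocScaleParam J b μ σ) (hθ' : IsLocScaleParam J b μ' σ') (z : X × ℝ) :
    Real.log (condPDF f μ' σ' z / condPDF f μ σ z) ^ 2 ≤
      2 * ((μ z.1 - μ' z.1) ^ 2 + (σ z.1 - σ' z.1) ^ 2) * G z.2 ^ 2 := by
  calc Real.log (condPDF f μ' σ' z / condPDF f μ σ z) ^ 2
      ≤ ((|μ z.1 - μ' z.1| + |σ z.1 - σ' z.1|) * G z.2) ^ 2 :=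
        sq_le_sq' (abs_le.mp (hG.abs_log_div_le hf0 hb hθ hθ' z)).1
          (abs_le.mp (hG.abs_log_div_le hf0 hb hθ hθ' z)).2
    _ = (|μ z.1 - μ' z.1| + |σ z.1 - σ' z.1|) ^ 2 * G z.2 ^ 2 := mul_pow _ _ _
    _ ≤ 2 * ((μ z.1 - μ' z.1) ^ 2 + (σ z.1 - σ' z.1) ^ 2) * G z.2 ^ 2 := by
        gcongr
        rw [← sq_abs (μ z.1 - μ' z.1), ← sq_abs (σ z.1 - σ' z.1)]
        exact add_sq_le

theorem lintegral_log_div_sq_le (hG : IsLogLipschitzEnvelope f J b G C) (hf : IsRegularError f)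
    (hb : 0 < b) {μ₀ σ₀ : X → ℝ} (hθ₀ : IsLocScaleParam J b μ₀ σ₀) (hθ : IsLocScaleParam J b μ σ)
    (hθ' : IsLocScaleParam J b μ' σ') (hh : IsProbDensity ν h) :
    ∫⁻ z, ENNReal.ofReal (Real.log (condPDF f μ' σ' z / condPDF f μ σ z) ^ 2)
        ∂(obsLaw ν f μ₀ σ₀ h) ≤ 2 * C * (l2DistSq ν h μ μ' + l2DistSq ν h σ σ') := by
  let D : X → ℝ := fun x => 2 * ((μ x - μ' x) ^ 2 + (σ x - σ' x) ^ 2)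
  have hD : Measurable D := by
    have := hθ.measurable_loc; have := hθ.measurable_scale
    have := hθ'.measurable_loc; have := hθ'.measurable_scale
    fun_prop
  have hD_nonneg : ∀ x, 0 ≤ D x := fun x => by positivity
  have hsplit : ∫⁻ x, ENNReal.ofReal (D x) * ENNReal.ofReal (h x) ∂ν =
      2 * (l2DistSq ν h μ μ' + l2DistSq ν h σ σ') := by
    have hmeas : Measurable fun x => ENNReal.ofReal ((μ x - μ' x) ^ 2 * h x) :=
      (((hθ.measurable_loc.sub hθ'.measurable_loc).pow_const 2).mul hh.1).ennreal_ofReal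
    rw [l2DistSq, l2DistSq, ← lintegral_add_left hmeas, ← lintegral_const_mul' _ _ (by norm_num)]
    refine lintegral_congr fun x => ?_
    have hx := hh.2.1 x
    rw [← ENNReal.ofReal_mul (hD_nonneg x), ← ENNReal.ofReal_add (by positivity) (by positivity),
      ← ENNReal.ofReal_ofNat 2, ← ENNReal.ofReal_mul zero_le_two]
    congr 1
    ring
  calc ∫⁻ z, ENNReal.ofReal (Real.log (condPDF f μ' σ' z / condPDF f μ σ z) ^ 2)
        ∂(obsLaw ν f μ₀ σ₀ h)
      ≤ ∫⁻ z, ENNReal.ofReal (D z.1) * ENNReal.ofReal (G z.2 ^ 2) ∂(obsLaw ν f μ₀ σ₀ h) := by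
        refine lintegral_mono fun z => ?_
        rw [← ENNReal.ofReal_mul (hD_nonneg _)]
        exact ENNReal.ofReal_le_ofReal (hG.log_div_sq_le hf.pos hb hθ hθ' z)
    _ ≤ C * ∫⁻ x, ENNReal.ofReal (D x) * ENNReal.ofReal (h x) ∂ν :=
        hG.lintegral_mul_sq_le hf.measurable hb hθ₀ hh hD.ennreal_ofReal
    _ = 2 * C * (l2DistSq ν h μ μ' + l2DistSq ν h σ σ') := by rw [hsplit]; ring

end IsLogLipschitzEnvelope

theorem IsLocScaleParam.abs_sub_add_abs_sub_le (hθ : IsLocScaleParam J b μ σ)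
    (hθ' : IsLocScaleParam J b μ' σ') (hb : 0 < b) (x : X) :
    |μ x - μ' x| + |σ x - σ' x| ≤ 2 * J + b := by
  have hμ := abs_le.mp (hθ.abs_loc_le x)
  have hμ' := abs_le.mp (hθ'.abs_loc_le x)
  have hloc : |μ x - μ' x| ≤ 2 * J := abs_le.mpr ⟨by linarith, by linarith⟩
  have hscale : |σ x - σ' x| ≤ b := abs_le.mpr
    ⟨by linarith [hθ.scale_pos hb x, (hθ'.scale_mem x).2],
      by linarith [hθ'.scale_pos hb x, (hθ.scale_mem x).2]⟩
  linarith

theorem IsLocScaleParam.isLikelihoodRatio_condPDF (hθ : IsLocScaleParam J b μ σ)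
    (hθ' : IsLocScaleParam J b μ' σ') (hb : 0 < b) (hf : IsRegularError f)
    (hh : IsProbDensity ν h) :
    IsLikelihoodRatio (obsLaw ν f μ σ h) fun z => condPDF f μ' σ' z / condPDF f μ σ z := by
  have hmeas : Measurable fun z => condPDF f μ' σ' z / condPDF f μ σ z :=
    (measurable_condPDF hf.measurable hθ'.measurable_loc hθ'.measurable_scale).div
      (measurable_condPDF hf.measurable hθ.measurable_loc hθ.measurable_scale)
  have := hθ.isProbabilityMeasure_obsLaw hf.isProbDensity hh
  have := hθ'.isProbabilityMeasure_obsLaw hf.isProbDensity hh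
  refine ⟨hmeas, fun z => div_pos (condPDF_pos hf.pos (hθ'.scale_pos hb) z)
    (condPDF_pos hf.pos (hθ.scale_pos hb) z), ?_, ?_⟩
  · rw [← setLIntegral_univ, ← withDensity_apply _ MeasurableSet.univ,
      ← hθ.obsLaw_eq_withDensity hθ' hb hf hh, measure_univ]
  · obtain ⟨G, C, hG⟩ := hf.exists_envelope J b hb
    have hint := hG.integrable_sq hf.measurable hb hθ hh
    refine (((integrable_const 1).add hint).const_mul (2 * J + b)).mono'
      hmeas.log.aestronglyMeasurable (ae_of_all _ fun z => ?_)
    have hle := hG.abs_log_div_le hf.pos hb hθ hθ' z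
    have hsum := hθ.abs_sub_add_abs_sub_le hθ' hb z.1
    have hG_le : G z.2 ≤ 1 + G z.2 ^ 2 := by nlinarith [sq_nonneg (G z.2 - 1)]
    rw [Real.norm_eq_abs]
    calc _ ≤ _ := hle
      _ ≤ (|μ z.1 - μ' z.1| + |σ z.1 - σ' z.1|) * (1 + G z.2 ^ 2) := by gcongr
      _ ≤ (2 * J + b) * (1 + G z.2 ^ 2) := by gcongr

theorem IsLogLipschitzEnvelope.ofReal_neg_integral_log_le (hG : IsLogLipschitzEnvelope f J b G C)
    (hf : IsRegularError f) (hb : 0 < b) (hθ : IsLocScaleParam J b μ σ)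
    (hθ' : IsLocScaleParam J b μ' σ') (hh : IsProbDensity ν h) :
    ENNReal.ofReal (-∫ z, Real.log (condPDF f μ' σ' z / condPDF f μ σ z) ∂(obsLaw ν f μ σ h)) ≤
      4 * C * (l2DistSq ν h μ μ' + l2DistSq ν h σ σ') := by
  have := hθ.isProbabilityMeasure_obsLaw hf.isProbDensity hh
  refine ((hθ.isLikelihoodRatio_condPDF hθ' hb hf hh).ofReal_neg_integral_log_le
    (hθ.obsLaw_eq_withDensity hθ' hb hf hh)).trans
    ((add_le_add (hG.lintegral_log_div_sq_le hf hb hθ hθ hθ' hh)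
      (hG.lintegral_log_div_sq_le hf hb hθ' hθ hθ' hh)).trans_eq ?_)
  ring

end Model

/-! ### The lower bound -/

section LowerBound

theorem sum_measureReal_le_one {Ω ι : Type*} [MeasurableSpace Ω] (P : Measure Ω)
    [IsProbabilityMeasure P] (s : Finset ι) {A : ι → Set Ω} (hA : ∀ i ∈ s, MeasurableSet (A i))
    (hd : (s : Set ι).PairwiseDisjoint A) : ∑ i ∈ s, P.real (A i) ≤ 1 := by
  rw [← measureReal_biUnion_finset hd hA]
  exact measureReal_le_one

theorem exists_measureReal_le_half {Ω Θ : Type*} [MeasurableSpace Ω] {P : Θ → Measure Ω}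
    {N N' : Finset Θ} (hN : N.Nonempty) (hP : ∀ v ∈ N', IsProbabilityMeasure (P v))
    {A : Θ → Set Ω} (hA : ∀ u ∈ N, MeasurableSet (A u)) (hd : (N : Set Θ).PairwiseDisjoint A)
    {L : ℝ} (hL : 0 ≤ L) (hcard : L * N'.card ≤ N.card / 4)
    (hchange : ∀ u ∈ N, ∃ v ∈ N', (P u).real (A u) ≤ L * (P v).real (A u) + 1 / 4) :
    ∃ u ∈ N, (P u).real (A u) ≤ 1 / 2 := by
  have hchange_sum : ∀ u ∈ N, (P u).real (A u) ≤ L * ∑ v ∈ N', (P v).real (A u) + 1 / 4 :=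
    fun u hu => by
      obtain ⟨v, hv, hle⟩ := hchange u hu
      refine hle.trans ?_
      gcongr
      exact Finset.single_le_sum (f := fun v => (P v).real (A u))
        (fun _ _ => measureReal_nonneg) hv
  have hsum : ∑ u ∈ N, ∑ v ∈ N', (P v).real (A u) ≤ N'.card := by
    rw [Finset.sum_comm, Finset.card_eq_sum_ones, Nat.cast_sum, Nat.cast_one]
    exact Finset.sum_le_sum fun v hv =>
      have := hP v hv
      sum_measureReal_le_one (P v) N hA hd
  refine Finset.exists_le_of_sum_le hN ?_
  calc ∑ u ∈ N, (P u).real (A u)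
      ≤ ∑ u ∈ N, (L * ∑ v ∈ N', (P v).real (A u) + 1 / 4) := Finset.sum_le_sum hchange_sum
    _ = L * ∑ u ∈ N, ∑ v ∈ N', (P v).real (A u) + N.card / 4 := by
        rw [Finset.sum_add_distrib, ← Finset.mul_sum, Finset.sum_const, nsmul_eq_mul]
        ring
    _ ≤ N.card / 4 + N.card / 4 := by
        gcongr
        exact (mul_le_mul_of_nonneg_left hsum hL).trans hcard
    _ = ∑ _u ∈ N, (1 / 2 : ℝ) := by rw [Finset.sum_const, nsmul_eq_mul]; ring

theorem ofReal_half_le_lintegral {Ω : Type*} [MeasurableSpace Ω] {P : Measure Ω}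
    [IsProbabilityMeasure P] {g : Ω → ℝ≥0∞} (hg : Measurable g) {c : ℝ} (hc : 0 ≤ c)
    (hP : P.real {d | g d < ENNReal.ofReal c} ≤ 1 / 2) :
    ENNReal.ofReal (c / 2) ≤ ∫⁻ d, g d ∂P := by
  have hcompl : ENNReal.ofReal (1 / 2) ≤ P {d | ENNReal.ofReal c ≤ g d} := by
    have hset : {d | ENNReal.ofReal c ≤ g d} = {d | g d < ENNReal.ofReal c}ᶜ := by
      ext d
      simp
    rw [hset, ← ofReal_measureReal,
      probReal_compl_eq_one_sub (measurableSet_lt hg measurable_const)]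
    exact ENNReal.ofReal_le_ofReal (by linarith)
  calc ENNReal.ofReal (c / 2) = ENNReal.ofReal c * ENNReal.ofReal (1 / 2) := by
        rw [← ENNReal.ofReal_mul hc, mul_one_div]
    _ ≤ ENNReal.ofReal c * P {d | ENNReal.ofReal c ≤ g d} := by gcongr
    _ ≤ ∫⁻ d, g d ∂P := mul_meas_ge_le_lintegral hg _

theorem exp_mul_card_le {α : Type*} {N N' : Finset α} (hN : N.Nonempty) (hN' : N'.Nonempty) {t : ℝ}
    (hle : t + Real.log N'.card + Real.log 4 ≤ Real.log N.card) :
    Real.exp t * N'.card ≤ N.card / 4 := by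
  have hN_pos : (0 : ℝ) < N.card := by exact_mod_cast hN.card_pos
  have hN'_pos : (0 : ℝ) < N'.card := by exact_mod_cast hN'.card_pos
  rw [← Real.log_le_log_iff (by positivity) (by positivity),
    Real.log_mul (Real.exp_pos _).ne' hN'_pos.ne', Real.log_exp,
    Real.log_div hN_pos.ne' four_ne_zero]
  linarith

variable {X : Type*} [MeasurableSpace X] {ν : Measure X} {f : ℝ → ℝ} {h u v w σ : X → ℝ}

theorem l2DistSq_eq_lintegral_withDensity (hh : IsProbDensity ν h) (hu : Measurable u)
    (hv : Measurable v) :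
    l2DistSq ν h u v =
      ∫⁻ x, ENNReal.ofReal ((u x - v x) ^ 2) ∂(ν.withDensity fun x => ENNReal.ofReal (h x)) := by
  have hsq : Measurable fun x => ENNReal.ofReal ((u x - v x) ^ 2) :=
    ((hu.sub hv).pow_const 2).ennreal_ofReal
  rw [lintegral_withDensity_eq_lintegral_mul _ hh.1.ennreal_ofReal hsq]
  refine lintegral_congr fun x => ?_
  rw [Pi.mul_apply, ← ENNReal.ofReal_mul (hh.2.1 x), mul_comm]

theorem l2DistSq_le_two_mul (hh : IsProbDensity ν h) (hu : Measurable u) (hw : Measurable w) :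
    l2DistSq ν h u v ≤ 2 * (l2DistSq ν h u w + l2DistSq ν h v w) := by
  have hmeas : Measurable fun x => ENNReal.ofReal ((u x - w x) ^ 2 * h x) :=
    (((hu.sub hw).pow_const 2).mul hh.1).ennreal_ofReal
  rw [l2DistSq, l2DistSq, l2DistSq, ← lintegral_add_left hmeas,
    ← lintegral_const_mul' _ _ ENNReal.ofNat_ne_top]
  refine lintegral_mono fun x => ?_
  have hx := hh.2.1 x
  rw [← ENNReal.ofReal_add (by positivity) (by positivity), ← ENNReal.ofReal_ofNat 2,
    ← ENNReal.ofReal_mul zero_le_two]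
  refine ENNReal.ofReal_le_ofReal ?_
  nlinarith [mul_nonneg (sq_nonneg ((u x - w x) + (v x - w x))) hx]

theorem measurable_l2DistSq {D : Type*} [MeasurableSpace D] {m : D → X → ℝ}
    (hh : IsProbDensity ν h) (hu : Measurable u) (hm : Measurable (Function.uncurry m)) :
    Measurable fun d => l2DistSq ν h u (m d) := by
  have := hh.isProbabilityMeasure
  have hm' : ∀ d, Measurable (m d) := fun d => hm.comp measurable_prodMk_left
  simp_rw [fun d => l2DistSq_eq_lintegral_withDensity hh hu (hm' d)]
  exact (((hu.comp measurable_snd).sub hm).pow_const 2).ennreal_ofReal.lintegral_prod_right'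

theorem IsL2Packing.pairwiseDisjoint {U : Set (X → ℝ)} {η : ℝ} {N : Finset (X → ℝ)}
    {D : Type*} {m : D → X → ℝ} (hN : IsL2Packing ν h U η N) (hh : IsProbDensity ν h)
    (hU : ∀ u ∈ U, Measurable u) (hm : ∀ d, Measurable (m d)) :
    (N : Set (X → ℝ)).PairwiseDisjoint
      fun u => {d | l2DistSq ν h u (m d) < ENNReal.ofReal (η ^ 2 / 4)} := by
  intro u hu v hv huv
  refine Set.disjoint_left.mpr fun d hdu hdv => (hN.pairwise hu hv huv).not_ge ?_
  calc l2DistSq ν h u v ≤ 2 * (l2DistSq ν h u (m d) + l2DistSq ν h v (m d)) :=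
        l2DistSq_le_two_mul hh (hU u (hN.subset hu)) (hm d)
    _ ≤ 2 * (ENNReal.ofReal (η ^ 2 / 4) + ENNReal.ofReal (η ^ 2 / 4)) := by
        gcongr
        exacts [le_of_lt hdu, le_of_lt hdv]
    _ = ENNReal.ofReal (η ^ 2) := by
        rw [← ENNReal.ofReal_add (by positivity) (by positivity), ← ENNReal.ofReal_ofNat 2,
          ← ENNReal.ofReal_mul zero_le_two]
        congr 1
        ring

variable {J b : ℝ} {G : ℝ → ℝ} {C : NNReal}

theorem IsLogLipschitzEnvelope.pi_obsLaw_real_le (hG : IsLogLipschitzEnvelope f J b G C)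
    (hf : IsRegularError f) (hb : 0 < b) (hu : IsLocScaleParam J b u σ)
    (hv : IsLocScaleParam J b v σ) (hh : IsProbDensity ν h) {δ : ℝ}
    (huv : l2DistSq ν h u v ≤ ENNReal.ofReal (δ ^ 2)) {n : ℕ} {A : Set (Fin n → X × ℝ)}
    (hA : MeasurableSet A) :
    (Measure.pi fun _ => obsLaw ν f u σ h).real A ≤
      Real.exp (4 * (1 + n * (4 * C * δ ^ 2))) * (Measure.pi fun _ => obsLaw ν f v σ h).real A +
        1 / 4 := by
  have := hu.isProbabilityMeasure_obsLaw hf.isProbDensity hh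
  have := hv.isProbabilityMeasure_obsLaw hf.isProbDensity hh
  have hKL : -∫ z, Real.log (condPDF f v σ z / condPDF f u σ z) ∂(obsLaw ν f u σ h) ≤
      4 * C * δ ^ 2 := by
    refine (ENNReal.ofReal_le_ofReal_iff (by positivity)).mp
      ((hG.ofReal_neg_integral_log_le hf hb hu hv hh).trans ?_)
    rw [l2DistSq_self, add_zero, ENNReal.ofReal_mul (by positivity),
      ENNReal.ofReal_mul (by positivity), ENNReal.ofReal_ofNat, ENNReal.ofReal_coe_nnreal]
    gcongr
  have hpos : 0 < 1 + n * (4 * C * δ ^ 2) := by positivity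
  refine ((hu.isLikelihoodRatio_condPDF hv hb hf hh).pi_real_le_exp_mul_add
    (hu.obsLaw_eq_withDensity hv hb hf hh) hA (mul_pos four_pos hpos)).trans ?_
  rw [Fintype.card_fin]
  refine add_le_add le_rfl ?_
  rw [div_le_div_iff₀ (mul_pos four_pos hpos) four_pos]
  nlinarith [mul_le_mul_of_nonneg_left hKL n.cast_nonneg]

variable {U S H : Set (X → ℝ)}

theorem le_minimaxRisk {n : ℕ} {c : ℝ≥0∞} (hσ : σ ∈ S) (hh : h ∈ H)
    (hc : ∀ m : (Fin n → X × ℝ) → X → ℝ, Measurable (Function.uncurry m) →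
      ∃ μ ∈ U, c ≤ risk ν f n m μ σ h) : c ≤ minimaxRisk ν f U S H n :=
  le_iInf₂ fun m hm =>
    have ⟨μ, hμ, hle⟩ := hc m hm
    hle.trans (le_iSup₂_of_le μ hμ (le_iSup₂_of_le σ hσ (le_iSup₂_of_le h hh le_rfl)))

theorem IsLogLipschitzEnvelope.ofReal_le_minimaxRisk (hG : IsLogLipschitzEnvelope f J b G C)
    (hf : IsRegularError f) (hb : 0 < b) (hU : ∀ u ∈ U, IsLocScaleParam J b u σ) (hσ : σ ∈ S)
    (hhH : h ∈ H) (hh : IsProbDensity ν h) {n : ℕ} {δ η : ℝ} {N N' : Finset (X → ℝ)}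
    (hN : IsL2Packing ν h U η N) (hne : N.Nonempty) (hN' : (N' : Set (X → ℝ)) ⊆ U)
    (hcover : ∀ u ∈ U, ∃ v ∈ N', l2DistSq ν h u v ≤ ENNReal.ofReal (δ ^ 2))
    (hcard : Real.exp (4 * (1 + n * (4 * C * δ ^ 2))) * N'.card ≤ N.card / 4) :
    ENNReal.ofReal (η ^ 2 / 8) ≤ minimaxRisk ν f U S H n := by
  refine le_minimaxRisk hσ hhH fun m hm => ?_
  have hprob : ∀ u ∈ U, IsProbabilityMeasure (obsLaw ν f u σ h) := fun u hu =>
    (hU u hu).isProbabilityMeasure_obsLaw hf.isProbDensity hh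
  have hmeas : ∀ u ∈ U, Measurable fun d => l2DistSq ν h u (m d) := fun u hu =>
    measurable_l2DistSq hh (hU u hu).measurable_loc hm
  have hA : ∀ u ∈ U, MeasurableSet {d | l2DistSq ν h u (m d) < ENNReal.ofReal (η ^ 2 / 4)} :=
    fun u hu => measurableSet_lt (hmeas u hu) measurable_const
  obtain ⟨u, hu, hle⟩ := exists_measureReal_le_half
    (P := fun u => Measure.pi fun _ : Fin n => obsLaw ν f u σ h) hne
    (fun v hv => have := hprob v (hN' hv); inferInstance) (fun u hu => hA u (hN.subset hu))
    (hN.pairwiseDisjoint hh (fun u hu => (hU u hu).measurable_loc)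
      fun d => hm.comp measurable_prodMk_left) (Real.exp_pos _).le hcard
    fun u hu => by
      obtain ⟨v, hv, huv⟩ := hcover u (hN.subset hu)
      exact ⟨v, hv, hG.pi_obsLaw_real_le hf hb (hU u (hN.subset hu)) (hU v (hN' hv)) hh huv
        (hA u (hN.subset hu))⟩
  have := hprob u (hN.subset hu)
  refine ⟨u, hN.subset hu, ?_⟩
  have hrisk := ofReal_half_le_lintegral (hmeas u (hN.subset hu)) (by positivity) hle
  rwa [div_div, show (4 : ℝ) * 2 = 8 by norm_num] at hrisk

theorem exists_minimaxRisk_ge (hf : IsRegularError f) (hb : 0 < b)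
    (hU : ∀ u ∈ U, IsLocScaleParam J b u σ) (hσ : σ ∈ S) (hhH : h ∈ H) (hh : IsProbDensity ν h)
    (hTB : TotallyBoundedL2 ν h U) {M : ℝ → ℝ} (hM : M =Θ[𝓝[>] (0 : ℝ)] packingEntropy ν h U)
    (hrich : IsRich M) {ε : ℕ → ℝ} (hε : SolvesEntropyEquation ν h U ε)
    (hε0 : Tendsto ε atTop (𝓝[>] 0)) :
    ∃ c : ℝ, 0 < c ∧ ∀ᶠ n in atTop, ENNReal.ofReal (c * ε n ^ 2) ≤ minimaxRisk ν f U S H n := by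
  obtain ⟨G, C, hG⟩ := hf.exists_envelope J b hb
  have hE0 := packingEntropy_nonneg (ν := ν) (h := h) (U := U)
  have htop := (hrich.tendsto_atTop hM hE0 (packingEntropy_antitoneOn hTB)).comp hε0
  obtain ⟨B, hB, hBbound⟩ := hε.2.2.exists_pos
  obtain ⟨γ, hγ, hgrow⟩ := hrich.exists_mul_le hM hE0 (2 + 16 * C * B)
  refine ⟨γ ^ 2 / 8, by positivity, ?_⟩
  filter_upwards [hε.1, hε0.eventually hgrow, hBbound.bound,
    htop.eventually_ge_atTop (4 + Real.log 4)] with n hpos hgrow hbound hlarge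
  simp only [Function.comp_apply] at hlarge
  rw [Real.norm_eq_abs, Real.norm_eq_abs, abs_of_nonneg (hE0 _),
    abs_of_nonneg (by positivity)] at hbound
  obtain ⟨N, hN⟩ := exists_isMaxL2Packing hTB (mul_pos hγ hpos)
  obtain ⟨N', hN'⟩ := exists_isMaxL2Packing hTB hpos
  have hlog4 : 0 < Real.log 4 := Real.log_pos (by norm_num)
  have hCB : 0 ≤ 16 * C * B * packingEntropy ν h U (ε n) := by have := hE0 (ε n); positivity
  have hne : ∀ {K : Finset (X → ℝ)}, 0 < Real.log K.card → K.Nonempty := fun hlog =>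
    Finset.nonempty_iff_ne_empty.mpr fun hempty => by simp [hempty] at hlog
  have hcard : Real.exp (4 * (1 + n * (4 * C * ε n ^ 2))) * N'.card ≤ N.card / 4 := by
    rw [hN.packingEntropy_eq] at hgrow
    refine exp_mul_card_le (hne (by linarith)) (hne (hN'.packingEntropy_eq ▸ by linarith)) ?_
    rw [← hN'.packingEntropy_eq]
    nlinarith [mul_le_mul_of_nonneg_left hbound C.2]
  rw [div_mul_eq_mul_div, ← mul_pow]
  exact hG.ofReal_le_minimaxRisk hf hb hU hσ hhH hh hN.toIsL2Packing
    (hne (by rw [← hN.packingEntropy_eq]; linarith)) hN'.subset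
    (fun u hu => hN'.exists_l2DistSq_le hpos.le hu) hcard

end LowerBound

/-! ### Inversion of distribution functions -/

section Quantile

theorem le_measureReal_Iic_of_quantile_lt {P : Measure ℝ} [IsProbabilityMeasure P] {τ y : ℝ}
    (hτ : τ < 1) (hy : quantile P τ < y) : τ ≤ P.real (Set.Iic y) := by
  have hne : {y : ℝ | ENNReal.ofReal τ ≤ P (Set.Iic y)}.Nonempty := by
    have htop : Tendsto (fun y => P (Set.Iic y)) atTop (𝓝 1) := by
      simpa using tendsto_measure_Iic_atTop P
    obtain ⟨a, ha⟩ := (htop.eventually_const_lt (ENNReal.ofReal_lt_one.mpr hτ)).exists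
    exact ⟨a, ha.le⟩
  obtain ⟨a, ha, hay⟩ := exists_lt_of_csInf_lt hne hy
  calc τ ≤ P.real (Set.Iic a) := (ENNReal.ofReal_le_iff_le_toReal (measure_ne_top _ _)).mp ha
    _ ≤ P.real (Set.Iic y) := measureReal_mono (Set.Iic_subset_Iic.mpr hay.le)

theorem measureReal_Iic_lt_of_lt_quantile {P : Measure ℝ} [IsProbabilityMeasure P] {τ y : ℝ}
    (hτ : 0 < τ) (hy : y < quantile P τ) : P.real (Set.Iic y) < τ := by
  have hbdd : BddBelow {y : ℝ | ENNReal.ofReal τ ≤ P (Set.Iic y)} := by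
    obtain ⟨a, ha⟩ := ((tendsto_cdf_atBot P).eventually_lt_const hτ).exists
    rw [cdf_eq_real] at ha
    refine ⟨a, fun c hc => le_of_not_gt fun hca => ha.not_ge ?_⟩
    exact ((ENNReal.ofReal_le_iff_le_toReal (measure_ne_top _ _)).mp hc).trans
      (measureReal_mono (Set.Iic_subset_Iic.mpr hca.le))
  exact lt_of_not_ge fun hle => notMem_of_lt_csInf hy hbdd
    ((ENNReal.ofReal_le_iff_le_toReal (measure_ne_top _ _)).mpr hle)

theorem errorLaw_real_Iic_add_mul_le {f : ℝ → ℝ} (hf : Measurable f)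
    [IsFiniteMeasure (errorLaw f)] {c u v : ℝ} (hc : 0 ≤ c) (huv : u ≤ v)
    (hfc : ∀ y ∈ Set.Ioc u v, c ≤ f y) :
    (errorLaw f).real (Set.Iic u) + c * (v - u) ≤ (errorLaw f).real (Set.Iic v) := by
  rw [← Set.Iic_union_Ioc_eq_Iic huv, measureReal_union (Set.Iic_disjoint_Ioc le_rfl)
    measurableSet_Ioc]
  gcongr
  refine (ENNReal.ofReal_le_iff_le_toReal (measure_ne_top _ _)).mp ?_
  rw [errorLaw, withDensity_apply _ measurableSet_Ioc, ENNReal.ofReal_mul hc,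
    ← Real.volume_Ioc, ← setLIntegral_const]
  exact setLIntegral_mono hf.ennreal_ofReal fun y hy => ENNReal.ofReal_le_ofReal (hfc y hy)

theorem IsRegularError.exists_cdf_growth {f : ℝ → ℝ} (hf : IsRegularError f) {τ : ℝ} (hτ0 : 0 < τ)
    (hτ1 : τ < 1) (hq : quantile (errorLaw f) τ = 0) (R : ℝ) :
    ∃ c : ℝ, 0 < c ∧ ∀ u : ℝ, |u| ≤ R →
      (0 < u → τ + c * u ≤ (errorLaw f).real (Set.Iic u)) ∧
      (u < 0 → (errorLaw f).real (Set.Iic u) ≤ τ + c * u) := by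
  have : IsProbabilityMeasure (errorLaw f) := hf.isProbDensity.isProbabilityMeasure
  obtain ⟨c, hc, hfc⟩ := hf.exists_le_of_abs_le R
  refine ⟨c / 2, by positivity, fun u hu => ⟨fun hpos => ?_, fun hneg => ?_⟩⟩ <;>
    have hu := abs_le.mp hu
  · have hτu : τ ≤ (errorLaw f).real (Set.Iic (u / 2)) :=
      le_measureReal_Iic_of_quantile_lt hτ1 (by rw [hq]; linarith)
    have hincr := errorLaw_real_Iic_add_mul_le hf.measurable (u := u / 2) (v := u) hc.le
      (by linarith) fun y hy => hfc y (abs_le.mpr ⟨by linarith [hy.1], by linarith [hy.2]⟩)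
    linarith
  · have hτu : (errorLaw f).real (Set.Iic (u / 2)) < τ :=
      measureReal_Iic_lt_of_lt_quantile hτ0 (by rw [hq]; linarith)
    have hincr := errorLaw_real_Iic_add_mul_le hf.measurable (u := u) (v := u / 2) hc.le
      (by linarith) fun y hy => hfc y (abs_le.mpr ⟨by linarith [hy.1], by linarith [hy.2]⟩)
    linarith

/-- The `τ`-th quantile of a distribution function `F`, truncated to `[-J, J]`. It is written as
the length of a sublevel set so that it depends measurably on `F` also when `F` is not monotone. -/
noncomputable def truncQuantile (τ J : ℝ) (F : ℝ → ℝ≥0∞) : ℝ :=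
  -J + (volume {t | t ∈ Set.Ioc (-J) J ∧ F t < ENNReal.ofReal τ}).toReal

variable {τ J : ℝ}

theorem truncQuantile_le {F : ℝ → ℝ≥0∞} {a : ℝ} (ha : -J ≤ a)
    (hF : ∀ t ∈ Set.Ioc (-J) J, a < t → ENNReal.ofReal τ ≤ F t) : truncQuantile τ J F ≤ a := by
  have hsub : {t | t ∈ Set.Ioc (-J) J ∧ F t < ENNReal.ofReal τ} ⊆ Set.Ioc (-J) a :=
    fun t ht => ⟨ht.1.1, le_of_not_gt fun hat => (hF t ht.1 hat).not_gt ht.2⟩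
  have hvol : (volume {t | t ∈ Set.Ioc (-J) J ∧ F t < ENNReal.ofReal τ}).toReal ≤ a - -J :=
    ENNReal.toReal_le_of_le_ofReal (by linarith) ((measure_mono hsub).trans_eq Real.volume_Ioc)
  rw [truncQuantile]
  linarith

theorem le_truncQuantile {F : ℝ → ℝ≥0∞} {a : ℝ} (ha : a ≤ J)
    (hF : ∀ t ∈ Set.Ioc (-J) J, t < a → F t < ENNReal.ofReal τ) : a ≤ truncQuantile τ J F := by
  have hsub : Set.Ioo (-J) a ⊆ {t | t ∈ Set.Ioc (-J) J ∧ F t < ENNReal.ofReal τ} := fun t ht =>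
    ⟨⟨ht.1, ht.2.le.trans ha⟩, hF t ⟨ht.1, ht.2.le.trans ha⟩ ht.2⟩
  have hfin : volume {t | t ∈ Set.Ioc (-J) J ∧ F t < ENNReal.ofReal τ} ≠ ⊤ :=
    measure_ne_top_of_subset (fun t ht => ht.1) measure_Ioc_lt_top.ne
  have hvol : a - -J ≤ (volume {t | t ∈ Set.Ioc (-J) J ∧ F t < ENNReal.ofReal τ}).toReal :=
    (ENNReal.ofReal_le_iff_le_toReal hfin).mp (Real.volume_Ioo.symm.trans_le (measure_mono hsub))
  rw [truncQuantile]
  linarith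

theorem abs_truncQuantile_sub_le {m c δ : ℝ} (hτ : 0 < τ) (hc : 0 < c) (hδ : 0 ≤ δ)
    (hm : |m| ≤ J) {F : ℝ → ℝ} {F' : ℝ → ℝ≥0∞} (hF0 : ∀ t, 0 ≤ F t)
    (hright : ∀ t ∈ Set.Ioc (-J) J, m < t → τ + c * (t - m) ≤ F t)
    (hleft : ∀ t ∈ Set.Ioc (-J) J, t < m → F t ≤ τ + c * (t - m))
    (hF'_le : ∀ t, F' t ≤ ENNReal.ofReal (F t) + ENNReal.ofReal δ)
    (hle_F' : ∀ t, ENNReal.ofReal (F t) ≤ F' t + ENNReal.ofReal δ) :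
    |truncQuantile τ J F' - m| ≤ δ / c := by
  have hm := abs_le.mp hm
  have hδc : 0 ≤ δ / c := by positivity
  have hupper : truncQuantile τ J F' ≤ m + δ / c := by
    refine truncQuantile_le (by linarith) fun t ht hlt => ?_
    have hgap : δ < (t - m) * c := (div_lt_iff₀ hc).mp (by linarith)
    refine (ENNReal.add_le_add_iff_right ENNReal.ofReal_ne_top).mp (le_trans ?_ (hle_F' t))
    rw [← ENNReal.ofReal_add hτ.le hδ]
    exact ENNReal.ofReal_le_ofReal (by linarith [hright t ht (by linarith)])
  have hlower : m - δ / c ≤ truncQuantile τ J F' := by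
    refine le_truncQuantile (by linarith) fun t ht hlt => ?_
    have hgap : δ < (m - t) * c := (div_lt_iff₀ hc).mp (by linarith)
    refine (hF'_le t).trans_lt ?_
    rw [← ENNReal.ofReal_add (hF0 t) hδ, ENNReal.ofReal_lt_ofReal_iff hτ]
    linarith [hleft t ht (by linarith)]
  exact abs_le.mpr ⟨by linarith, by linarith⟩

theorem measurable_truncQuantile {D : Type*} [MeasurableSpace D] {F : D → ℝ → ℝ≥0∞} (τ J : ℝ)
    (hF : Measurable (Function.uncurry F)) : Measurable fun d => truncQuantile τ J (F d) := by
  have hs : MeasurableSet {p : D × ℝ | p.2 ∈ Set.Ioc (-J) J ∧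
      Function.uncurry F p < ENNReal.ofReal τ} :=
    (measurable_snd measurableSet_Ioc).inter (measurableSet_lt hF measurable_const)
  exact ((measurable_measure_prodMk_left (ν := volume) hs).ennreal_toReal).const_add (-J)

end Quantile

/-! ### Total variation and Hellinger distance -/

section TotalVariation

variable {Ω : Type*} [MeasurableSpace Ω] {ν : Measure Ω}

theorem sq_lintegral_mul_le {f g : Ω → ℝ≥0∞} (hf : AEMeasurable f ν) (hg : AEMeasurable g ν) :
    (∫⁻ y, f y * g y ∂ν) ^ 2 ≤ (∫⁻ y, f y ^ 2 ∂ν) * ∫⁻ y, g y ^ 2 ∂ν := by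
  have hsq : ∀ a : ℝ≥0∞, (a ^ (1 / 2 : ℝ)) ^ 2 = a := fun a => by
    rw [← ENNReal.rpow_ofNat, ← ENNReal.rpow_mul]
    norm_num
  have hHölder := ENNReal.lintegral_mul_le_Lp_mul_Lq ν Real.HolderConjugate.two_two hf hg
  simp only [ENNReal.rpow_ofNat, Pi.mul_apply] at hHölder
  simpa only [mul_pow, hsq] using pow_le_pow_left' hHölder 2

variable {p q : Ω → ℝ}

theorem setLIntegral_ofReal_le_add (hq : Measurable q) (s : Set Ω) :
    ∫⁻ y in s, ENNReal.ofReal (p y) ∂ν ≤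
      ∫⁻ y in s, ENNReal.ofReal (q y) ∂ν + ∫⁻ y, ENNReal.ofReal |p y - q y| ∂ν := by
  calc ∫⁻ y in s, ENNReal.ofReal (p y) ∂ν
      ≤ ∫⁻ y in s, (ENNReal.ofReal (q y) + ENNReal.ofReal |p y - q y|) ∂ν :=
        lintegral_mono fun y => (ENNReal.ofReal_le_ofReal (by
          linarith [le_abs_self (p y - q y)])).trans ENNReal.ofReal_add_le
    _ = ∫⁻ y in s, ENNReal.ofReal (q y) ∂ν + ∫⁻ y in s, ENNReal.ofReal |p y - q y| ∂ν :=
        lintegral_add_left hq.ennreal_ofReal _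
    _ ≤ ∫⁻ y in s, ENNReal.ofReal (q y) ∂ν + ∫⁻ y, ENNReal.ofReal |p y - q y| ∂ν :=
        add_le_add_right (setLIntegral_le_lintegral _ _) _

namespace IsProbDensity

theorem lintegral_add (hp : IsProbDensity ν p) (hq : IsProbDensity ν q) :
    ∫⁻ y, ENNReal.ofReal (p y + q y) ∂ν = 2 := by
  simp_rw [ENNReal.ofReal_add (hp.2.1 _) (hq.2.1 _)]
  rw [lintegral_add_left hp.1.ennreal_ofReal, hp.2.2, hq.2.2, one_add_one_eq_two]

theorem lintegral_abs_sub_le_two (hp : IsProbDensity ν p) (hq : IsProbDensity ν q) :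
    ∫⁻ y, ENNReal.ofReal |p y - q y| ∂ν ≤ 2 := by
  rw [← hp.lintegral_add hq]
  exact lintegral_mono fun y => ENNReal.ofReal_le_ofReal
    (abs_le.mpr ⟨by linarith [hp.2.1 y], by linarith [hq.2.1 y]⟩)

theorem lintegral_sqrt_add_sqrt_sq_le (hp : IsProbDensity ν p) (hq : IsProbDensity ν q) :
    ∫⁻ y, ENNReal.ofReal (√(p y) + √(q y)) ^ 2 ∂ν ≤ 4 := by
  calc ∫⁻ y, ENNReal.ofReal (√(p y) + √(q y)) ^ 2 ∂ν
      ≤ ∫⁻ y, 2 * ENNReal.ofReal (p y + q y) ∂ν := by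
        refine lintegral_mono fun y => ?_
        rw [← ENNReal.ofReal_pow (by positivity), ← ENNReal.ofReal_ofNat 2,
          ← ENNReal.ofReal_mul zero_le_two]
        refine ENNReal.ofReal_le_ofReal (add_sq_le.trans_eq ?_)
        rw [Real.sq_sqrt (hp.2.1 y), Real.sq_sqrt (hq.2.1 y)]
    _ = 4 := by
        rw [lintegral_const_mul' _ _ ENNReal.ofNat_ne_top, hp.lintegral_add hq]
        norm_num

theorem sq_lintegral_abs_sub_le (hp : IsProbDensity ν p) (hq : IsProbDensity ν q) :
    (∫⁻ y, ENNReal.ofReal |p y - q y| ∂ν) ^ 2 ≤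
      4 * ∫⁻ y, ENNReal.ofReal ((√(p y) - √(q y)) ^ 2) ∂ν := by
  have hfactor : ∀ y, ENNReal.ofReal |p y - q y| =
      ENNReal.ofReal (√(p y) + √(q y)) * ENNReal.ofReal |√(p y) - √(q y)| := fun y => by
    rw [← ENNReal.ofReal_mul (by positivity), ← abs_of_nonneg (by positivity : 0 ≤ √(p y) + √(q y)),
      ← abs_mul, ← sq_sub_sq, Real.sq_sqrt (hp.2.1 y), Real.sq_sqrt (hq.2.1 y)]
  calc (∫⁻ y, ENNReal.ofReal |p y - q y| ∂ν) ^ 2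
      ≤ (∫⁻ y, ENNReal.ofReal (√(p y) + √(q y)) ^ 2 ∂ν) *
          ∫⁻ y, ENNReal.ofReal |√(p y) - √(q y)| ^ 2 ∂ν := by
        simp only [hfactor]
        exact sq_lintegral_mul_le (hp.1.sqrt.add hq.1.sqrt).ennreal_ofReal.aemeasurable
          (hp.1.sqrt.sub hq.1.sqrt).abs.ennreal_ofReal.aemeasurable
    _ ≤ 4 * ∫⁻ y, ENNReal.ofReal ((√(p y) - √(q y)) ^ 2) ∂ν := by
        simp only [← ENNReal.ofReal_pow (abs_nonneg _), sq_abs]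
        gcongr
        exact hp.lintegral_sqrt_add_sqrt_sq_le hq

theorem sq_lintegral_abs_sub_le_of_pos (hp : IsProbDensity ν p) (hp0 : ∀ y, 0 < p y)
    (hq : IsProbDensity ν q) :
    (∫⁻ y, ENNReal.ofReal |p y - q y| ∂ν) ^ 2 ≤
      4 * ∫⁻ y, ENNReal.ofReal ((1 - √(q y / p y)) ^ 2) * ENNReal.ofReal (p y) ∂ν := by
  refine (hp.sq_lintegral_abs_sub_le hq).trans_eq ?_
  congr 1
  refine lintegral_congr fun y => ?_
  have hpy : 0 < √(p y) := Real.sqrt_pos.mpr (hp0 y)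
  rw [← ENNReal.ofReal_mul (sq_nonneg _), Real.sqrt_div' _ (hp0 y).le]
  congr 1
  nth_rewrite 3 [← Real.sq_sqrt (hp0 y).le]
  field_simp

end IsProbDensity

end TotalVariation

/-! ### Conditional quantiles of predictive densities -/

section PredictiveQuantile

variable {f : ℝ → ℝ}

theorem IsProbDensity.lsPDF (hf : IsProbDensity volume f) (m : ℝ) {s : ℝ} (hs : 0 < s) :
    IsProbDensity volume (lsPDF f m s) :=
  ⟨(hf.1.comp ((measurable_id.sub_const m).div_const s)).div_const s,
    fun _ => div_nonneg (hf.2.1 _) hs.le,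
    by simpa [hf.2.2] using lintegral_mul_lsPDF (f := f) (fun _ => 1) m hs⟩

theorem setLIntegral_Iic_lsPDF (m : ℝ) {s : ℝ} (hs : 0 < s) (t : ℝ) :
    ∫⁻ y in Set.Iic t, ENNReal.ofReal (lsPDF f m s y) = errorLaw f (Set.Iic ((t - m) / s)) := by
  have hmem : ∀ e, m + s * e ∈ Set.Iic t ↔ e ∈ Set.Iic ((t - m) / s) := fun e => by
    rw [Set.mem_Iic, Set.mem_Iic, le_div_iff₀' hs, le_sub_iff_add_le']
  have hind : ∀ (A : Set ℝ) (k : ℝ → ℝ≥0∞) (y : ℝ), A.indicator k y = A.indicator 1 y * k y :=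
    fun A k y => by simp [← Set.indicator_mul_left]
  have hstd : ∀ e, (Set.Iic t).indicator (1 : ℝ → ℝ≥0∞) (m + s * e) =
      (Set.Iic ((t - m) / s)).indicator 1 e := fun e => by
    simp only [Set.indicator_apply, hmem, Pi.one_apply]
  rw [errorLaw, withDensity_apply _ measurableSet_Iic, ← lintegral_indicator measurableSet_Iic,
    ← lintegral_indicator measurableSet_Iic]
  simp only [hind _ fun _ => ENNReal.ofReal _]
  simp only [lintegral_mul_lsPDF _ m hs, hstd]

variable {τ b : ℝ}

theorem IsRegularError.exists_lsPDF_cdf_growth (hf : IsRegularError f) (hτ0 : 0 < τ) (hτ1 : τ < 1)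
    (hq : quantile (errorLaw f) τ = 0) (J : ℝ) (hb : 0 < b) :
    ∃ c : ℝ, 0 < c ∧ ∀ m s t : ℝ, |m| ≤ J → s ∈ Set.Icc b⁻¹ b → |t| ≤ J →
      (m < t → τ + c * (t - m) ≤ (errorLaw f).real (Set.Iic ((t - m) / s))) ∧
      (t < m → (errorLaw f).real (Set.Iic ((t - m) / s)) ≤ τ + c * (t - m)) := by
  obtain ⟨c, hc, hgrow⟩ := hf.exists_cdf_growth hτ0 hτ1 hq (2 * J * b)
  refine ⟨c / b, by positivity, fun m s t hm hs ht => ?_⟩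
  have hs0 : 0 < s := (inv_pos.mpr hb).trans_le hs.1
  have hbound : |(t - m) / s| ≤ 2 * J * b := by
    rw [abs_div, abs_of_pos hs0, div_eq_mul_inv]
    have hJ : |t - m| ≤ 2 * J := by linarith [abs_sub t m]
    exact mul_le_mul hJ (inv_le_of_inv_le₀ hb hs.1) (by positivity) ((abs_nonneg _).trans hJ)
  refine ⟨fun hmt => ?_, fun htm => ?_⟩
  · calc τ + c / b * (t - m) = τ + c * ((t - m) / b) := by ring
      _ ≤ τ + c * ((t - m) / s) := by
        have := sub_pos.mpr hmt
        gcongr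
        exact hs.2
      _ ≤ (errorLaw f).real (Set.Iic ((t - m) / s)) :=
        (hgrow _ hbound).1 (div_pos (sub_pos.mpr hmt) hs0)
  · calc (errorLaw f).real (Set.Iic ((t - m) / s)) ≤ τ + c * ((t - m) / s) :=
        (hgrow _ hbound).2 (div_neg_of_neg_of_pos (sub_neg.mpr htm) hs0)
      _ = τ - c * ((m - t) / s) := by ring
      _ ≤ τ - c * ((m - t) / b) := by
        have := sub_pos.mpr htm
        gcongr
        exact hs.2
      _ = τ + c / b * (t - m) := by ring

theorem IsRegularError.exists_abs_truncQuantile_sub_le (hf : IsRegularError f) (hτ0 : 0 < τ)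
    (hτ1 : τ < 1) (hq : quantile (errorLaw f) τ = 0) (J : ℝ) (hb : 0 < b) :
    ∃ c : ℝ, 0 < c ∧ ∀ (m s : ℝ) (q : ℝ → ℝ), |m| ≤ J → s ∈ Set.Icc b⁻¹ b →
      IsProbDensity volume q →
      |truncQuantile τ J (fun t => ∫⁻ y in Set.Iic t, ENNReal.ofReal (q y)) - m| ≤
        (∫⁻ y, ENNReal.ofReal |lsPDF f m s y - q y|).toReal / c := by
  have : IsProbabilityMeasure (errorLaw f) := hf.isProbDensity.isProbabilityMeasure
  obtain ⟨c, hc, hgrow⟩ := hf.exists_lsPDF_cdf_growth hτ0 hτ1 hq J hb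
  refine ⟨c, hc, fun m s q hm hs hqd => ?_⟩
  have hs0 : 0 < s := (inv_pos.mpr hb).trans_le hs.1
  have hp : IsProbDensity volume (lsPDF f m s) := hf.isProbDensity.lsPDF m hs0
  have hTV : ∫⁻ y, ENNReal.ofReal |lsPDF f m s y - q y| ≠ ⊤ :=
    ne_top_of_le_ne_top ENNReal.ofNat_ne_top (hp.lintegral_abs_sub_le_two hqd)
  have habs : ∀ t ∈ Set.Ioc (-J) J, |t| ≤ J := fun t ht => abs_le.mpr ⟨ht.1.le, ht.2⟩
  refine abs_truncQuantile_sub_le (F := fun t => (errorLaw f).real (Set.Iic ((t - m) / s))) hτ0 hc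
    ENNReal.toReal_nonneg hm (fun t => measureReal_nonneg)
    (fun t ht => (hgrow m s t hm hs (habs t ht)).1)
    (fun t ht => (hgrow m s t hm hs (habs t ht)).2) (fun t => ?_) fun t => ?_ <;>
    rw [ENNReal.ofReal_toReal hTV, ofReal_measureReal, ← setLIntegral_Iic_lsPDF m hs0]
  · simp only [abs_sub_comm (lsPDF f m s _)]
    exact setLIntegral_ofReal_le_add hp.1 _
  · exact setLIntegral_ofReal_le_add hqd.1 _

theorem IsRegularError.exists_sq_truncQuantile_sub_le (hf : IsRegularError f) (hτ0 : 0 < τ)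
    (hτ1 : τ < 1) (hq : quantile (errorLaw f) τ = 0) (J : ℝ) (hb : 0 < b) :
    ∃ C : ℝ, 0 < C ∧ ∀ (m s : ℝ) (q : ℝ → ℝ), |m| ≤ J → s ∈ Set.Icc b⁻¹ b →
      IsProbDensity volume q →
      ENNReal.ofReal
          ((m - truncQuantile τ J fun t => ∫⁻ y in Set.Iic t, ENNReal.ofReal (q y)) ^ 2) ≤
        ENNReal.ofReal C * ∫⁻ y, ENNReal.ofReal ((1 - √(q y / lsPDF f m s y)) ^ 2) *
          ENNReal.ofReal (lsPDF f m s y) := by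
  obtain ⟨c, hc, hquant⟩ := hf.exists_abs_truncQuantile_sub_le hτ0 hτ1 hq J hb
  refine ⟨4 / c ^ 2, by positivity, fun m s q hm hs hqd => ?_⟩
  have hs0 : 0 < s := (inv_pos.mpr hb).trans_le hs.1
  have hp : IsProbDensity volume (lsPDF f m s) := hf.isProbDensity.lsPDF m hs0
  have hTV : ∫⁻ y, ENNReal.ofReal |lsPDF f m s y - q y| ≠ ⊤ :=
    ne_top_of_le_ne_top ENNReal.ofNat_ne_top (hp.lintegral_abs_sub_le_two hqd)
  calc ENNReal.ofReal
        ((m - truncQuantile τ J fun t => ∫⁻ y in Set.Iic t, ENNReal.ofReal (q y)) ^ 2)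
      ≤ ENNReal.ofReal (((∫⁻ y, ENNReal.ofReal |lsPDF f m s y - q y|).toReal / c) ^ 2) := by
        rw [← sq_abs, abs_sub_comm]
        gcongr
        exact hquant m s q hm hs hqd
    _ = ENNReal.ofReal (1 / c ^ 2) * (∫⁻ y, ENNReal.ofReal |lsPDF f m s y - q y|) ^ 2 := by
        rw [div_pow, div_eq_mul_one_div, mul_comm, ENNReal.ofReal_mul (by positivity),
          ENNReal.ofReal_pow ENNReal.toReal_nonneg, ENNReal.ofReal_toReal hTV]
    _ ≤ ENNReal.ofReal (1 / c ^ 2) * (4 * ∫⁻ y, ENNReal.ofReal ((1 - √(q y / lsPDF f m s y)) ^ 2) *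
          ENNReal.ofReal (lsPDF f m s y)) := by
        gcongr
        exact hp.sq_lintegral_abs_sub_le_of_pos (fun y => div_pos (hf.pos _) hs0) hqd
    _ = _ := by
        rw [← mul_assoc, ← ENNReal.ofReal_ofNat 4, ← ENNReal.ofReal_mul (by positivity),
          one_div_mul_eq_div]

end PredictiveQuantile

section Estimator

variable {X : Type*} {J : Type*} [Fintype J]

/-- The predictive quantile estimator of `μ x`: the truncated `τ`-th quantile of the conditional
density of the next response at `x`, when the conditional densities `g` are given a uniform prior
and the sample `d` has been observed. -/
noncomputable def predEst (τ B : ℝ) (g : J → X × ℝ → ℝ) {i : ℕ} (d : Fin i → X × ℝ) (x : X) : ℝ :=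
  truncQuantile τ B fun t => ∫⁻ y in Set.Iic t, ENNReal.ofReal (mixPred g d (x, y))

/-- The estimator attaining the minimax rate: the average of the predictive quantile estimators
based on the initial segments of the sample. -/
noncomputable def avgEst (τ B : ℝ) (g : J → X × ℝ → ℝ) {n : ℕ} (d : Fin n → X × ℝ) (x : X) : ℝ :=
  (∑ i : Fin n, predEst τ B g (fun k : Fin i => d (Fin.castLE i.isLt.le k)) x) / n

variable [MeasurableSpace X] {ν : Measure X} {f : ℝ → ℝ}

theorem measurable_predEst (τ B : ℝ) {g : J → X × ℝ → ℝ} (hg : ∀ j, Measurable (g j)) (i : ℕ) :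
    Measurable fun p : (Fin i → X × ℝ) × X => predEst τ B g p.1 p.2 := by
  refine measurable_truncQuantile τ B (F := fun (p : (Fin i → X × ℝ) × X) t =>
    ∫⁻ y in Set.Iic t, ENNReal.ofReal (mixPred g p.1 (p.2, y))) ?_
  have hmix : Measurable fun q : (((Fin i → X × ℝ) × X) × ℝ) × ℝ =>
      ENNReal.ofReal (mixPred g q.1.1.1 (q.1.1.2, q.2)) :=
    ((measurable_mixPred hg i).comp (f := fun q : (((Fin i → X × ℝ) × X) × ℝ) × ℝ =>
      (q.1.1.1, q.1.1.2, q.2)) (by fun_prop)).ennreal_ofReal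
  have hle : MeasurableSet {q : (((Fin i → X × ℝ) × X) × ℝ) × ℝ | q.2 ≤ q.1.2} :=
    measurableSet_le measurable_snd (measurable_snd.comp measurable_fst)
  simp only [Function.uncurry_def, ← lintegral_indicator measurableSet_Iic]
  exact (hmix.indicator hle).lintegral_prod_right'

theorem measurable_predEst_comp_castLE (τ B : ℝ) {g : J → X × ℝ → ℝ} (hg : ∀ j, Measurable (g j))
    {i n : ℕ} (hi : i ≤ n) :
    Measurable fun p : (Fin n → X × ℝ) × X =>
      predEst τ B g (fun k : Fin i => p.1 (Fin.castLE hi k)) p.2 :=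
  (measurable_predEst τ B hg i).comp (f := fun p : (Fin n → X × ℝ) × X =>
    (fun k : Fin i => p.1 (Fin.castLE hi k), p.2)) (by fun_prop)

theorem measurable_avgEst (τ B : ℝ) {g : J → X × ℝ → ℝ} (hg : ∀ j, Measurable (g j)) (n : ℕ) :
    Measurable (Function.uncurry (avgEst τ B g : (Fin n → X × ℝ) → X → ℝ)) :=
  (Finset.measurable_fun_sum _ fun i _ =>
    measurable_predEst_comp_castLE τ B hg i.isLt.le).div_const _

theorem isProbDensity_mixPred_condPDF [Nonempty J] (hf : IsRegularError f) {m s : J → X → ℝ}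
    (hm : ∀ j, Measurable (m j)) (hs : ∀ j, Measurable (s j)) (hs0 : ∀ j x, 0 < s j x) {i : ℕ}
    (d : Fin i → X × ℝ) (x : X) :
    IsProbDensity volume fun y => mixPred (fun j => condPDF f (m j) (s j)) d (x, y) := by
  have hmeas : ∀ j, Measurable (condPDF f (m j) (s j)) := fun j =>
    measurable_condPDF hf.measurable (hm j) (hs j)
  have hpos : ∀ j z, 0 < condPDF f (m j) (s j) z := fun j => condPDF_pos hf.pos (hs0 j)
  exact ⟨(measurable_mixPred hmeas i).comp (f := fun y => (d, x, y)) (by fun_prop),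
    fun y => (mixPred_pos hpos d _).le,
    lintegral_mixPred_comp hpos (fun j => (hmeas j).comp measurable_prodMk_left)
      (fun j => (hf.isProbDensity.lsPDF (m j x) (hs0 j x)).2.2) d⟩

theorem l2DistSq_average_le {h u : X → ℝ} (hh : IsProbDensity ν h) (hu : Measurable u) {n : ℕ}
    (hn : 0 < n) {v : Fin n → X → ℝ} (hv : ∀ i, Measurable (v i)) :
    l2DistSq ν h u (fun x => (∑ i, v i x) / n) ≤
      ENNReal.ofReal (1 / n) * ∑ i, l2DistSq ν h u (v i) := by
  have : (0 : ℝ) < n := by exact_mod_cast hn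
  simp only [l2DistSq]
  rw [← lintegral_finsetSum (f := fun i x => ENNReal.ofReal ((u x - v i x) ^ 2 * h x)) _
    fun i _ => (((hu.sub (hv i)).pow_const 2).mul hh.1).ennreal_ofReal,
    ← lintegral_const_mul' _ _ ENNReal.ofReal_ne_top]
  refine lintegral_mono fun x => ?_
  have hx := hh.2.1 x
  have haverage : u x - (∑ i, v i x) / n = (∑ i, (u x - v i x)) / n := by
    rw [Finset.sum_sub_distrib, Finset.sum_const, Finset.card_fin, nsmul_eq_mul]
    field_simp
  rw [← ENNReal.ofReal_sum_of_nonneg fun i _ => mul_nonneg (sq_nonneg _) hx,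
    ← ENNReal.ofReal_mul (by positivity), ← Finset.sum_mul, ← mul_assoc, haverage]
  gcongr
  calc ((∑ i, (u x - v i x)) / n) ^ 2 = (∑ i, (u x - v i x)) ^ 2 / n ^ 2 := div_pow _ _ _
    _ ≤ (n * ∑ i, (u x - v i x) ^ 2) / n ^ 2 := by
      gcongr
      simpa using sq_sum_le_card_mul_sum_sq (s := Finset.univ) (f := fun i : Fin n => u x - v i x)
    _ = 1 / n * ∑ i, (u x - v i x) ^ 2 := by field_simp

end Estimator

/-! ### The upper bound -/

section UpperBound

universe v w

variable {X : Type v} [MeasurableSpace X] {ν : Measure X} {f : ℝ → ℝ} {τ b : ℝ}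

theorem IsRegularError.exists_l2DistSq_predEst_le (hf : IsRegularError f) (hτ0 : 0 < τ)
    (hτ1 : τ < 1) (hq : quantile (errorLaw f) τ = 0) (B : ℝ) (hb : 0 < b) :
    ∃ C : ℝ, 0 < C ∧ ∀ {J : Type w} [Fintype J] [Nonempty J] {m s : J → X → ℝ} {μ σ h : X → ℝ},
      (∀ j, IsLocScaleParam B b (m j) (s j)) → IsLocScaleParam B b μ σ → IsProbDensity ν h →
      ∀ {i : ℕ} (d : Fin i → X × ℝ),
      l2DistSq ν h μ (predEst τ B (fun j => condPDF f (m j) (s j)) d) ≤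
        ENNReal.ofReal C * ∫⁻ z, ENNReal.ofReal ((1 - √(mixPred (fun j z =>
          condPDF f (m j) (s j) z / condPDF f μ σ z) d z)) ^ 2) ∂(obsLaw ν f μ σ h) := by
  obtain ⟨C, hC, hquant⟩ := hf.exists_sq_truncQuantile_sub_le hτ0 hτ1 hq B hb
  refine ⟨C, hC, fun {J} _ _ {m s μ σ h} hθ hθ₀ hh {i} d => ?_⟩
  have hcond : ∀ j, Measurable (condPDF f (m j) (s j)) := fun j =>
    measurable_condPDF hf.measurable (hθ j).measurable_loc (hθ j).measurable_scale
  have hcond₀ : Measurable (condPDF f μ σ) :=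
    measurable_condPDF hf.measurable hθ₀.measurable_loc hθ₀.measurable_scale
  have hmix : Measurable fun z => ENNReal.ofReal ((1 - √(mixPred (fun j z =>
      condPDF f (m j) (s j) z / condPDF f μ σ z) d z)) ^ 2) :=
    (((measurable_mixPred (fun j => (hcond j).div hcond₀) i).comp
      (measurable_prodMk_left (x := d))).sqrt.const_sub 1 |>.pow_const 2).ennreal_ofReal
  rw [lintegral_obsLaw hf.measurable hθ₀.measurable_loc hθ₀.measurable_scale
    (hθ₀.scale_pos hb) hh hmix, ← lintegral_const_mul' _ _ ENNReal.ofReal_ne_top, l2DistSq]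
  refine lintegral_mono fun x => ?_
  rw [ENNReal.ofReal_mul (sq_nonneg _), mul_left_comm, mul_comm]
  gcongr
  simp only [mixPred_div (condPDF_pos hf.pos (hθ₀.scale_pos hb))]
  exact hquant (μ x) (σ x) _ (hθ₀.abs_loc_le x) (hθ₀.scale_mem x)
    (isProbDensity_mixPred_condPDF hf (fun j => (hθ j).measurable_loc)
      (fun j => (hθ j).measurable_scale) (fun j => (hθ j).scale_pos hb) d x)

theorem lintegral_pi_comp_castLE {Z : Type*} [MeasurableSpace Z] (P : Measure Z)
    [IsProbabilityMeasure P] {i n : ℕ} (hi : i ≤ n) {k : (Fin i → Z) → ENNReal}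
    (hk : Measurable k) :
    ∫⁻ d, k (fun j => d (Fin.castLE hi j)) ∂(Measure.pi fun _ : Fin n => P) =
      ∫⁻ d, k d ∂(Measure.pi fun _ : Fin i => P) :=
  (measurePreserving_pi_comp_of_injective (fun _ : Fin n => P)
    (Fin.castLE_injective hi)).lintegral_comp hk

theorem risk_avgEst_le_sum {J : Type*} [Fintype J] {B : ℝ} {μ σ h : X → ℝ}
    [IsProbabilityMeasure (obsLaw ν f μ σ h)] (hh : IsProbDensity ν h) (hμ : Measurable μ)
    {g : J → X × ℝ → ℝ} (hg : ∀ j, Measurable (g j)) {n : ℕ} (hn : 0 < n) :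
    risk ν f n (avgEst τ B g) μ σ h ≤ ENNReal.ofReal (1 / n) * ∑ i ∈ Finset.range n,
      ∫⁻ d, l2DistSq ν h μ (predEst τ B g d) ∂(Measure.pi fun _ : Fin i => obsLaw ν f μ σ h) := by
  have hloss : ∀ i : ℕ, Measurable fun d : Fin i → X × ℝ => l2DistSq ν h μ (predEst τ B g d) :=
    fun i => measurable_l2DistSq hh hμ (measurable_predEst τ B hg i)
  calc risk ν f n (avgEst τ B g) μ σ h
      ≤ ∫⁻ d, ENNReal.ofReal (1 / n) * ∑ i : Fin n, l2DistSq ν h μ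
          (predEst τ B g fun k : Fin i => d (Fin.castLE i.isLt.le k))
          ∂(Measure.pi fun _ : Fin n => obsLaw ν f μ σ h) :=
        lintegral_mono fun d => l2DistSq_average_le
          (v := fun i => predEst τ B g fun k : Fin i => d (Fin.castLE i.isLt.le k)) hh hμ hn
          fun i => (measurable_predEst τ B hg i).of_uncurry_left
    _ = ENNReal.ofReal (1 / n) * ∑ i : Fin n, ∫⁻ d, l2DistSq ν h μ (predEst τ B g d)
          ∂(Measure.pi fun _ : Fin i => obsLaw ν f μ σ h) := by
        rw [lintegral_const_mul' _ _ ENNReal.ofReal_ne_top, lintegral_finsetSum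
          (f := fun (i : Fin n) (d : Fin n → X × ℝ) => l2DistSq ν h μ (predEst τ B g
            fun k : Fin i => d (Fin.castLE i.isLt.le k))) _ fun i _ =>
          (hloss i).comp (measurable_pi_lambda _ fun k => measurable_pi_apply _)]
        exact congrArg _ (Finset.sum_congr rfl fun i _ =>
          lintegral_pi_comp_castLE _ i.isLt.le (hloss i))
    _ = _ := congrArg _ (Fin.sum_univ_eq_sum_range (fun i => ∫⁻ d, l2DistSq ν h μ
          (predEst τ B g d) ∂(Measure.pi fun _ : Fin i => obsLaw ν f μ σ h)) n)

theorem IsRegularError.exists_risk_avgEst_le (hf : IsRegularError f) (hτ0 : 0 < τ)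
    (hτ1 : τ < 1) (hq : quantile (errorLaw f) τ = 0) (B : ℝ) (hb : 0 < b) :
    ∃ C : ℝ, 0 < C ∧ ∀ {J : Type w} [Fintype J] {m s : J → X → ℝ} {μ σ h : X → ℝ},
      (∀ j, IsLocScaleParam B b (m j) (s j)) → IsLocScaleParam B b μ σ → IsProbDensity ν h →
      ∀ (j : J) {n : ℕ}, 0 < n →
      risk ν f n (avgEst τ B fun j => condPDF f (m j) (s j)) μ σ h ≤
        ENNReal.ofReal (C * (Real.log (Fintype.card J) / n -
          ∫ z, Real.log (condPDF f (m j) (s j) z / condPDF f μ σ z) ∂(obsLaw ν f μ σ h))) := by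
  obtain ⟨C, hC, hpred⟩ := hf.exists_l2DistSq_predEst_le (X := X) (ν := ν) hτ0 hτ1 hq B hb
  refine ⟨C, hC, fun {J} _ {m s μ σ h} hθ hθ₀ hh j {n} hn => ?_⟩
  have : Nonempty J := ⟨j⟩
  have : (0 : ℝ) < n := by exact_mod_cast hn
  have := hθ₀.isProbabilityMeasure_obsLaw hf.isProbDensity hh
  have hratio := fun j => hθ₀.isLikelihoodRatio_condPDF (hθ j) hb hf hh
  refine (risk_avgEst_le_sum hh hθ₀.measurable_loc (fun j => measurable_condPDF hf.measurable
    (hθ j).measurable_loc (hθ j).measurable_scale) hn).trans ?_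
  calc _ ≤ ENNReal.ofReal (1 / n) * ∑ i ∈ Finset.range n, ENNReal.ofReal C *
          ∫⁻ d, ∫⁻ z, ENNReal.ofReal ((1 - √(mixPred (fun j z =>
            condPDF f (m j) (s j) z / condPDF f μ σ z) d z)) ^ 2) ∂(obsLaw ν f μ σ h)
          ∂(Measure.pi fun _ : Fin i => obsLaw ν f μ σ h) := by
        gcongr with i
        rw [← lintegral_const_mul' _ _ ENNReal.ofReal_ne_top]
        exact lintegral_mono (hpred hθ hθ₀ hh)
    _ ≤ ENNReal.ofReal (1 / n) * (ENNReal.ofReal C * ENNReal.ofReal (Real.log (Fintype.card J) -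
          n * ∫ z, Real.log (condPDF f (m j) (s j) z / condPDF f μ σ z) ∂(obsLaw ν f μ σ h))) := by
        rw [← Finset.mul_sum]
        gcongr
        exact sum_hellinger_mixPred_le hratio j n
    _ = _ := by
        rw [← ENNReal.ofReal_mul hC.le, ← ENNReal.ofReal_mul (by positivity)]
        congr 1
        field_simp

theorem l2DistSq_le_mul {h h₀ : X → ℝ} {C : ℝ} (hh₀ : ∀ x, 0 ≤ h₀ x)
    (hdom : ∀ x, h x ≤ C * h₀ x) (u v : X → ℝ) :
    l2DistSq ν h u v ≤ ENNReal.ofReal C * l2DistSq ν h₀ u v := by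
  rw [l2DistSq, l2DistSq, ← lintegral_const_mul' _ _ ENNReal.ofReal_ne_top]
  refine lintegral_mono fun x => ?_
  rw [← ENNReal.ofReal_mul' (mul_nonneg (sq_nonneg _) (hh₀ x)), mul_left_comm]
  gcongr
  exact hdom x

theorem IsLogLipschitzEnvelope.neg_integral_log_le {G : ℝ → ℝ} {L : NNReal}
    {J C₀ ε : ℝ} {μ σ μ' σ' h h₀ : X → ℝ} (hG : IsLogLipschitzEnvelope f J b G L)
    (hf : IsRegularError f) (hb : 0 < b) (hθ : IsLocScaleParam J b μ σ)
    (hθ' : IsLocScaleParam J b μ' σ') (hh : IsProbDensity ν h) (hh₀ : ∀ x, 0 ≤ h₀ x)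
    (hdom : ∀ x, h x ≤ C₀ * h₀ x) (hμ : l2DistSq ν h₀ μ μ' ≤ ENNReal.ofReal (ε ^ 2))
    (hσ : l2DistSq ν h₀ σ σ' ≤ ENNReal.ofReal (ε ^ 2)) :
    -∫ z, Real.log (condPDF f μ' σ' z / condPDF f μ σ z) ∂(obsLaw ν f μ σ h) ≤
      (8 * L * C₀.toNNReal : NNReal) * ε ^ 2 := by
  refine (ENNReal.ofReal_le_ofReal_iff (by positivity)).mp ?_
  calc _ ≤ 4 * L * (l2DistSq ν h μ μ' + l2DistSq ν h σ σ') :=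
        hG.ofReal_neg_integral_log_le hf hb hθ hθ' hh
    _ ≤ 4 * L * (ENNReal.ofReal C₀ * ENNReal.ofReal (ε ^ 2) +
          ENNReal.ofReal C₀ * ENNReal.ofReal (ε ^ 2)) := by
        gcongr
        · exact (l2DistSq_le_mul hh₀ hdom μ μ').trans (by gcongr)
        · exact (l2DistSq_le_mul hh₀ hdom σ σ').trans (by gcongr)
    _ = ENNReal.ofReal ((8 * L * C₀.toNNReal : NNReal) * ε ^ 2) := by
        rw [ENNReal.ofReal_mul (NNReal.coe_nonneg _), ENNReal.ofReal_coe_nnreal,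
          ENNReal.ofReal.eq_1 C₀]
        push_cast
        ring

variable {U S H : Set (X → ℝ)} {h₀ : X → ℝ} {B C₀ : ℝ}

theorem IsRegularError.exists_minimaxRisk_le_of_isMaxL2Packing (hf : IsRegularError f)
    (hτ0 : 0 < τ) (hτ1 : τ < 1) (hq : quantile (errorLaw f) τ = 0) (hb : 0 < b)
    (hθ : ∀ μ ∈ U, ∀ σ ∈ S, IsLocScaleParam B b μ σ) (hH : ∀ h ∈ H, IsProbDensity ν h)
    (hh₀ : ∀ x, 0 ≤ h₀ x) (hdom : ∀ h ∈ H, ∀ x, h x ≤ C₀ * h₀ x) :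
    ∃ C K : ℝ, 0 < C ∧ 0 ≤ K ∧ ∀ {n : ℕ} {ε : ℝ} {N N' : Finset (X → ℝ)}, 0 < n → 0 ≤ ε →
      IsMaxL2Packing ν h₀ U ε N → IsMaxL2Packing ν h₀ S ε N' →
      minimaxRisk ν f U S H n ≤ ENNReal.ofReal
        (C * ((packingEntropy ν h₀ U ε + packingEntropy ν h₀ S ε) / n + K * ε ^ 2)) := by
  obtain ⟨G, L, hG⟩ := hf.exists_envelope B b hb
  obtain ⟨C, hC, hrisk⟩ := hf.exists_risk_avgEst_le (X := X) (ν := ν) hτ0 hτ1 hq B hb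
  refine ⟨C, (8 * L * C₀.toNNReal : NNReal), hC, NNReal.coe_nonneg _,
    fun {n ε N N'} hn hε hN hN' => ?_⟩
  let m : ↥(N ×ˢ N') → X → ℝ := fun j => j.1.1
  let s : ↥(N ×ˢ N') → X → ℝ := fun j => j.1.2
  have hms : ∀ j, IsLocScaleParam B b (m j) (s j) := fun j =>
    hθ _ (hN.subset (Finset.mem_product.mp j.2).1) _ (hN'.subset (Finset.mem_product.mp j.2).2)
  refine iInf₂_le_of_le (avgEst τ B fun j => condPDF f (m j) (s j)) (measurable_avgEst τ B
    (fun j => measurable_condPDF hf.measurable (hms j).measurable_loc (hms j).measurable_scale) n)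
    (iSup₂_le fun μ hμ => iSup₂_le fun σ hσ => iSup₂_le fun h hh => ?_)
  obtain ⟨u, huN, hu⟩ := hN.exists_l2DistSq_le hε hμ
  obtain ⟨t, htN, ht⟩ := hN'.exists_l2DistSq_le hε hσ
  let j : ↥(N ×ˢ N') := ⟨(u, t), Finset.mk_mem_product huN htN⟩
  have hentropy : Real.log (Fintype.card ↥(N ×ˢ N')) =
      packingEntropy ν h₀ U ε + packingEntropy ν h₀ S ε := by
    have hne : (N.card : ℝ) ≠ 0 := by exact_mod_cast (Finset.card_pos.mpr ⟨u, huN⟩).ne'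
    have hne' : (N'.card : ℝ) ≠ 0 := by exact_mod_cast (Finset.card_pos.mpr ⟨t, htN⟩).ne'
    rw [Fintype.card_coe, Finset.card_product, Nat.cast_mul, Real.log_mul hne hne',
      hN.packingEntropy_eq, hN'.packingEntropy_eq]
  have hKL := hG.neg_integral_log_le hf hb (hθ μ hμ σ hσ) (hms j) (hH h hh) hh₀ (hdom h hh) hu ht
  refine (hrisk hms (hθ μ hμ σ hσ) (hH h hh) j hn).trans ?_
  rw [hentropy]
  gcongr
  linarith

theorem exists_minimaxRisk_le (hf : IsRegularError f) (hτ0 : 0 < τ) (hτ1 : τ < 1)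
    (hq : quantile (errorLaw f) τ = 0) (hb : 0 < b)
    (hθ : ∀ μ ∈ U, ∀ σ ∈ S, IsLocScaleParam B b μ σ) (hH : ∀ h ∈ H, IsProbDensity ν h)
    (hh₀ : ∀ x, 0 ≤ h₀ x) (hdom : ∀ h ∈ H, ∀ x, h x ≤ C₀ * h₀ x)
    (hTU : TotallyBoundedL2 ν h₀ U) (hTS : TotallyBoundedL2 ν h₀ S)
    (hSU : packingEntropy ν h₀ S =O[𝓝[>] (0 : ℝ)] packingEntropy ν h₀ U) {ε : ℕ → ℝ}
    (hε : SolvesEntropyEquation ν h₀ U ε) (hε0 : Tendsto ε atTop (𝓝[>] 0)) :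
    ∃ C : ℝ, 0 < C ∧ ∀ᶠ n in atTop, minimaxRisk ν f U S H n ≤ ENNReal.ofReal (C * ε n ^ 2) := by
  obtain ⟨C, K, hC, hK, hrisk⟩ :=
    hf.exists_minimaxRisk_le_of_isMaxL2Packing hτ0 hτ1 hq hb hθ hH hh₀ hdom
  obtain ⟨A, hA, hUbound⟩ := hε.2.1.exists_pos
  obtain ⟨A', hA', hSbound⟩ := hSU.exists_pos
  refine ⟨C * ((1 + A') * A + K), by positivity, ?_⟩
  filter_upwards [hε.1, hUbound.bound, hε0.eventually hSbound.bound, eventually_gt_atTop 0]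
    with n hpos hU hS hn
  have : (0 : ℝ) < n := by exact_mod_cast hn
  obtain ⟨N, hN⟩ := exists_isMaxL2Packing hTU hpos
  obtain ⟨N', hN'⟩ := exists_isMaxL2Packing hTS hpos
  simp only [Real.norm_of_nonneg (packingEntropy_nonneg _)] at hU hS
  rw [Real.norm_of_nonneg (by positivity)] at hU
  refine (hrisk hn hpos.le hN hN').trans ?_
  rw [mul_assoc, add_mul]
  gcongr
  calc (packingEntropy ν h₀ U (ε n) + packingEntropy ν h₀ S (ε n)) / n
      ≤ ((1 + A') * (A * (n * ε n ^ 2))) / n := by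
        gcongr
        rw [one_add_mul]
        exact add_le_add hU (hS.trans (by gcongr))
    _ = (1 + A') * A * ε n ^ 2 := by field_simp

end UpperBound

/-! ### Error densities with a locally Lipschitz logarithm -/

section Regularity

variable {f : ℝ → ℝ}

theorem abs_log_sub_log_le {b s s' : ℝ} (hb : 0 < b) (hs : b⁻¹ ≤ s) (hs' : b⁻¹ ≤ s') :
    |Real.log s - Real.log s'| ≤ b * |s - s'| := by
  have log_sub_log_le : ∀ {u v : ℝ}, b⁻¹ ≤ u → b⁻¹ ≤ v →
      Real.log u - Real.log v ≤ b * |u - v| := by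
    intro u v hu hv
    have hu0 : 0 < u := (inv_pos.mpr hb).trans_le hu
    have hv0 : 0 < v := (inv_pos.mpr hb).trans_le hv
    calc Real.log u - Real.log v = Real.log (u / v) := (Real.log_div hu0.ne' hv0.ne').symm
      _ ≤ u / v - 1 := Real.log_le_sub_one_of_pos (div_pos hu0 hv0)
      _ = v⁻¹ * (u - v) := by field_simp
      _ ≤ v⁻¹ * |u - v| := by
        gcongr
        exact le_abs_self _
      _ ≤ b * |u - v| := by
        gcongr
        exact inv_le_of_inv_le₀ hb hv
  rw [abs_sub_le_iff]
  exact ⟨log_sub_log_le hs hs', abs_sub_comm s s' ▸ log_sub_log_le hs' hs⟩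

theorem abs_standardize_sub_le {b m m' s s' y : ℝ} (hb : 0 < b) (hs : b⁻¹ ≤ s)
    (hs' : b⁻¹ ≤ s') :
    |(y - m) / s - (y - m') / s'| ≤ b * (|m - m'| + |(y - m') / s'| * |s - s'|) := by
  have hs0 : 0 < s := (inv_pos.mpr hb).trans_le hs
  have hs0' : 0 < s' := (inv_pos.mpr hb).trans_le hs'
  have hdiff : (y - m) / s - (y - m') / s' = s⁻¹ * ((m' - m) + (y - m') / s' * (s' - s)) := by
    field_simp
    ring
  rw [hdiff, abs_mul, abs_of_pos (inv_pos.mpr hs0), abs_sub_comm m m', abs_sub_comm s s',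
    ← abs_mul]
  gcongr
  · exact inv_le_of_inv_le₀ hb hs
  · exact abs_add_le _ _

theorem abs_standardize_le {b J m s y : ℝ} (hb : 0 < b) (hs : b⁻¹ ≤ s) (hm : |m| ≤ J) :
    |(y - m) / s| ≤ b * (J + |y|) := by
  have hs0 : 0 < s := (inv_pos.mpr hb).trans_le hs
  rw [abs_div, abs_of_pos hs0, div_eq_inv_mul]
  gcongr
  · exact inv_le_of_inv_le₀ hb hs
  · linarith [abs_sub y m]

theorem exists_le_of_abs_log_sub_log_le (hpos : ∀ y, 0 < f y) {K : ℝ} (hK : 0 ≤ K)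
    (hlip : ∀ u v, |Real.log (f u) - Real.log (f v)| ≤ K * (1 + |u| + |v|) * |u - v|) (R : ℝ) :
    ∃ c, 0 < c ∧ ∀ y, |y| ≤ R → c ≤ f y := by
  refine ⟨Real.exp (Real.log (f 0) - K * (1 + R) * R), Real.exp_pos _, fun y hy => ?_⟩
  rw [← Real.le_log_iff_exp_le (hpos y)]
  have h0y := (le_abs_self _).trans (hlip 0 y)
  rw [abs_zero, add_zero, zero_sub, abs_neg] at h0y
  have : K * (1 + |y|) * |y| ≤ K * (1 + R) * R := by
    have : 0 ≤ R := (abs_nonneg y).trans hy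
    gcongr
  linarith

theorem abs_log_lsPDF_sub_le (hpos : ∀ y, 0 < f y) {K : ℝ} (hK : 0 ≤ K)
    (hlip : ∀ u v, |Real.log (f u) - Real.log (f v)| ≤ K * (1 + |u| + |v|) * |u - v|)
    {J b m m' s s' : ℝ} (hb : 1 ≤ b) (hm : |m| ≤ J) (hm' : |m'| ≤ J) (hs : b⁻¹ ≤ s)
    (hs' : b⁻¹ ≤ s') (y : ℝ) :
    |Real.log (lsPDF f m s y) - Real.log (lsPDF f m' s' y)| ≤
      (|m - m'| + |s - s'|) * ((2 * K * b ^ 3 + b) * (1 + J + |y|) ^ 2) := by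
  have hb0 : 0 < b := by linarith
  have hJ : 0 ≤ J := (abs_nonneg m).trans hm
  have log_lsPDF : ∀ (m : ℝ) {s : ℝ}, b⁻¹ ≤ s →
      Real.log (lsPDF f m s y) = Real.log (f ((y - m) / s)) - Real.log s := fun _ _ h =>
    Real.log_div (hpos _).ne' ((inv_pos.mpr hb0).trans_le h).ne'
  rw [log_lsPDF m hs, log_lsPDF m' hs', sub_sub_sub_comm]
  have hu := abs_standardize_le (y := y) hb0 hs hm
  have hv := abs_standardize_le (y := y) hb0 hs' hm'
  have huv := abs_standardize_sub_le (m := m) (m' := m') (y := y) hb0 hs hs'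
  have hlog := abs_log_sub_log_le hb0 hs hs'
  have hf := hlip ((y - m) / s) ((y - m') / s')
  generalize (y - m) / s = u at *
  generalize (y - m') / s' = v at *
  have hY : 1 ≤ 1 + J + |y| := by linarith [abs_nonneg y]
  have hweight : 1 + |u| + |v| ≤ 2 * b * (1 + J + |y|) := by linarith
  have hdist : |u - v| ≤ b * (b * (1 + J + |y|) * (|m - m'| + |s - s'|)) := by
    refine huv.trans (mul_le_mul_of_nonneg_left ?_ hb0.le)
    rw [mul_add (b * (1 + J + |y|))]
    gcongr
    · exact le_mul_of_one_le_left (abs_nonneg _) (one_le_mul_of_one_le_of_one_le hb hY)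
    · linarith
  calc _ ≤ |Real.log (f u) - Real.log (f v)| + |Real.log s - Real.log s'| := abs_sub _ _
    _ ≤ K * (2 * b * (1 + J + |y|)) * (b * (b * (1 + J + |y|) * (|m - m'| + |s - s'|))) +
          b * (|m - m'| + |s - s'|) * (1 + J + |y|) ^ 2 := by
        gcongr
        · exact hf.trans (by gcongr)
        · refine hlog.trans ((mul_le_mul_of_nonneg_left ?_ hb0.le).trans
            (le_mul_of_one_le_right (by positivity) (one_le_pow₀ hY)))
          linarith [abs_nonneg (m - m')]
    _ = _ := by ring

theorem lintegral_sq_mul_lsPDF_le (hf : Measurable f) (hone : ∫⁻ y, ENNReal.ofReal (f y) = 1)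
    {J b m s : ℝ} (hm : |m| ≤ J) (hs : 0 < s) (hsb : s ≤ b) (A : ℝ) :
    ∫⁻ y, ENNReal.ofReal ((A * (1 + J + |y|) ^ 2) ^ 2) * ENNReal.ofReal (lsPDF f m s y) ≤
      ENNReal.ofReal (A ^ 2 * 8) * (ENNReal.ofReal ((1 + 2 * J) ^ 4) + ENNReal.ofReal (b ^ 4) *
        ∫⁻ y, ENNReal.ofReal (y ^ 4) * ENNReal.ofReal (f y)) := by
  have hJ : 0 ≤ J := (abs_nonneg m).trans hm
  have hb : 0 < b := hs.trans_le hsb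
  have henvelope : ∀ e, (A * (1 + J + |m + s * e|) ^ 2) ^ 2 ≤
      A ^ 2 * 8 * ((1 + 2 * J) ^ 4 + b ^ 4 * e ^ 4) := fun e => by
    have hme : |m + s * e| ≤ J + b * |e| := by
      refine (abs_add_le _ _).trans ?_
      rw [abs_mul, abs_of_pos hs]
      gcongr
    have hpow := add_pow_le (show 0 ≤ 1 + 2 * J by positivity)
      (show 0 ≤ b * |e| by positivity) 4
    rw [mul_pow b, Even.pow_abs (by decide)] at hpow
    calc (A * (1 + J + |m + s * e|) ^ 2) ^ 2 = A ^ 2 * (1 + J + |m + s * e|) ^ 4 := by ring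
      _ ≤ A ^ 2 * ((1 + 2 * J) + b * |e|) ^ 4 := by
        gcongr A ^ 2 * ?_ ^ 4
        linarith
      _ ≤ A ^ 2 * 8 * ((1 + 2 * J) ^ 4 + b ^ 4 * e ^ 4) := by
        rw [mul_assoc]
        gcongr
        norm_num at hpow
        exact hpow
  rw [lintegral_mul_lsPDF _ _ hs]
  calc _ ≤ ∫⁻ e, ENNReal.ofReal (A ^ 2 * 8) * (ENNReal.ofReal ((1 + 2 * J) ^ 4) *
          ENNReal.ofReal (f e) + ENNReal.ofReal (b ^ 4) *
            (ENNReal.ofReal (e ^ 4) * ENNReal.ofReal (f e))) := by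
        refine lintegral_mono fun e => ?_
        grw [henvelope e]
        rw [ENNReal.ofReal_mul (p := A ^ 2 * 8) (by positivity), ENNReal.ofReal_add
          (by positivity) (by positivity), ENNReal.ofReal_mul (p := b ^ 4) (by positivity)]
        exact le_of_eq (by ring)
    _ = _ := by
        rw [lintegral_const_mul' _ _ ENNReal.ofReal_ne_top,
          lintegral_add_left (hf.ennreal_ofReal.const_mul _),
          lintegral_const_mul' _ _ ENNReal.ofReal_ne_top,
          lintegral_const_mul' _ _ ENNReal.ofReal_ne_top, hone, mul_one]

theorem isRegularError_of_abs_log_sub_log_le (hf : Measurable f) (hpos : ∀ y, 0 < f y)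
    (hone : ∫⁻ y, ENNReal.ofReal (f y) = 1) {K : ℝ} (hK : 0 ≤ K)
    (hlip : ∀ u v, |Real.log (f u) - Real.log (f v)| ≤ K * (1 + |u| + |v|) * |u - v|)
    (hmom : ∫⁻ y, ENNReal.ofReal (y ^ 4) * ENNReal.ofReal (f y) ≠ ⊤) : IsRegularError f where
  measurable := hf
  pos := hpos
  lintegral_eq_one := hone
  exists_le_of_abs_le := exists_le_of_abs_log_sub_log_le hpos hK hlip
  exists_envelope J b hb := by
    refine ⟨fun y => (2 * K * b ^ 3 + b) * (1 + J + |y|) ^ 2,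
      (ENNReal.ofReal ((2 * K * b ^ 3 + b) ^ 2 * 8) * (ENNReal.ofReal ((1 + 2 * J) ^ 4) +
        ENNReal.ofReal (b ^ 4) * ∫⁻ y, ENNReal.ofReal (y ^ 4) * ENNReal.ofReal (f y))).toNNReal,
      by fun_prop, fun hm hm' hs hs' => abs_log_lsPDF_sub_le hpos hK hlip ?_ hm hm' hs.1 hs'.1,
      fun hm hs => ?_⟩
    · by_contra! h
      exact absurd ((one_lt_inv₀ hb).mpr h) (by linarith [hs.1, hs.2])
    · rw [ENNReal.coe_toNNReal (by finiteness)]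
      exact lintegral_sq_mul_lsPDF_le hf hone hm ((inv_pos.mpr hb).trans_le hs.1) hs.2 _

theorem lsPDF_lsPDF (η m : ℝ) {s t : ℝ} (ht : 0 < t) (y : ℝ) :
    lsPDF (lsPDF f η s) m t y = lsPDF f (m + t * η) (t * s) y := by
  have harg : ((y - m) / t - η) / s = (y - (m + t * η)) / (t * s) := by
    field_simp
    ring
  rw [lsPDF, lsPDF, lsPDF, harg, div_div, mul_comm s t]

theorem abs_add_mul_le {J b η m t : ℝ} (hb : 0 < b) (hm : |m| ≤ J) (ht : t ∈ Set.Icc b⁻¹ b) :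
    |m + t * η| ≤ J + b * |η| := by
  have ht0 : 0 < t := (inv_pos.mpr hb).trans_le ht.1
  refine (abs_add_le _ _).trans ?_
  rw [abs_mul, abs_of_pos ht0]
  gcongr
  exact ht.2

theorem mul_mem_Icc_inv {b s t : ℝ} (hb : 0 < b) (hs : 0 < s) (ht : t ∈ Set.Icc b⁻¹ b) :
    t * s ∈ Set.Icc (b * (s + s⁻¹))⁻¹ (b * (s + s⁻¹)) := by
  refine ⟨?_, mul_le_mul ht.2 (le_add_of_nonneg_right (by positivity)) hs.le hb.le⟩
  rw [mul_inv]
  exact mul_le_mul ht.1 (inv_le_of_inv_le₀ hs (le_add_of_nonneg_left hs.le)) (by positivity)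
    ((inv_pos.mpr hb).le.trans ht.1)

theorem IsLogLipschitzEnvelope.lsPDF {J b η s : ℝ} {G : ℝ → ℝ} {C : NNReal} (hs : 0 < s)
    (hb : 0 < b) (hG : IsLogLipschitzEnvelope f (J + b * |η|) (b * (s + s⁻¹)) G C) :
    IsLogLipschitzEnvelope (lsPDF f η s) J b (fun y => (1 + |η| + s) * |G y|)
      (((1 + |η| + s) ^ 2).toNNReal * C) := by
  refine ⟨hG.measurable.abs.const_mul _, fun {m m' t t'} hm hm' ht ht' y => ?_,
    fun {m t} hm ht => ?_⟩
  · have ht0 : 0 < t := (inv_pos.mpr hb).trans_le ht.1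
    have ht0' : 0 < t' := (inv_pos.mpr hb).trans_le ht'.1
    rw [lsPDF_lsPDF η m ht0, lsPDF_lsPDF η m' ht0']
    have hparam : |m + t * η - (m' + t' * η)| + |t * s - t' * s| ≤
        (|m - m'| + |t - t'|) * (1 + |η| + s) := by
      rw [add_sub_add_comm, ← sub_mul, ← sub_mul, abs_mul _ s, abs_of_pos hs]
      have := abs_add_le (m - m') ((t - t') * η)
      rw [abs_mul] at this
      nlinarith [mul_nonneg (abs_nonneg (m - m')) (abs_nonneg η),
        mul_nonneg (abs_nonneg (m - m')) hs.le, abs_nonneg (t - t')]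
    grw [hG.abs_log_sub_log_le (abs_add_mul_le hb hm ht) (abs_add_mul_le hb hm' ht')
      (mul_mem_Icc_inv hb hs ht) (mul_mem_Icc_inv hb hs ht') y, le_abs_self (G y), hparam,
      mul_assoc]
  · have ht0 : 0 < t := (inv_pos.mpr hb).trans_le ht.1
    simp only [lsPDF_lsPDF η m ht0, mul_pow, sq_abs, ENNReal.ofReal_mul (sq_nonneg (1 + |η| + s)),
      mul_assoc]
    rw [lintegral_const_mul' _ _ ENNReal.ofReal_ne_top, ENNReal.coe_mul]
    exact mul_le_mul_right (hG.lintegral_sq_le (abs_add_mul_le hb hm ht)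
      (mul_mem_Icc_inv hb hs ht)) _

theorem IsRegularError.lsPDF (hf : IsRegularError f) (η : ℝ) {s : ℝ} (hs : 0 < s) :
    IsRegularError (lsPDF f η s) where
  measurable := (hf.isProbDensity.lsPDF η hs).1
  pos y := div_pos (hf.pos _) hs
  lintegral_eq_one := (hf.isProbDensity.lsPDF η hs).2.2
  exists_le_of_abs_le R := by
    obtain ⟨c, hc, hle⟩ := hf.exists_le_of_abs_le ((R + |η|) / s)
    refine ⟨c / s, div_pos hc hs, fun y hy => div_le_div_of_nonneg_right (hle _ ?_) hs.le⟩
    rw [abs_div, abs_of_pos hs]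
    gcongr
    exact (abs_sub _ _).trans (by gcongr)
  exists_envelope J b hb := by
    obtain ⟨G, C, hG⟩ := hf.exists_envelope (J + b * |η|) (b * (s + s⁻¹)) (by positivity)
    exact ⟨_, _, hG.lsPDF hs hb⟩

end Regularity

/-! ### The error families -/

section CheckLoss

theorem lintegral_eq_add_half_lines (k : ℝ → ℝ≥0∞) :
    ∫⁻ y, k y = (∫⁻ w in Set.Ioi (0 : ℝ), k w) + ∫⁻ w in Set.Ioi (0 : ℝ), k (-w) := by
  have hneg : ∫⁻ w in Set.Ioi (0 : ℝ), k (-w) = ∫⁻ y in Set.Iio 0, k y := by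
    rw [← lintegral_indicator measurableSet_Ioi, ← lintegral_indicator measurableSet_Iio,
      ← lintegral_sub_left_eq_self ((Set.Iio 0).indicator k) 0]
    exact lintegral_congr fun w => by simp [Set.indicator]
  rw [hneg, ← lintegral_add_compl k measurableSet_Ioi, Set.compl_Ioi,
    setLIntegral_congr Iio_ae_eq_Iic]

theorem lintegral_Ioi_comp_mul (k : ℝ → ℝ≥0∞) {c : ℝ} (hc : 0 < c) :
    ∫⁻ w in Set.Ioi (0 : ℝ), k (c * w) = ENNReal.ofReal c⁻¹ * ∫⁻ w in Set.Ioi (0 : ℝ), k w := by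
  rw [← lintegral_indicator measurableSet_Ioi, ← lintegral_indicator measurableSet_Ioi,
    ← lintegral_comp_add_mul _ 0 hc]
  refine lintegral_congr fun w => ?_
  simp [Set.indicator, hc]

variable {κ : ℝ}

theorem checkLoss_eq_max (κ y : ℝ) : checkLoss κ y = max (κ * y) ((κ - 1) * y) := by
  unfold checkLoss
  split_ifs with h
  · rw [max_eq_right (by linarith)]; ring
  · rw [max_eq_left (by linarith)]; ring

theorem measurable_checkLoss (κ : ℝ) : Measurable (checkLoss κ) := by
  rw [funext (checkLoss_eq_max κ)]
  fun_prop

theorem abs_checkLoss_sub_le (hκ0 : 0 < κ) (hκ1 : κ < 1) (x y : ℝ) :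
    |checkLoss κ x - checkLoss κ y| ≤ |x - y| := by
  rw [checkLoss_eq_max, checkLoss_eq_max]
  refine (abs_max_sub_max_le_max _ _ _ _).trans (max_le ?_ ?_)
  · rw [← mul_sub, abs_mul, abs_of_pos hκ0]
    exact mul_le_of_le_one_left (abs_nonneg _) hκ1.le
  · rw [← mul_sub, abs_mul, abs_of_neg (by linarith)]
    exact mul_le_of_le_one_left (abs_nonneg _) (by linarith)

theorem mul_abs_le_checkLoss (κ y : ℝ) : κ * (1 - κ) * |y| ≤ checkLoss κ y := by
  rw [checkLoss_eq_max]
  rcases le_total 0 y with hy | hy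
  · rw [abs_of_nonneg hy]
    exact le_max_of_le_left (by nlinarith [mul_nonneg (sq_nonneg κ) hy])
  · rw [abs_of_nonpos hy]
    exact le_max_of_le_right (by nlinarith [mul_nonneg (sq_nonneg (1 - κ)) (neg_nonneg.mpr hy)])

theorem checkLoss_nonneg (hκ0 : 0 < κ) (hκ1 : κ < 1) (y : ℝ) : 0 ≤ checkLoss κ y := by
  have : 0 < 1 - κ := by linarith
  exact (by positivity : 0 ≤ κ * (1 - κ) * |y|).trans (mul_abs_le_checkLoss κ y)

theorem lintegral_comp_checkLoss (hκ0 : 0 < κ) (hκ1 : κ < 1) (k : ℝ → ℝ≥0∞) :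
    ∫⁻ y, k (checkLoss κ y) =
      ENNReal.ofReal (κ * (1 - κ))⁻¹ * ∫⁻ w in Set.Ioi (0 : ℝ), k w := by
  have hκ' : 0 < 1 - κ := by linarith
  have hright : ∀ w ∈ Set.Ioi (0 : ℝ), k (checkLoss κ w) = k (κ * w) := fun w hw => by
    rw [checkLoss, if_neg (not_lt.mpr (le_of_lt hw)), sub_zero, mul_comm]
  have hleft : ∀ w ∈ Set.Ioi (0 : ℝ), k (checkLoss κ (-w)) = k ((1 - κ) * w) := fun w hw => by
    rw [checkLoss, if_pos (neg_lt_zero.mpr hw)]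
    ring_nf
  rw [lintegral_eq_add_half_lines, setLIntegral_congr_fun measurableSet_Ioi hright,
    setLIntegral_congr_fun measurableSet_Ioi hleft, lintegral_Ioi_comp_mul k hκ0,
    lintegral_Ioi_comp_mul k hκ', ← add_mul, ← ENNReal.ofReal_add (by positivity) (by positivity)]
  congr 2
  field_simp
  ring

theorem isRegularError_comp_checkLoss (hκ0 : 0 < κ) (hκ1 : κ < 1) {g : ℝ → ℝ}
    (hg : Measurable g) (hpos : ∀ w, 0 ≤ w → 0 < g w)
    (hint : ∫⁻ w in Set.Ioi (0 : ℝ), ENNReal.ofReal (g w) = ENNReal.ofReal (κ * (1 - κ)))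
    {K : ℝ} (hK : 0 ≤ K) (hlip : ∀ w w', 0 ≤ w → 0 ≤ w' →
      |Real.log (g w) - Real.log (g w')| ≤ K * |w - w'|)
    (hmom : ∫⁻ w in Set.Ioi (0 : ℝ), ENNReal.ofReal (w ^ 4) * ENNReal.ofReal (g w) ≠ ⊤) :
    IsRegularError fun y => g (checkLoss κ y) := by
  have hκ : 0 < κ * (1 - κ) := mul_pos hκ0 (by linarith)
  have hnonneg := checkLoss_nonneg hκ0 hκ1
  refine isRegularError_of_abs_log_sub_log_le (hg.comp (measurable_checkLoss κ))
    (fun y => hpos _ (hnonneg y)) ?_ hK (fun u v => ?_) ?_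
  · rw [lintegral_comp_checkLoss hκ0 hκ1 fun w => ENNReal.ofReal (g w), hint,
      ← ENNReal.ofReal_mul (by positivity), inv_mul_cancel₀ hκ.ne', ENNReal.ofReal_one]
  · calc _ ≤ K * |checkLoss κ u - checkLoss κ v| := hlip _ _ (hnonneg u) (hnonneg v)
      _ ≤ K * |u - v| := by grw [abs_checkLoss_sub_le hκ0 hκ1]
      _ ≤ K * (1 + |u| + |v|) * |u - v| := by
        gcongr
        exact le_mul_of_one_le_right hK (by linarith [abs_nonneg u, abs_nonneg v])
  · have hbound : ∀ y, ENNReal.ofReal (y ^ 4) ≤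
        ENNReal.ofReal (κ * (1 - κ))⁻¹ ^ 4 * ENNReal.ofReal (checkLoss κ y ^ 4) := fun y => by
      rw [← ENNReal.ofReal_pow (by positivity), ← ENNReal.ofReal_mul (by positivity), ← mul_pow,
        ← Even.pow_abs (by decide) y]
      gcongr
      rw [inv_mul_eq_div, le_div_iff₀' hκ]
      exact mul_abs_le_checkLoss κ y
    refine ne_top_of_le_ne_top ?_ (lintegral_mono fun y => mul_le_mul_left (hbound y) _)
    simp only [mul_assoc]
    rw [lintegral_const_mul' _ _ (by finiteness), lintegral_comp_checkLoss hκ0 hκ1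
      fun w => ENNReal.ofReal (w ^ 4) * ENNReal.ofReal (g w)]
    finiteness

end CheckLoss

section TruncatedGamma

/-- The profile `(a + w)^a e^{-(a + w)}` on `[0, ∞)` out of which the two sides of the truncated
gamma density are glued. -/
noncomputable def gammaProfile (a w : ℝ) : ℝ := (a + w) ^ a * Real.exp (-(a + w))

variable {a : ℝ}

theorem gammaProfile_pos (ha : 0 ≤ a) {w : ℝ} (hw : 0 ≤ w) : 0 < gammaProfile a w := by
  refine mul_pos ?_ (Real.exp_pos _)
  rcases ha.eq_or_lt with rfl | ha
  · simp
  · positivity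

theorem measurable_gammaProfile (a : ℝ) : Measurable (gammaProfile a) := by
  unfold gammaProfile
  fun_prop

theorem integrableOn_rpow_mul_exp_neg {t : ℝ} (ha : 0 ≤ a) (ht : 0 ≤ t) :
    IntegrableOn (fun x : ℝ => x ^ t * Real.exp (-x)) (Set.Ioi a) := by
  have hΓ := Real.GammaIntegral_convergent (s := t + 1) (by linarith)
  rw [add_sub_cancel_right] at hΓ
  exact (hΓ.mono_set (Set.Ioi_subset_Ioi ha)).congr_fun (fun x _ => mul_comm _ _)
    measurableSet_Ioi

theorem lintegral_Ioi_comp_add (k : ℝ → ℝ≥0∞) (a : ℝ) :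
    ∫⁻ w in Set.Ioi (0 : ℝ), k (a + w) = ∫⁻ x in Set.Ioi a, k x := by
  rw [← lintegral_indicator measurableSet_Ioi, ← lintegral_indicator measurableSet_Ioi,
    ← lintegral_add_left_eq_self ((Set.Ioi a).indicator k) a]
  exact lintegral_congr fun w => by simp [Set.indicator]

theorem lintegral_gammaProfile (ha : 0 ≤ a) :
    ∫⁻ w in Set.Ioi (0 : ℝ), ENNReal.ofReal (gammaProfile a w) =
      ENNReal.ofReal (upperGamma (a + 1) a) := by
  simp only [gammaProfile]
  rw [lintegral_Ioi_comp_add fun x => ENNReal.ofReal (x ^ a * Real.exp (-x)), upperGamma,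
    add_sub_cancel_right, ofReal_integral_eq_lintegral_ofReal (integrableOn_rpow_mul_exp_neg ha ha)]
  refine (ae_restrict_mem measurableSet_Ioi).mono fun x hx => ?_
  have : 0 < x := ha.trans_lt hx
  positivity

theorem upperGamma_pos (ha : 0 ≤ a) : 0 < upperGamma (a + 1) a := by
  rw [← ENNReal.ofReal_pos, ← lintegral_gammaProfile ha, setLIntegral_pos_iff
    (measurable_gammaProfile a).ennreal_ofReal]
  have hsub : Set.Ioi 0 ⊆
      Function.support (fun w => ENNReal.ofReal (gammaProfile a w)) ∩ Set.Ioi 0 := fun w hw =>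
    ⟨(ENNReal.ofReal_pos.mpr (gammaProfile_pos ha (le_of_lt hw))).ne', hw⟩
  exact (by simp : 0 < volume (Set.Ioi (0 : ℝ))).trans_le (measure_mono hsub)

theorem lintegral_pow_mul_gammaProfile_ne_top (ha : 0 ≤ a) (n : ℕ) :
    ∫⁻ w in Set.Ioi (0 : ℝ), ENNReal.ofReal (w ^ n) * ENNReal.ofReal (gammaProfile a w) ≠ ⊤ := by
  have hfin : ∫⁻ w in Set.Ioi (0 : ℝ), ENNReal.ofReal ((a + w) ^ (a + n) * Real.exp (-(a + w))) ≠
      ⊤ := by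
    rw [lintegral_Ioi_comp_add fun x => ENNReal.ofReal (x ^ (a + n) * Real.exp (-x))]
    exact (integrableOn_rpow_mul_exp_neg ha (by positivity)).lintegral_lt_top.ne
  refine ne_top_of_le_ne_top hfin (setLIntegral_mono' measurableSet_Ioi fun w hw => ?_)
  have hw0 : 0 < w := hw
  have haw : 0 < a + w := by linarith
  rw [← ENNReal.ofReal_mul (by positivity), gammaProfile, Real.rpow_add haw, Real.rpow_natCast,
    ← mul_assoc, mul_comm (w ^ n)]
  gcongr
  linarith

theorem abs_log_gammaProfile_sub_le (ha : 0 ≤ a) {w w' : ℝ} (hw : 0 ≤ w) (hw' : 0 ≤ w') :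
    |Real.log (gammaProfile a w) - Real.log (gammaProfile a w')| ≤ 2 * |w - w'| := by
  rcases ha.eq_or_lt with rfl | ha
  · simp only [gammaProfile, Real.rpow_zero, one_mul, Real.log_exp, zero_add]
    rw [neg_sub_neg, abs_sub_comm]
    linarith [abs_nonneg (w - w')]
  have hlog : ∀ v, 0 ≤ v → Real.log (gammaProfile a v) = a * Real.log (a + v) - (a + v) :=
    fun v hv => by
      rw [gammaProfile, Real.log_mul (by positivity) (by positivity),
        Real.log_rpow (by positivity), Real.log_exp, sub_eq_add_neg]
  have hlip : a * |Real.log (a + w) - Real.log (a + w')| ≤ |w - w'| := by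
    have := abs_log_sub_log_le (b := a⁻¹) (s := a + w) (s' := a + w') (by positivity)
      (by rw [inv_inv]; linarith) (by rw [inv_inv]; linarith)
    rwa [add_sub_add_left_eq_sub, inv_mul_eq_div, le_div_iff₀' ha] at this
  calc _ = |a * (Real.log (a + w) - Real.log (a + w')) - (w - w')| := by
        rw [hlog w hw, hlog w' hw']
        ring_nf
    _ ≤ a * |Real.log (a + w) - Real.log (a + w')| + |w - w'| := by
        grw [abs_sub, abs_mul, abs_of_pos ha]
    _ ≤ 2 * |w - w'| := by linarith

theorem acdtgPDF_eq_lsPDF (η s a κ : ℝ) : acdtgPDF η s a κ =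
    lsPDF (fun y => κ * (1 - κ) / upperGamma (a + 1) a * gammaProfile a (checkLoss κ y)) η s := by
  funext y
  rw [acdtgPDF, lsPDF, gammaProfile, mul_comm s, ← div_div]
  ring

theorem isRegularError_acdtgPDF {η s a κ : ℝ} (hs : 0 < s) (ha : 0 ≤ a) (hκ0 : 0 < κ)
    (hκ1 : κ < 1) : IsRegularError (acdtgPDF η s a κ) := by
  have hΓ := upperGamma_pos ha
  have hc : 0 < κ * (1 - κ) / upperGamma (a + 1) a :=
    div_pos (mul_pos hκ0 (sub_pos.mpr hκ1)) hΓ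
  rw [acdtgPDF_eq_lsPDF]
  refine (isRegularError_comp_checkLoss hκ0 hκ1
    (g := fun w => κ * (1 - κ) / upperGamma (a + 1) a * gammaProfile a w)
    ((measurable_gammaProfile a).const_mul _)
    (fun w hw => mul_pos hc (gammaProfile_pos ha hw)) ?_ zero_le_two (fun w w' hw hw' => ?_)
    ?_).lsPDF η hs
  · simp only [ENNReal.ofReal_mul hc.le]
    rw [lintegral_const_mul' _ _ ENNReal.ofReal_ne_top, lintegral_gammaProfile ha,
      ← ENNReal.ofReal_mul hc.le, div_mul_cancel₀ _ hΓ.ne']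
  · rw [Real.log_mul hc.ne' (gammaProfile_pos ha hw).ne', Real.log_mul hc.ne'
      (gammaProfile_pos ha hw').ne', add_sub_add_left_eq_sub]
    exact abs_log_gammaProfile_sub_le ha hw hw'
  · simp only [ENNReal.ofReal_mul hc.le,
      mul_left_comm _ (ENNReal.ofReal (κ * (1 - κ) / upperGamma (a + 1) a))]
    rw [lintegral_const_mul' _ _ ENNReal.ofReal_ne_top]
    have := lintegral_pow_mul_gammaProfile_ne_top ha 4
    finiteness

theorem aldPDF_eq_acdtgPDF (η s κ : ℝ) : aldPDF η s κ = acdtgPDF η s 0 κ := by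
  have hΓ : upperGamma (0 + 1) 0 = 1 := by
    simpa only [upperGamma, add_sub_cancel_right, Real.rpow_zero, one_mul] using
      integral_exp_neg_Ioi_zero
  funext y
  rw [aldPDF, acdtgPDF, hΓ]
  simp

end TruncatedGamma

section NormalLaplace

theorem cnlPDF_eq_lsPDF (η κ β : ℝ) {s : ℝ} (hs : 0 < s) :
    cnlPDF η s κ β = lsPDF (cnlPDF 0 1 κ β) η s := by
  funext y
  have hle : (y - η) / s ≤ 0 ↔ y ≤ η := by rw [div_le_iff₀ hs, zero_mul, sub_nonpos]
  simp only [cnlPDF, lsPDF, sub_zero, mul_one, hle]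
  split_ifs <;> field_simp

variable {κ β : ℝ}

theorem cnlPDF_zero_one (hc : (1 - κ) / β = 2 * κ / √(2 * Real.pi)) (y : ℝ) :
    cnlPDF 0 1 κ β y =
      2 * κ / √(2 * Real.pi) * Real.exp (-(min y 0 ^ 2 / 2 + max y 0 / β)) := by
  rw [cnlPDF]
  split_ifs with hy
  · rw [min_eq_left hy, max_eq_right hy]
    ring_nf
  · rw [min_eq_right (not_le.mp hy).le, max_eq_left (not_le.mp hy).le, mul_one, hc]
    ring_nf

theorem lintegral_pow_mul_exp_neg_mul_rpow_ne_top (n : ℕ) {c p : ℝ} (hc : 0 < c) (hp : 0 < p) :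
    ∫⁻ w in Set.Ioi (0 : ℝ), ENNReal.ofReal (w ^ n) * ENNReal.ofReal (Real.exp (-c * w ^ p)) ≠
      ⊤ := by
  have hfin := (integrableOn_rpow_mul_exp_neg_mul_rpow (s := n) (p := p) (b := c)
    (neg_one_lt_zero.trans_le n.cast_nonneg) hp hc).lintegral_lt_top
  refine ne_top_of_le_ne_top hfin.ne (setLIntegral_mono' measurableSet_Ioi fun w hw => ?_)
  rw [Real.rpow_natCast, ENNReal.ofReal_mul (pow_nonneg (le_of_lt hw) n)]

theorem lintegral_exp_neg_mul_Ioi {c : ℝ} (hc : 0 < c) :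
    ∫⁻ w in Set.Ioi (0 : ℝ), ENNReal.ofReal (Real.exp (-c * w)) = ENNReal.ofReal c⁻¹ := by
  simp only [neg_mul]
  rw [lintegral_Ioi_comp_mul (fun w => ENNReal.ofReal (Real.exp (-w))) hc,
    ← ofReal_integral_eq_lintegral_ofReal (integrableOn_exp_neg_Ioi 0)
      (ae_of_all _ fun w => (Real.exp_pos _).le), integral_exp_neg_Ioi_zero, ENNReal.ofReal_one,
    mul_one]

theorem lintegral_exp_neg_mul_sq_Ioi {c : ℝ} (hc : 0 < c) :
    ∫⁻ w in Set.Ioi (0 : ℝ), ENNReal.ofReal (Real.exp (-c * w ^ 2)) =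
      ENNReal.ofReal (√(Real.pi / c) / 2) := by
  rw [← integral_gaussian_Ioi, ofReal_integral_eq_lintegral_ofReal
    (integrable_exp_neg_mul_sq hc).integrableOn (ae_of_all _ fun w => (Real.exp_pos _).le)]

theorem lintegral_mul_cnlPDF {k : ℝ → ℝ≥0∞} (hk : ∀ w, k (-w) = k w) (hκ0 : 0 < κ)
    (hc : (1 - κ) / β = 2 * κ / √(2 * Real.pi)) :
    ∫⁻ y, k y * ENNReal.ofReal (cnlPDF 0 1 κ β y) =
      ENNReal.ofReal (2 * κ / √(2 * Real.pi)) *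
        ((∫⁻ w in Set.Ioi (0 : ℝ), k w * ENNReal.ofReal (Real.exp (-β⁻¹ * w))) +
          ∫⁻ w in Set.Ioi (0 : ℝ), k w * ENNReal.ofReal (Real.exp (-(1 / 2) * w ^ 2))) := by
  have hA : 0 ≤ 2 * κ / √(2 * Real.pi) := by positivity
  have hright : ∀ w ∈ Set.Ioi (0 : ℝ), k w * ENNReal.ofReal (cnlPDF 0 1 κ β w) =
      ENNReal.ofReal (2 * κ / √(2 * Real.pi)) *
        (k w * ENNReal.ofReal (Real.exp (-β⁻¹ * w))) := fun w hw => by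
    rw [cnlPDF_zero_one hc, min_eq_right (le_of_lt hw), max_eq_left (le_of_lt hw),
      ENNReal.ofReal_mul hA, mul_left_comm]
    ring_nf
  have hleft : ∀ w ∈ Set.Ioi (0 : ℝ), k (-w) * ENNReal.ofReal (cnlPDF 0 1 κ β (-w)) =
      ENNReal.ofReal (2 * κ / √(2 * Real.pi)) *
        (k w * ENNReal.ofReal (Real.exp (-(1 / 2) * w ^ 2))) := fun w hw => by
    have hw' : -w ≤ 0 := neg_nonpos.mpr (le_of_lt hw)
    rw [cnlPDF_zero_one hc, min_eq_left hw', max_eq_right hw', ENNReal.ofReal_mul hA,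
      mul_left_comm, hk]
    ring_nf
  rw [lintegral_eq_add_half_lines, setLIntegral_congr_fun measurableSet_Ioi hright,
    setLIntegral_congr_fun measurableSet_Ioi hleft, lintegral_const_mul' _ _ ENNReal.ofReal_ne_top,
    lintegral_const_mul' _ _ ENNReal.ofReal_ne_top, mul_add]

theorem lintegral_cnlPDF (hκ0 : 0 < κ) (hκ1 : κ < 1) (hβ : 0 < β)
    (hc : (1 - κ) / β = 2 * κ / √(2 * Real.pi)) :
    ∫⁻ y, ENNReal.ofReal (cnlPDF 0 1 κ β y) = 1 := by
  have hright : 2 * κ / √(2 * Real.pi) * β = 1 - κ := by rw [← hc, div_mul_cancel₀ _ hβ.ne']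
  have hleft : 2 * κ / √(2 * Real.pi) * (√(Real.pi / (1 / 2)) / 2) = κ := by
    rw [show Real.pi / (1 / 2) = 2 * Real.pi by ring]
    have : √(2 * Real.pi) ≠ 0 := by positivity
    field_simp
  have h := lintegral_mul_cnlPDF (k := 1) (fun _ => rfl) hκ0 hc
  simp only [Pi.one_apply, one_mul] at h
  rw [h, lintegral_exp_neg_mul_Ioi (inv_pos.mpr hβ), lintegral_exp_neg_mul_sq_Ioi one_half_pos,
    inv_inv, mul_add, ← ENNReal.ofReal_mul (by positivity), ← ENNReal.ofReal_mul (by positivity),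
    hright, hleft, ← ENNReal.ofReal_add (by linarith) hκ0.le, sub_add_cancel, ENNReal.ofReal_one]

theorem lintegral_pow_four_mul_cnlPDF_ne_top (hκ0 : 0 < κ) (hβ : 0 < β)
    (hc : (1 - κ) / β = 2 * κ / √(2 * Real.pi)) :
    ∫⁻ y, ENNReal.ofReal (y ^ 4) * ENNReal.ofReal (cnlPDF 0 1 κ β y) ≠ ⊤ := by
  rw [lintegral_mul_cnlPDF (k := fun y => ENNReal.ofReal (y ^ 4))
    (fun w => by rw [Even.neg_pow (by decide)]) hκ0 hc]
  have hright := lintegral_pow_mul_exp_neg_mul_rpow_ne_top 4 (inv_pos.mpr hβ) one_pos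
  have hleft := lintegral_pow_mul_exp_neg_mul_rpow_ne_top 4 one_half_pos two_pos
  simp only [Real.rpow_one, Real.rpow_two] at hright hleft
  finiteness

theorem abs_log_cnlPDF_sub_le (hκ0 : 0 < κ) (hβ : 0 < β)
    (hc : (1 - κ) / β = 2 * κ / √(2 * Real.pi)) (u v : ℝ) :
    |Real.log (cnlPDF 0 1 κ β u) - Real.log (cnlPDF 0 1 κ β v)| ≤
      (1 / 2 + β⁻¹) * (1 + |u| + |v|) * |u - v| := by
  have hA : 2 * κ / √(2 * Real.pi) ≠ 0 := by positivity
  rw [cnlPDF_zero_one hc, cnlPDF_zero_one hc, Real.log_mul hA (Real.exp_ne_zero _),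
    Real.log_mul hA (Real.exp_ne_zero _), add_sub_add_left_eq_sub, Real.log_exp, Real.log_exp]
  have hmin : |min u 0 - min v 0| ≤ |u - v| := by
    simpa using abs_min_sub_min_le_max u 0 v 0
  have hmax : |max u 0 - max v 0| ≤ |u - v| := by
    simpa using abs_max_sub_max_le_max u 0 v 0
  have habs : ∀ t : ℝ, |min t 0| ≤ |t| := fun t => by
    simpa using abs_min_sub_min_le_max t 0 0 0
  calc _ = |1 / 2 * ((min u 0 + min v 0) * (min u 0 - min v 0)) +
          β⁻¹ * (max u 0 - max v 0)| := by
        rw [← abs_neg]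
        ring_nf
    _ ≤ 1 / 2 * ((|min u 0| + |min v 0|) * |min u 0 - min v 0|) +
          β⁻¹ * |max u 0 - max v 0| := by
        grw [abs_add_le, abs_mul, abs_mul (β⁻¹), abs_mul (min u 0 + min v 0), abs_add_le (min u 0)]
        rw [abs_of_pos one_half_pos, abs_of_pos (inv_pos.mpr hβ)]
    _ ≤ 1 / 2 * ((1 + |u| + |v|) * |u - v|) + β⁻¹ * ((1 + |u| + |v|) * |u - v|) := by
        have hsum : |min u 0| + |min v 0| ≤ 1 + |u| + |v| := by linarith [habs u, habs v]
        have hone : 1 ≤ 1 + |u| + |v| := by linarith [abs_nonneg u, abs_nonneg v]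
        have hmax_le := hmax.trans (le_mul_of_one_le_left (abs_nonneg _) hone)
        grw [hsum, hmin, hmax_le]
    _ = _ := by ring

theorem isRegularError_cnlPDF (η : ℝ) {s : ℝ} (hs : 0 < s) (hκ0 : 0 < κ) (hκ1 : κ < 1)
    (hβ : 0 < β) (hc : (1 - κ) / β = 2 * κ / √(2 * Real.pi)) :
    IsRegularError (cnlPDF η s κ β) := by
  rw [cnlPDF_eq_lsPDF η κ β hs]
  refine (isRegularError_of_abs_log_sub_log_le ?_ (fun y => ?_) (lintegral_cnlPDF hκ0 hκ1 hβ hc)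
    (by positivity) (abs_log_cnlPDF_sub_le hκ0 hβ hc)
    (lintegral_pow_four_mul_cnlPDF_ne_top hκ0 hβ hc)).lsPDF η hs
  · rw [funext (cnlPDF_zero_one hc)]
    fun_prop
  · rw [cnlPDF_zero_one hc]
    positivity

end NormalLaplace

section Cauchy

theorem cauchyPDFReal_eq_lsPDF (η : ℝ) {s : NNReal} (hs : 0 < s) :
    cauchyPDFReal η s = lsPDF (cauchyPDFReal 0 1) η s := by
  funext y
  have : (0 : ℝ) < s := hs
  simp only [lsPDF, cauchyPDFReal_def, NNReal.coe_one, sub_zero]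
  field_simp

theorem log_lsPDF_cauchyPDFReal {s : ℝ} (hs : 0 < s) (m y : ℝ) :
    Real.log (lsPDF (cauchyPDFReal 0 1) m s y) =
      Real.log s - 2 * Real.log ‖(⟨s, y - m⟩ : ℂ)‖ - Real.log Real.pi := by
  have hnorm : ‖(⟨s, y - m⟩ : ℂ)‖ ^ 2 = s ^ 2 + (y - m) ^ 2 := by
    rw [Complex.sq_norm, Complex.normSq_mk]
    ring
  have hpdf : lsPDF (cauchyPDFReal 0 1) m s y = s / ‖(⟨s, y - m⟩ : ℂ)‖ ^ 2 / Real.pi := by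
    rw [hnorm, lsPDF, cauchyPDFReal_def]
    simp only [NNReal.coe_one, sub_zero]
    field_simp
    ring
  have hne : ‖(⟨s, y - m⟩ : ℂ)‖ ^ 2 ≠ 0 := by rw [hnorm]; positivity
  rw [hpdf, Real.log_div (div_ne_zero hs.ne' hne) Real.pi_ne_zero, Real.log_div hs.ne' hne,
    Real.log_pow, Nat.cast_ofNat]

theorem abs_log_lsPDF_cauchyPDFReal_sub_le {b m m' s s' : ℝ} (hb : 0 < b) (hs : b⁻¹ ≤ s)
    (hs' : b⁻¹ ≤ s') (y : ℝ) :
    |Real.log (lsPDF (cauchyPDFReal 0 1) m s y) - Real.log (lsPDF (cauchyPDFReal 0 1) m' s' y)| ≤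
      (|m - m'| + |s - s'|) * (3 * b) := by
  have hs0 := (inv_pos.mpr hb).trans_le hs
  have hs0' := (inv_pos.mpr hb).trans_le hs'
  rw [log_lsPDF_cauchyPDFReal hs0, log_lsPDF_cauchyPDFReal hs0']
  have hre_le_norm : ∀ {t x : ℝ}, b⁻¹ ≤ t → b⁻¹ ≤ ‖(⟨t, x⟩ : ℂ)‖ := fun {t x} ht =>
    ht.trans ((le_abs_self t).trans (Complex.abs_re_le_norm ⟨t, x⟩))
  have hdist : |‖(⟨s, y - m⟩ : ℂ)‖ - ‖(⟨s', y - m'⟩ : ℂ)‖| ≤ |m - m'| + |s - s'| := by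
    refine (abs_norm_sub_norm_le _ _).trans ((Complex.norm_le_abs_re_add_abs_im _).trans ?_)
    simp only [Complex.sub_re, Complex.sub_im, sub_sub_sub_cancel_left]
    rw [add_comm, abs_sub_comm m' m]
  have hnorm := abs_log_sub_log_le hb (hre_le_norm (x := y - m) hs)
    (hre_le_norm (x := y - m') hs')
  calc _ = |(Real.log s - Real.log s') -
          2 * (Real.log ‖(⟨s, y - m⟩ : ℂ)‖ - Real.log ‖(⟨s', y - m'⟩ : ℂ)‖)| := by ring_nf
    _ ≤ b * |s - s'| + 2 * (b * (|m - m'| + |s - s'|)) := by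
        grw [abs_sub, abs_mul, abs_two, hnorm, hdist, abs_log_sub_log_le hb hs hs']
    _ ≤ _ := by nlinarith [abs_nonneg (m - m')]

theorem isRegularError_cauchyPDFReal (η : ℝ) {s : NNReal} (hs : 0 < s) :
    IsRegularError (cauchyPDFReal η s) := by
  rw [cauchyPDFReal_eq_lsPDF η hs]
  refine IsRegularError.lsPDF ⟨measurable_cauchyPDFReal 0 1, cauchyPDF_pos 0 one_ne_zero,
    lintegral_cauchyPDF_eq_one 0 one_ne_zero, fun R => ?_, fun J b hb => ?_⟩ η hs
  · refine ⟨Real.pi⁻¹ * (R ^ 2 + 1)⁻¹, by positivity, fun y hy => ?_⟩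
    have hyR : y ^ 2 ≤ R ^ 2 := sq_le_sq.mpr (hy.trans (le_abs_self R))
    simp only [cauchyPDFReal_def, NNReal.coe_one, sub_zero, one_pow, mul_one]
    gcongr
  · refine ⟨fun _ => 3 * b, ((3 * b) ^ 2).toNNReal, measurable_const,
      fun _ _ hs hs' => abs_log_lsPDF_cauchyPDFReal_sub_le hb hs.1 hs'.1, fun {m t} _ ht => ?_⟩
    rw [lintegral_mul_lsPDF _ _ ((inv_pos.mpr hb).trans_le ht.1),
      lintegral_const_mul' _ _ ENNReal.ofReal_ne_top]
    exact ((congrArg _ (lintegral_cauchyPDF_eq_one 0 one_ne_zero)).trans (mul_one _)).le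

end Cauchy

theorem IsErrorDensity.isRegularError {f : ℝ → ℝ} (hf : IsErrorDensity f) : IsRegularError f := by
  cases hf with
  | ald η s κ hs hκ0 hκ1 =>
    rw [aldPDF_eq_acdtgPDF]
    exact isRegularError_acdtgPDF hs le_rfl hκ0 hκ1
  | acdtg η s a κ hs ha hκ0 hκ1 => exact isRegularError_acdtgPDF hs ha hκ0 hκ1
  | cnl η s κ β hs hκ0 hκ1 hβ hc => exact isRegularError_cnlPDF η hs hκ0 hκ1 hβ hc
  | cauchy η s hs => exact isRegularError_cauchyPDFReal η hs

end LocScale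

theorem corollary1_general {X : Type*} [MeasurableSpace X] (ν : Measure X)
    (τ : ℝ) (hτ0 : 0 < τ) (hτ1 : τ < 1) (f : ℝ → ℝ) (hf : LocScale.IsRegularError f)
    (hq : LocScale.quantile (LocScale.errorLaw f) τ = 0) (U S H : Set (X → ℝ))
    (hU : ∀ μ ∈ U, Measurable μ) (hUb : ∃ J : ℝ, ∀ μ ∈ U, ∀ x, |μ x| ≤ J)
    (hSne : S.Nonempty) (hS : ∀ σ ∈ S, Measurable σ)
    (hSb : ∃ b : ℝ, 1 < b ∧ ∀ σ ∈ S, ∀ x, b⁻¹ ≤ σ x ∧ σ x ≤ b)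
    (hH : ∀ h ∈ H, LocScale.IsProbDensity ν h)
    (h₀ : X → ℝ) (hh₀ : h₀ ∈ H) (hdom : ∃ C : ℝ, ∀ h ∈ H, ∀ x, h x ≤ C * h₀ x)
    (hent : LocScale.EntropyCondition ν h₀ U S) :
    (∃ ε : ℕ → ℝ, LocScale.SolvesEntropyEquation ν h₀ U ε) ∧
    ∀ ε : ℕ → ℝ, LocScale.SolvesEntropyEquation ν h₀ U ε →
      LocScale.HasSqRate (LocScale.minimaxRisk ν f U S H) ε := by
  obtain ⟨hTU, hTS, ⟨M, hM, hrich, hreg⟩, hSU⟩ := hent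
  obtain ⟨J, hJ⟩ := hUb
  obtain ⟨b, hb1, hb⟩ := hSb
  obtain ⟨C₀, hC₀⟩ := hdom
  obtain ⟨σ, hσ⟩ := hSne
  have hb0 : 0 < b := one_pos.trans hb1
  have hθ : ∀ μ ∈ U, ∀ σ ∈ S, LocScale.IsLocScaleParam J b μ σ := fun μ hμ σ hσ =>
    ⟨hU μ hμ, hS σ hσ, hJ μ hμ, hb σ hσ⟩
  have hanti := LocScale.packingEntropy_antitoneOn hTU
  refine ⟨LocScale.exists_solution LocScale.packingEntropy_nonneg hanti
    (hrich.eventually_pos hM LocScale.packingEntropy_nonneg) (hreg.congr hM), fun ε hε => ?_⟩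
  obtain ⟨K, hK, hbound⟩ := hε.2.2.exists_pos
  have hε0 : Tendsto ε atTop (𝓝[>] 0) :=
    LocScale.tendsto_nhdsGT_zero_of_mul_sq_le hanti hK.le hε.1 <| hbound.bound.mono fun n hn => by
      rwa [Real.norm_of_nonneg (by positivity),
        Real.norm_of_nonneg (LocScale.packingEntropy_nonneg _)] at hn
  obtain ⟨c, hc, hlower⟩ := LocScale.exists_minimaxRisk_ge hf hb0 (fun μ hμ => hθ μ hμ σ hσ) hσ hh₀
    (hH h₀ hh₀) hTU hM hrich hε hε0
  obtain ⟨C, hC, hupper⟩ := LocScale.exists_minimaxRisk_le hf hτ0 hτ1 hq hb0 hθ hH (hH h₀ hh₀).2.1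
    hC₀ hTU hTS hSU hε hε0
  exact ⟨c, C, hc, hC, hlower.and hupper⟩

theorem corollary1 {X : Type*} [MeasurableSpace X] (ν : Measure X) [SigmaFinite ν]
    -- error density with `τ`-th quantile zero
    (τ : ℝ) (hτ0 : 0 < τ) (hτ1 : τ < 1) (f : ℝ → ℝ) (hf : LocScale.IsErrorDensity f)
    (hq : LocScale.quantile (LocScale.errorLaw f) τ = 0)
    -- regression functions, scale functions, covariate densities
    (U S H : Set (X → ℝ))
    (hU : ∀ μ ∈ U, Measurable μ) (hUb : ∃ J : ℝ, ∀ μ ∈ U, ∀ x, |μ x| ≤ J)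
    (hSne : S.Nonempty) (hS : ∀ σ ∈ S, Measurable σ)
    (hSb : ∃ b : ℝ, 1 < b ∧ ∀ σ ∈ S, ∀ x, b⁻¹ ≤ σ x ∧ σ x ≤ b)
    (hH : ∀ h ∈ H, LocScale.IsProbDensity ν h)
    -- dominating density
    (h₀ : X → ℝ) (hh₀ : h₀ ∈ H) (hdom : ∃ C : ℝ, ∀ h ∈ H, ∀ x, h x ≤ C * h₀ x)
    -- entropy condition
    (hent : LocScale.EntropyCondition ν h₀ U S) :
    (∃ ε : ℕ → ℝ, LocScale.SolvesEntropyEquation ν h₀ U ε) ∧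
    ∀ ε : ℕ → ℝ, LocScale.SolvesEntropyEquation ν h₀ U ε →
      LocScale.HasSqRate (LocScale.minimaxRisk ν f U S H) ε := by
  exact corollary1_general ν τ hτ0 hτ1 f hf.isRegularError hq U S H hU hUb hSne hS hSb hH h₀ hh₀
    hdom hent
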